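/- Let $1\le p\le q<n$ and let $U\subset\mathbb C^n$ be a connected non-empty open set (the domain of a chart). Consider on $U$ a completely decomposable holomorphic $d$-web of codimension $q$: foliations $\mathcal F_1,\dots,\mathcal F_d$ given by holomorphic submersions $u_i=(u_{i,1},\dots,u_{i,q}):U\to\mathbb C^q$, $T\mathcal F_i=\ker du_i$ (no condition on their relative position is needed). A holomorphic $p$-form $\omega$ is $\mathcal F_i$-basic if $i_X\omega=0$ and $L_X\omega=0$ for all $X$ tangent to $\mathcal F_i$; locally $\omega=\sum_A (f_A\circ u_i)\,du_{i,A}$ with $A=(\alpha_1<\dots<\alpha_p)$, $du_{i,A}=du_{i,\alpha_1}\wedge\dots\wedge du_{i,\alpha_p}$. A $p$-abelian relation is a family $(\omega_i)_{1\le i\le d}$ of $\mathcal F_i$-basic $p$-forms with $\sum_i\omega_i=0$; it is closed if all $d\omega_i=0$. The $p$-rank (resp. closed $p$-rank) of the web is the supremum over $m\in U$ of the dimension of the space of germs at $m$ of $p$-abelian (resp. closed $p$-abelian) relations. Put $b(r,s)=\binom rs$, $c(r,h)=\binom{r-1+h}{h}$, $z(r,p,k)=b(r+k,r-p)\,c(p,k)$.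 Set $a(r,k)=b(r,p)\,c(r,k)$ (resp. $a(r,k)=z(r,p,k)$), let $k_0$ be the largest $k\geq0$ with $a(n,k)/a(q,k)\le d$, and put $$\pi=\sum_{h\ge0}a(q,h)\Bigl(d-\frac{a(n,h)}{a(q,h)}\Bigr)^+ ,$$ that is, $\pi=\pi^0_p(n,d,q)$ (resp. $\pi=\pi'_p(n,d,q)$). For $\omega_i=\sum_A(f_{i,A}\circ u_i)\,du_{i,A}$ the equation $\sum_i\omega_i=0$ reads $(E_B)$: $\sum_{i,A}(f_{i,A}\circ u_i)J_{i,B}^A=0$ for all $B=(\lambda_1<\dots<\lambda_p)$, where $J_{i,B}^A=\det\bigl(\partial u_{i,\alpha_a}/\partial x_{\lambda_b}\bigr)$. Its derivative $(E_B)'_L$ is $\sum_{i,A}\sum_{|K|\le|L|}M_{B,L}^{i,A,K}\,\bigl((f_{i,A})'_K\circ u_i\bigr)=0$, with coefficients depending only on the $u_i$. The fibre at $x$ of the space $R_k$ of formal $p$-abelian relations of order $k$ is the set of vectors $(w(i,A,K))_{|K|\le k}$ (candidates for $(f_{i,A})'_K(u_i(x))$) satisfying at $x$ all these linear equations with $|L|\le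 k$ (resp. and whose part of each order $h\leq k$ lies in the kernel of the Koszul differential $S^h\otimes\Lambda^p\to S^{h-1}\otimes\Lambda^{p+1}$ in the $q$ variables of each $u_i$); $R_{-1}=0$. Let $P_k$ be the matrix $(M_{B,L}^{i,A,K})_{|L|=|K|=k}$ (resp. its restriction to that kernel). The web is $p$-ordinary (resp. strongly $p$-ordinary) if for all $k\ge0$, at every point of $U$, $P_k$ has the maximal rank $\min(a(n,k),\,d\,a(q,k))$. It is $p$-calibrated (resp. strongly $p$-calibrated) if $d=a(n,k_0)/a(q,k_0)$. **Theorem.** Assume that the web is $p$-ordinary and $p$-calibrated (resp. strongly $p$-ordinary and strongly $p$-calibrated). Then $\mathcal E:=R_{k_0-1}$ and $R_{k_0}$ are holomorphic vector bundles of rank $\pi$ on $U$, the projection $R_{k_0}\to\mathcal E$ is bijective on each fibre, and, if $\ell$ is its inverse and $\iota:R_{k_0}\to J^1\mathcal E$ the natural inclusion (given by $\partial_\lambda (f'_K\circ u_i)=\sum_\alpha (f'_{K+1_\alpha}\circ u_i)\,\partial_\lambda u_{i,\alpha}$), the formula $\nabla s=j^1s-\iota(\ell(s))$ defines a holomorphic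 connection on $\mathcal E$. Moreover: (i) for every open $V\subset U$, the map $\sigma\mapsto j^{k_0-1}\sigma$ is a linear isomorphism from the space of $p$-abelian relations (resp. closed $p$-abelian relations) on $V$ onto the space of holomorphic sections $s$ of $\mathcal E$ over $V$ with $\nabla s=0$; (ii) the $p$-rank (resp. closed $p$-rank) of the web is equal to $\pi$ if and only if the curvature of $\nabla$ vanishes identically on $U$. -/

import Mathlib

open Filter Topology

noncomputable section

namespace WebTheory

/-- The two parallel theories: all abelian relations (`all`, attached to ordinary webs) and closed
abelian relations (`closed`, attached to strongly ordinary webs). -/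
inductive RelKind
  | all
  | closed

/-! ### Numbers -/

/-- `c(r,h) = b(r-1+h,h)`, the dimension of the space of homogeneous polynomials of degree `h` in
`r` variables. -/
def homDim (r h : ℕ) : ℕ := (r - 1 + h).choose h

/-- `b(r,p) c(r,k)`, resp. `z(r,p,k) = b(r+k,r-p) c(p,k)`: the dimension of the space of `k`-jets
of `p`-forms (resp. closed `p`-forms) in `r` variables with a given `(k-1)`-jet. -/
def symbDim (κ : RelKind) (r p k : ℕ) : ℕ :=
  match κ with
  | .all => r.choose p * homDim r k
  | .closed => (r + k).choose (r - p) * homDim p k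

/-- The quotient `b(n,p)c(n,k) / (b(q,p)c(q,k))`, resp. `z(n,p,k) / z(q,p,k)`. -/
def ratio (κ : RelKind) (n q p k : ℕ) : ℚ :=
  (symbDim κ n p k : ℚ) / (symbDim κ q p k : ℚ)

/-- The largest `k` such that `ratio κ n q p k ≤ d`. -/
def kZero (κ : RelKind) (n d q p : ℕ) : ℕ := sSup {k : ℕ | ratio κ n q p k ≤ (d : ℚ)}

/-- `d` is the value of the quotient at `kZero`. -/
def IsCalibrated (κ : RelKind) (n d q p : ℕ) : Prop :=
  (d : ℚ) = ratio κ n q p (kZero κ n d q p)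

/-- The number `∑_{h ≥ 0} b(q,p) c(q,h) (d - b(n,p)c(n,h) / (b(q,p)c(q,h)))⁺`, resp.
`∑_{h ≥ 0} z(q,p,h) (d - z(n,p,h) / z(q,p,h))⁺`. The subtraction is the truncated one of `ℕ`, that
is, the positive part; only finitely many terms are nonzero when `1 ≤ p ≤ q < n`. -/
def maxRank (κ : RelKind) (n d q p : ℕ) : ℕ :=
  ∑ᶠ h : ℕ, (d * symbDim κ q p h - symbDim κ n p h)

/-! ### Webs and abelian relations -/

/-- The differential forms of degree `p` at a point of `ℂⁿ`. -/
abbrev Form (n p : ℕ) : Type := (Fin n → ℂ) [⋀^Fin p]→L[ℂ] ℂ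

/-- A completely decomposable holomorphic `d`-web of codimension `q` on a connected open subset `U`
of `ℂⁿ` (the domain of a chart): the foliation `F_i` is given by a holomorphic submersion
`u_i : U → ℂ^q`, with `T_x F_i = ker (du_i)_x`. Nothing is required on the relative position of the
foliations, so that webs in general position are covered whatever the meaning of that term. -/
structure Web (n d q : ℕ) where
  U : Set (Fin n → ℂ)
  isOpen_U : IsOpen U
  isConnected_U : IsConnected U
  u : Fin d → (Fin n → ℂ) → (Fin q → ℂ)
  holomorphic_u : ∀ i, AnalyticOnNhd ℂ (u i) U
  submersion_u : ∀ i, ∀ x ∈ U, Function.Surjective (fderiv ℂ (u i) x)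

/-- An increasing multi-index `λ_1 < ... < λ_p` with values in `{1, ..., r}`. -/
abbrev IncIdx (p r : ℕ) : Type := Fin p ↪o Fin r

instance (p r : ℕ) : Fintype (IncIdx p r) := Fintype.ofFinite _

namespace Web

variable {n d q : ℕ} (W : Web n d q)

/-- `F_i`-basic `p`-forms on `V`: holomorphic forms `ω` with `i_X ω = 0` and `L_X ω = 0` for all `X`
tangent to `F_i`. As `L_X = i_X d + d i_X`, the second condition may be replaced by
`i_X dω = 0` in presence of the first one. -/
structure IsBasic {p : ℕ} (i : Fin d) (V : Set (Fin n → ℂ)) (ω : (Fin n → ℂ) → Form n p) :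
    Prop where
  holomorphic : AnalyticOnNhd ℂ ω V
  semibasic : ∀ x ∈ V, ∀ (m : Fin p → (Fin n → ℂ)) (j : Fin p),
    fderiv ℂ (W.u i) x (m j) = 0 → ω x m = 0
  semibasic_d : ∀ x ∈ V, ∀ (m : Fin (p + 1) → (Fin n → ℂ)) (j : Fin (p + 1)),
    fderiv ℂ (W.u i) x (m j) = 0 → extDeriv ω x m = 0

/-- `p`-abelian relations on `V` (for `κ = closed`: closed `p`-abelian relations): families of
`F_i`-basic (closed) `p`-forms on `V` with zero sum. -/
structure IsAbelian (κ : RelKind) (p : ℕ) (V : Set (Fin n → ℂ))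
    (ω : (Fin n → ℂ) → Fin d → Form n p) : Prop where
  basic : ∀ i, W.IsBasic i V (fun x => ω x i)
  trace_zero : ∀ x ∈ V, ∑ i, ω x i = 0
  closed : κ = .closed → ∀ i, ∀ x ∈ V, extDeriv (fun y => ω y i) x = 0

section closure

variable {W} {κ : RelKind} {p : ℕ} {V V' : Set (Fin n → ℂ)}
  {ω ω' : (Fin n → ℂ) → Fin d → Form n p}

theorem IsAbelian.mono (h : W.IsAbelian κ p V ω) (hV : V' ⊆ V) : W.IsAbelian κ p V' ω where
  basic i := ⟨(h.basic i).1.mono hV, fun x hx => (h.basic i).2 x (hV hx),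
    fun x hx => (h.basic i).3 x (hV hx)⟩
  trace_zero x hx := h.trace_zero x (hV hx)
  closed hκ i x hx := h.closed hκ i x (hV hx)

theorem IsAbelian.zero : W.IsAbelian κ p V 0 := by
  have key : ∀ (i : Fin d) (x : Fin n → ℂ),
      extDeriv (fun y => (0 : (Fin n → ℂ) → Fin d → Form n p) y i) x = 0 := by
    intro i x
    have := extDeriv_smul (𝕜 := ℂ) (x := x) (0 : ℂ) (fun _ : Fin n → ℂ => (0 : Form n p))
    simpa [Pi.zero_def] using this
  refine ⟨fun i => ⟨analyticOnNhd_const, ?_, ?_⟩, ?_, fun _ i x _ => key i x⟩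
  · intro x _ m j _
    rfl
  · intro x _ m j _
    rw [key]
    rfl
  · intro x _
    simp

theorem IsAbelian.add (h : W.IsAbelian κ p V ω) (h' : W.IsAbelian κ p V ω') :
    W.IsAbelian κ p V (ω + ω') := by
  have key : ∀ i, ∀ x ∈ V, extDeriv (fun y => (ω + ω') y i) x =
      extDeriv (fun y => ω y i) x + extDeriv (fun y => ω' y i) x := fun i x hx =>
    extDeriv_fun_add ((h.basic i).1 x hx).differentiableAt ((h'.basic i).1 x hx).differentiableAt
  refine ⟨fun i => ⟨(h.basic i).1.add (h'.basic i).1, ?_, ?_⟩, ?_, ?_⟩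
  · intro x hx m j hm
    have h1 := (h.basic i).2 x hx m j hm
    have h2 := (h'.basic i).2 x hx m j hm
    simp_all
  · intro x hx m j hm
    have h1 := (h.basic i).3 x hx m j hm
    have h2 := (h'.basic i).3 x hx m j hm
    simp_all
  · intro x hx
    have h1 := h.trace_zero x hx
    have h2 := h'.trace_zero x hx
    simp_all [Finset.sum_add_distrib]
  · intro hκ i x hx
    rw [key i x hx, h.closed hκ i x hx, h'.closed hκ i x hx, add_zero]

theorem IsAbelian.smul (c : ℂ) (h : W.IsAbelian κ p V ω) : W.IsAbelian κ p V (c • ω) := by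
  have key : ∀ i x, extDeriv (fun y => (c • ω) y i) x = c • extDeriv (fun y => ω y i) x :=
    fun i x => extDeriv_smul c (fun y => ω y i)
  refine ⟨fun i => ⟨(analyticOnNhd_const (v := c)).smul (h.basic i).1, ?_, ?_⟩, ?_, ?_⟩
  · intro x hx m j hm
    have h1 := (h.basic i).2 x hx m j hm
    simp_all
  · intro x hx m j hm
    have h1 := (h.basic i).3 x hx m j hm
    simp_all
  · intro x hx
    have h1 := h.trace_zero x hx
    simp [← Finset.smul_sum, h1]
  · intro hκ i x hx
    rw [key i x, h.closed hκ i x hx, smul_zero]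

end closure

/-- The vector space of (closed) `p`-abelian relations on `V`. A family of forms on `V` is
represented by its extension by zero to `ℂⁿ`. -/
def Ab (κ : RelKind) (p : ℕ) (V : Set (Fin n → ℂ)) :
    Submodule ℂ ((Fin n → ℂ) → Fin d → Form n p) where
  carrier := {ω | W.IsAbelian κ p V ω ∧ ∀ x ∉ V, ω x = 0}
  add_mem' h h' := ⟨h.1.add h'.1, fun x hx => by simp [h.2 x hx, h'.2 x hx]⟩
  zero_mem' := ⟨.zero, fun _ _ => rfl⟩
  smul_mem' c _ h := ⟨h.1.smul c, fun x hx => by simp [h.2 x hx]⟩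

/-- The vector space of germs at `m` of (closed) `p`-abelian relations. -/
def AbGerm (κ : RelKind) (p : ℕ) (m : Fin n → ℂ) :
    Submodule ℂ (Germ (𝓝 m) (Fin d → Form n p)) where
  carrier := {g | ∃ (V : Set (Fin n → ℂ)) (ω : (Fin n → ℂ) → Fin d → Form n p),
    IsOpen V ∧ m ∈ V ∧ W.IsAbelian κ p V ω ∧ g = (ω : Germ (𝓝 m) (Fin d → Form n p))}
  add_mem' := by
    rintro _ _ ⟨V, ω, hV, hm, h, rfl⟩ ⟨V', ω', hV', hm', h', rfl⟩
    exact ⟨V ∩ V', ω + ω', hV.inter hV', ⟨hm, hm'⟩,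
      (h.mono Set.inter_subset_left).add (h'.mono Set.inter_subset_right), rfl⟩
  zero_mem' := ⟨Set.univ, 0, isOpen_univ, Set.mem_univ m, .zero, rfl⟩
  smul_mem' := by
    rintro c _ ⟨V, ω, hV, hm, h, rfl⟩
    exact ⟨V, c • ω, hV, hm, h.smul c, rfl⟩

/-- The (closed) `p`-rank at `m`, possibly infinite. -/
def rankAt (κ : RelKind) (p : ℕ) (m : Fin n → ℂ) : ℕ∞ :=
  Cardinal.toENat (Module.rank ℂ (W.AbGerm κ p m))

/-- The (closed) `p`-rank of the web: the supremum of the ranks at the points of `U`. -/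
def rank (κ : RelKind) (p : ℕ) : ℕ∞ := ⨆ m ∈ W.U, W.rankAt κ p m

end Web

/-! ### Jets and formal abelian relations

A derivation multi-index of order `h` in `r` variables is an unordered `h`-tuple of variables,
i.e. an element of `Sym (Fin r) h`; `α ::ₛ K` is the multi-index `K + 1_α`. -/

/-- Indices `(i, A, K)` with `|K| = h` of the unknowns of order `h`. -/
abbrev SymbIdx (d q p h : ℕ) : Type := Fin d × IncIdx p q × Sym (Fin q) h

/-- Vectors `w_h = (w(i,A,K))` with `|K| = h`: candidates for the values at a point of the partial
derivatives of order `h` of the coefficients `f_{i,A}`, where `ω_i = ∑_A (f_{i,A} ∘ u_i) du_{i,A}`. -/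
abbrev Symb (d q p h : ℕ) : Type := SymbIdx d q p h → ℂ

/-- Vectors `(w_0, ..., w_{r-1})`, that is, `(r-1)`-jets (the zero space for `r = 0`). -/
abbrev Jet (d q p r : ℕ) : Type := (h : Fin r) → Symb d q p h

/-- The projection of `r`-jets to `(r-1)`-jets. -/
def Jet.proj {d q p r : ℕ} (w : Jet d q p (r + 1)) : Jet d q p r := fun h => w h.castSucc

/-- The multi-index `C` with its entry of rank `j` removed. -/
def IncIdx.drop {p q : ℕ} (C : IncIdx (p + 1) q) (j : Fin (p + 1)) : IncIdx p q :=
  (Fin.succAboveOrderEmb j).trans C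

/-- The admissible vectors `w_h`. For `κ = all`: all of them. For `κ = closed`: those in the kernel
of the Koszul differential `S^h ⊗ Λ^p → S^{h-1} ⊗ Λ^{p+1}` (in the `q` transverse variables of each
foliation), i.e. the order-`h` parts of jets of closed forms. -/
def symbols (κ : RelKind) (d q p : ℕ) : (h : ℕ) → Submodule ℂ (Symb d q p h)
  | 0 => ⊤
  | h + 1 =>
    { carrier := {w | κ = .closed → ∀ (i : Fin d) (C : IncIdx (p + 1) q) (K : Sym (Fin q) h),
        ∑ j : Fin (p + 1), (-1 : ℂ) ^ (j : ℕ) * w (i, C.drop j, C j ::ₛ K) = 0}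
      add_mem' := by
        intro a b ha hb hκ i C K
        simp only [Pi.add_apply, mul_add, Finset.sum_add_distrib]
        rw [ha hκ i C K, hb hκ i C K, add_zero]
      zero_mem' := by
        intro _ i C K
        simp
      smul_mem' := by
        intro c a ha hκ i C K
        simp only [Pi.smul_apply, smul_eq_mul, mul_left_comm _ c, ← Finset.mul_sum]
        rw [ha hκ i C K, mul_zero] }

/-- The coefficients `M_L^K` of the expansion
`((f ∘ v) J)'_L = ∑_K M_L^K (f'_K ∘ v)`, `L` being the list of the directions of derivation and `K` a
multi-index in the `q` variables of `f`. They are given by `M_∅^0 = J`, `M_∅^K = 0` for `K ≠ 0` and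
`M_{L+1_λ}^K = (M_L^K)'_λ + ∑_{α ∈ K} M_L^{K-1_α} (v_α)'_λ`. -/
def coef {n q : ℕ} (v : (Fin n → ℂ) → (Fin q → ℂ)) (J : (Fin n → ℂ) → ℂ) :
    List (Fin n) → Multiset (Fin q) → (Fin n → ℂ) → ℂ
  | [], K => fun x => if K = 0 then J x else 0
  | l :: L, K => fun x => fderiv ℂ (coef v J L K) x (Pi.single l 1) +
      ∑ α ∈ K.toFinset, coef v J L (K.erase α) x * fderiv ℂ v x (Pi.single l 1) α

/-- Iterated partial derivative of `f` along a list of coordinate directions. -/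
def partialDeriv {q : ℕ} : List (Fin q) → ((Fin q → ℂ) → ℂ) → (Fin q → ℂ) → ℂ
  | [], f => f
  | a :: K, f => fun y => fderiv ℂ (partialDeriv K f) y (Pi.single a 1)

/-- `E` is a holomorphic vector subbundle of rank `N` of the trivial bundle with fibre `F` over
`U`: near every point of `U` it has a holomorphic frame with `N` elements. -/
def IsHolomorphicSubbundle {n : ℕ} {F : Type*} [NormedAddCommGroup F] [NormedSpace ℂ F]
    (U : Set (Fin n → ℂ)) (E : (Fin n → ℂ) → Submodule ℂ F) (N : ℕ) : Prop :=
  ∀ x ∈ U, ∃ V : Set (Fin n → ℂ), IsOpen V ∧ x ∈ V ∧ V ⊆ U ∧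
    ∃ e : Fin N → (Fin n → ℂ) → F, (∀ j, AnalyticOnNhd ℂ (e j) V) ∧
      ∀ y ∈ V, LinearIndependent ℂ (fun j => e j y) ∧
        Submodule.span ℂ (Set.range fun j => e j y) = E y

namespace Web

variable {n d q : ℕ} (W : Web n d q)

/-- The Jacobian determinant `J_{i,B}^A = det (D(u_{i,α_1},…,u_{i,α_p}) / D(x_{λ_1},…,x_{λ_p}))`. -/
def jac {p : ℕ} (i : Fin d) (A : IncIdx p q) (B : IncIdx p n) (x : Fin n → ℂ) : ℂ :=
  (Matrix.of fun a b : Fin p => fderiv ℂ (W.u i) x (Pi.single (B b) 1) (A a)).det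

/-- The matrix `P_h^{(l)}` at `x`, with entries `M_{B,L}^{i,A,K}`, `|L| = l`, `|K| = h`. Its rows are
the equations `(E_B)'_L`, where `(E_B)` is `∑_{i,A} (f_{i,A} ∘ u_i) J_{i,B}^A = 0`. -/
def block (p l h : ℕ) (x : Fin n → ℂ) :
    Matrix (IncIdx p n × Sym (Fin n) l) (SymbIdx d q p h) ℂ :=
  Matrix.of fun BL iAK => coef (W.u iAK.1) (W.jac iAK.1 iAK.2.1 BL.1)
    ((BL.2 : Multiset (Fin n)).sort (· ≤ ·)) (iAK.2.2 : Multiset (Fin q)) x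

/-- The web is `p`-ordinary (resp. strongly `p`-ordinary): at every point and for every `k ≥ 0`, the
matrix `P_k = P_k^{(k)}` (resp. its restriction to the closed symbols) has maximal rank
`inf (b(n,p) c(n,k), d b(q,p) c(q,k))` (resp. `inf (z(n,p,k), d z(q,p,k))`). -/
def IsOrdinary (κ : RelKind) (p : ℕ) : Prop :=
  ∀ x ∈ W.U, ∀ k : ℕ,
    Module.finrank ℂ ((symbols κ d q p k).map (W.block p k k x).mulVecLin) =
      min (symbDim κ n p k) (d * symbDim κ q p k)

/-- The fibre at `x` of `R_{r-1}`, the formal (closed) `p`-abelian relations of order `r - 1`: the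
jets `(w_0, ..., w_{r-1})` that satisfy all the equations `(E_B)'_L` with `|L| ≤ r - 1`.
It is zero for `r = 0`. -/
def R (κ : RelKind) (p r : ℕ) (x : Fin n → ℂ) : Submodule ℂ (Jet d q p r) where
  carrier := {w | (∀ h : Fin r, w h ∈ symbols κ d q p h) ∧
    ∀ l : Fin r, ∑ h : Fin r, (W.block p l h x).mulVec (w h) = 0}
  add_mem' := by
    rintro a b ⟨ha, ha'⟩ ⟨hb, hb'⟩
    refine ⟨fun h => add_mem (ha h) (hb h), fun l => ?_⟩
    simp only [Pi.add_apply, Matrix.mulVec_add, Finset.sum_add_distrib, ha' l, hb' l, add_zero]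
  zero_mem' := ⟨fun h => zero_mem _, fun l => by simp⟩
  smul_mem' := by
    rintro c a ⟨ha, ha'⟩
    refine ⟨fun h => Submodule.smul_mem _ c (ha h), fun l => ?_⟩
    simp only [Pi.smul_apply, Matrix.mulVec_smul, ← Finset.smul_sum, ha' l, smul_zero]

/-- `w` is the `(r-1)`-jet at `x` of the family `ω` of basic forms: near `x`,
`ω_i = ∑_A (f_{i,A} ∘ u_i) du_{i,α_1} ∧ … ∧ du_{i,α_p}` with `f_{i,A}` holomorphic near `u_i(x)`, and
`w(i,A,K) = (f_{i,A})'_K (u_i(x))` for `|K| ≤ r - 1`. -/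
def IsJetAt {p : ℕ} (r : ℕ) (ω : (Fin n → ℂ) → Fin d → Form n p) (x : Fin n → ℂ)
    (w : Jet d q p r) : Prop :=
  ∃ f : Fin d → IncIdx p q → (Fin q → ℂ) → ℂ,
    (∀ i A, AnalyticAt ℂ (f i A) (W.u i x)) ∧
    (∀ i, ∀ᶠ y in 𝓝 x, ∀ m : Fin p → (Fin n → ℂ),
      ω y i m = ∑ A : IncIdx p q, f i A (W.u i y) *
        (Matrix.of fun a b : Fin p => fderiv ℂ (W.u i) y (m b) (A a)).det) ∧
    ∀ (h : Fin r) (i : Fin d) (A : IncIdx p q) (K : Sym (Fin q) h),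
      w h (i, A, K) = partialDeriv ((K : Multiset (Fin q)).sort (· ≤ ·)) (f i A) (W.u i x)

/-! ### The tautological connection -/

/-- Holomorphic sections over `V` of `R_{r-1}`. -/
def IsSection (κ : RelKind) (p r : ℕ) (V : Set (Fin n → ℂ)) (s : (Fin n → ℂ) → Jet d q p r) :
    Prop :=
  AnalyticOnNhd ℂ s V ∧ ∀ x ∈ V, s x ∈ W.R κ p r x

/-- The map `R_r → R_{r-1}` has the inverse `lift` at `x`, when it is bijective. -/
def lift (κ : RelKind) (p r : ℕ) (x : Fin n → ℂ) : Jet d q p r → Jet d q p (r + 1) :=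
  Function.invFunOn Jet.proj (W.R κ p (r + 1) x : Set (Jet d q p (r + 1)))

/-- The derivative part, in the direction `v`, of the inclusion of the `r`-jets at `x` of families of
basic forms in the 1-jets of sections of the bundle of their `(r-1)`-jets:
`∂_v (f'_K ∘ u) = ∑_α (f'_{K+1_α} ∘ u) du_α(v)`. -/
def jetDeriv {p r : ℕ} (x : Fin n → ℂ) (w : Jet d q p (r + 1)) (v : Fin n → ℂ) : Jet d q p r :=
  fun h iAK => ∑ α : Fin q, w h.succ (iAK.1, iAK.2.1, α ::ₛ iAK.2.2) * fderiv ℂ (W.u iAK.1) x v α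

/-- The covariant derivative `∇_v s` at `x`, where `∇ s = j^1 s - ι (lift s)` with
`ι : R_r ⊂ J^1 R_{r-1}` the natural inclusion. -/
def nabla (κ : RelKind) (p r : ℕ) (s : (Fin n → ℂ) → Jet d q p r) (x v : Fin n → ℂ) :
    Jet d q p r :=
  fderiv ℂ s x v - W.jetDeriv x (W.lift κ p r x (s x)) v

/-- The operator `nabla` is a holomorphic connection on the bundle `R_{r-1}` over `U`: it maps
holomorphic sections to holomorphic 1-forms with values in the bundle, it is additive, and it
satisfies the Leibniz rule. -/
structure IsHolomorphicConnection (κ : RelKind) (p r : ℕ) : Prop where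
  linear : ∀ s x, IsLinearMap ℂ (W.nabla κ p r s x)
  isSection : ∀ V, IsOpen V → V ⊆ W.U → ∀ s, W.IsSection κ p r V s →
    ∀ v, W.IsSection κ p r V (fun x => W.nabla κ p r s x v)
  add : ∀ V, IsOpen V → V ⊆ W.U → ∀ s t, W.IsSection κ p r V s → W.IsSection κ p r V t →
    ∀ x ∈ V, ∀ v, W.nabla κ p r (fun y => s y + t y) x v = W.nabla κ p r s x v + W.nabla κ p r t x v
  leibniz : ∀ V, IsOpen V → V ⊆ W.U → ∀ s, W.IsSection κ p r V s →
    ∀ f : (Fin n → ℂ) → ℂ, AnalyticOnNhd ℂ f V → ∀ x ∈ V, ∀ v,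
      W.nabla κ p r (fun y => f y • s y) x v = fderiv ℂ f x v • s x + f x • W.nabla κ p r s x v

/-- Parallel holomorphic sections over `V`. A section over `V` is represented by its extension by
zero to `ℂⁿ`. -/
def parallelSections (κ : RelKind) (p r : ℕ) (V : Set (Fin n → ℂ)) :
    Set ((Fin n → ℂ) → Jet d q p r) :=
  {s | W.IsSection κ p r V s ∧ (∀ x ∈ V, ∀ v, W.nabla κ p r s x v = 0) ∧ ∀ x ∉ V, s x = 0}

/-- The curvature `(∇_v ∇_w - ∇_w ∇_v - ∇_[v,w]) s` for the constant (hence commuting) vector fields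
`v`, `w`. -/
def curvature (κ : RelKind) (p r : ℕ) (s : (Fin n → ℂ) → Jet d q p r) (v w x : Fin n → ℂ) :
    Jet d q p r :=
  W.nabla κ p r (fun y => W.nabla κ p r s y w) x v -
    W.nabla κ p r (fun y => W.nabla κ p r s y v) x w

/-- The curvature vanishes identically on `U`. -/
def IsFlat (κ : RelKind) (p r : ℕ) : Prop :=
  ∀ V, IsOpen V → V ⊆ W.U → ∀ s, W.IsSection κ p r V s →
    ∀ v w, ∀ x ∈ V, W.curvature κ p r s v w x = 0

end Web

end WebTheory

end

open Filter Topology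

noncomputable section

namespace WebTheory

/-! ### Monotonicity of the quotients and the value of `maxRank` -/

/-! Write a(r,k) for `symbDim κ r p k`. An equation of order l involves only unknowns of order at
most l (`coef_eq_zero`), so the linear system defining `R` is block triangular, with diagonal blocks
P_h. Extending a formal relation by one more order r means solving P_r w_r = -(contribution of the
lower orders). Both sides are symbols of order r of (closed) p-forms in n variables, because a
formal family is realised by polynomial forms and the trace of closed forms is closed
(`eqs_mem_formSymbols`). In the closed case the dimension a(n,r) of that space comes from the
exactness of the Koszul complex. Maximal rank therefore makes P_r surjective onto it for r ≤ k₀,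
with kernel of dimension d a(q,r) - a(n,r). Summing over the orders gives fibres of constant
dimension π. Calibration makes the kernel at order k₀ zero, whence the bijectivity of R_{k₀} →
R_{k₀-1} (`bijOn_proj`). Kernels of constant dimension of an analytic family of linear maps form a
holomorphic bundle.

Differentiating (E_B)'_L along a section s and subtracting (E_B)'_{L+1_λ} evaluated on the lift of s
leaves exactly (E_B)'_L evaluated on ∇s. Hence ∇ takes its values in the bundle
(`fderiv_sub_jetDeriv_mem`). If ∇s = 0, the entry of order 0 attached to (i,A) is constant along
F_i, so it is locally f ∘ u_i. The equation ∇s = 0 then forces all other entries to be derivatives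
of f: s is the jet of an abelian relation (`exists_of_parallel`).

A parallel section is determined by its value at one point. So the rank at m is the dimension of the
space of values at m of germs of parallel sections; it is at most π, with equality exactly when
every vector of the fibre extends. In that case a parallel frame exists near m, the curvature
vanishes near m, and the identity theorem carries this to the connected set U. Conversely, for a
flat connection the Frobenius theorem (`exists_fundamental_solution`) extends every vector. -/

theorem homDim_pos {r : ℕ} (_ : 1 ≤ r) (k : ℕ) : 0 < homDim r k :=
  Nat.choose_pos (by omega)

theorem symbDim_pos (κ : RelKind) {r p : ℕ} (hp : 1 ≤ p) (hpr : p ≤ r) (k : ℕ) :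
    0 < symbDim κ r p k := by
  cases κ
  · exact Nat.mul_pos (Nat.choose_pos hpr) (homDim_pos (hp.trans hpr) k)
  · exact Nat.mul_pos (Nat.choose_pos (by omega)) (homDim_pos hp k)

theorem homDim_succ_mul {r : ℕ} (hr : 1 ≤ r) (k : ℕ) :
    homDim r (k + 1) * (k + 1) = homDim r k * (r + k) := by
  obtain ⟨s, rfl⟩ := Nat.exists_eq_add_of_le' hr
  have := Nat.add_one_mul_choose_eq (s + k) k
  simp only [homDim, Nat.add_sub_cancel]
  rw [show s + (k + 1) = s + k + 1 by ring, ← this]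
  ring

/-- The growth factor a(r,k+1)/a(r,k) has the form (r+s)e/c with s, c, e independent of r (s = k for
all forms, s = k+1 for closed ones). The quotient is thus multiplied by (n+s)/(q+s) > 1 at each
step. -/
theorem ratio_succ (κ : RelKind) {n q p : ℕ} (hp : 1 ≤ p) (hpq : p ≤ q) (hqn : q < n) (k : ℕ) :
    ratio κ n q p k < ratio κ n q p (k + 1) := by
  have hqk : (0 : ℚ) < symbDim κ q p k := by exact_mod_cast symbDim_pos κ hp hpq k
  have hqk' : (0 : ℚ) < symbDim κ q p (k + 1) := by exact_mod_cast symbDim_pos κ hp hpq (k + 1)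
  have hnk : (0 : ℚ) < symbDim κ n p k := by
    exact_mod_cast symbDim_pos κ hp (hpq.trans hqn.le) k
  have key : ∃ c e : ℕ, 0 < c ∧ 0 < e ∧ ∃ s : ℕ, 
      ∀ r, p ≤ r → symbDim κ r p (k + 1) * c = symbDim κ r p k * (r + s) * e := by
    cases κ
    · refine ⟨k + 1, 1, by omega, by omega, k, fun r hr => ?_⟩
      simp only [symbDim]
      rw [mul_assoc, homDim_succ_mul (hp.trans hr)]
      ring
    · refine ⟨(p + k + 1) * (k + 1), p + k, by positivity, by omega, k + 1, fun r hr => ?_⟩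
      simp only [symbDim]
      have h1 := homDim_succ_mul hp k
      have h2 : (r + (k + 1)).choose (r - p) * (p + k + 1) =
          (r + k).choose (r - p) * (r + k + 1) := by
        have := Nat.choose_mul_succ_eq (r + k) (r - p)
        rw [show r + k + 1 - (r - p) = p + k + 1 by omega] at this
        rw [← add_assoc, ← this]
      calc _ = ((r + (k + 1)).choose (r - p) * (p + k + 1)) * (homDim p (k + 1) * (k + 1)) := by ring
        _ = _ := by rw [h1, h2]; ring
  obtain ⟨c, e, hc, he, s, h⟩ := key
  have h1 : (symbDim κ n p (k + 1) : ℚ) * c = symbDim κ n p k * (n + s) * e := by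
    exact_mod_cast h n (hpq.trans hqn.le)
  have h2 : (symbDim κ q p (k + 1) : ℚ) * c = symbDim κ q p k * (q + s) * e := by
    exact_mod_cast h q hpq
  have hc' : (0 : ℚ) < c := by exact_mod_cast hc
  have he' : (0 : ℚ) < e := by exact_mod_cast he
  have hqn' : (q : ℚ) < n := by exact_mod_cast hqn
  rw [ratio, ratio, div_lt_div_iff₀ hqk hqk']
  refine lt_of_mul_lt_mul_right ?_ hc'.le
  calc (symbDim κ n p k : ℚ) * symbDim κ q p (k + 1) * c
      = symbDim κ n p k * symbDim κ q p k * e * (q + s) := by rw [mul_assoc, h2]; ring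
    _ < symbDim κ n p k * symbDim κ q p k * e * (n + s) := by gcongr
    _ = _ := by rw [mul_right_comm (symbDim κ n p (k + 1) : ℚ), h1]; ring

theorem ratio_strictMono (κ : RelKind) {n q p : ℕ} (hp : 1 ≤ p) (hpq : p ≤ q) (hqn : q < n) :
    StrictMono (ratio κ n q p) :=
  strictMono_nat_of_lt_succ (ratio_succ κ hp hpq hqn)

section calibrated

variable {κ : RelKind} {n d q p : ℕ} (hp : 1 ≤ p) (hpq : p ≤ q) (hqn : q < n)
  (hcal : IsCalibrated κ n d q p)
include hp hpq hqn hcal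

/-- Calibration says that the quotient takes the value d at `kZero`, and monotonicity decides the
sign on either side. Up to `kZero` the block P_h has at least as many unknowns as equations. -/
theorem symbDim_le_of_le_kZero {h : ℕ} (hh : h ≤ kZero κ n d q p) :
    symbDim κ n p h ≤ d * symbDim κ q p h := by
  have hq : (0 : ℚ) < symbDim κ q p h := by exact_mod_cast symbDim_pos κ hp hpq h
  have h1 : ratio κ n q p h ≤ d := by
    rw [hcal]
    exact (ratio_strictMono κ hp hpq hqn).monotone hh
  rw [ratio, div_le_iff₀ hq] at h1
  exact_mod_cast h1

/-- From `kZero` on the truncated differences vanish, so `maxRank` is a sum over the orders below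
`kZero`. At `kZero` itself both inequalities hold. -/
theorem symbDim_le_of_kZero_le {h : ℕ} (hh : kZero κ n d q p ≤ h) :
    d * symbDim κ q p h ≤ symbDim κ n p h := by
  have hq : (0 : ℚ) < symbDim κ q p h := by exact_mod_cast symbDim_pos κ hp hpq h
  have h1 : (d : ℚ) ≤ ratio κ n q p h := by
    rw [hcal]
    exact (ratio_strictMono κ hp hpq hqn).monotone hh
  rw [ratio, le_div_iff₀ hq] at h1
  exact_mod_cast h1

theorem maxRank_eq_sum : maxRank κ n d q p =
    ∑ h ∈ Finset.range (kZero κ n d q p), (d * symbDim κ q p h - symbDim κ n p h) := by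
  refine finsum_eq_sum_of_support_subset _ fun h hh => ?_
  simp only [Finset.coe_range, Set.mem_Iio]
  by_contra hk
  exact hh (Nat.sub_eq_zero_of_le (symbDim_le_of_kZero_le hp hpq hqn hcal (not_lt.1 hk)))

end calibrated

/-- Numerical form of the exactness of the Koszul complex at S^{h+1} ⊗ Λ^p: the kernel, plus an
image made of the closed symbols of degree p+1 and order h, fills the whole space. -/
theorem symbDim_closed_recursion {r p : ℕ} (hp : 1 ≤ p) (hpr : p < r) (h : ℕ) :
    symbDim .closed r p (h + 1) + symbDim .closed r (p + 1) h = r.choose p * homDim r (h + 1) := by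
  obtain ⟨t, rfl⟩ := Nat.exists_eq_add_of_le' hp
  obtain ⟨s, rfl⟩ := Nat.exists_eq_add_of_lt hpr
  simp only [symbDim, homDim]
  have e1 : t + 1 + s + 1 + (h + 1) = (s + 1) + (t + h + 2) := by ring
  have e2 : t + 1 + s + 1 - (t + 1) = s + 1 := by omega
  have e3 : t + 1 - 1 + (h + 1) = (h + 1) + t := by omega
  have e4 : t + 1 + s + 1 + h = s + (t + h + 2) := by ring
  have e5 : t + 1 + s + 1 - (t + 1 + 1) = s := by omega
  have e6 : t + 1 + 1 - 1 + h = h + (t + 1) := by omega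
  have e7 : t + 1 + s + 1 = (t + 1) + (s + 1) := by ring
  have e8 : t + 1 + s + 1 - 1 + (h + 1) = (h + 1) + (t + s + 1) := by omega
  rw [e1, e2, e3, e4, e5, e6, e8, e7]
  have : ∀ a b : ℕ, ((a + b).choose a : ℚ) = (a + b).factorial / (a.factorial * b.factorial) :=
    fun a b => Nat.cast_add_choose ℚ
  have goal : (((s + 1 + (t + h + 2)).choose (s + 1) * (h + 1 + t).choose (h + 1) +
      (s + (t + h + 2)).choose s * (h + (t + 1)).choose h : ℕ) : ℚ) =
      (((t + 1 + (s + 1)).choose (t + 1) * (h + 1 + (t + s + 1)).choose (h + 1) : ℕ) : ℚ) := by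
    push_cast
    rw [this, this, this, this, this, this]
    have f1 : s + 1 + (t + h + 2) = (t + s + h + 2) + 1 := by ring
    have f2 : h + 1 + t = t + h + 1 := by ring
    have f3 : s + (t + h + 2) = t + s + h + 2 := by ring
    have f4 : h + (t + 1) = t + h + 1 := by ring
    have f5 : t + 1 + (s + 1) = (t + s + 1) + 1 := by ring
    have f6 : h + 1 + (t + s + 1) = t + s + h + 2 := by ring
    rw [f1, f2, f3, f4, f5, f6, show t + h + 2 = (t + h + 1) + 1 by ring]
    simp only [Nat.factorial_succ (t + s + h + 2), Nat.factorial_succ (t + h + 1),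
      Nat.factorial_succ (t + s + 1), Nat.factorial_succ s, Nat.factorial_succ t,
      Nat.factorial_succ h]
    have g : ∀ a : ℕ, (a.factorial : ℚ) ≠ 0 := fun a => by exact_mod_cast a.factorial_ne_zero
    have g1 := g s
    have g2 := g t
    have g3 := g h
    have g4 := g (t + h + 1)
    have g5 := g (t + s + h + 2)
    have g6 := g (t + s + 1)
    push_cast
    field_simp
    ring
  exact_mod_cast goal

/-! ### Analytic families of linear maps -/

section families

variable {D F G : Type*} [NormedAddCommGroup D] [NormedSpace ℂ D] [NormedAddCommGroup F]
  [NormedSpace ℂ F] [NormedAddCommGroup G] [NormedSpace ℂ G]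

/-- In finite dimension an operator is recovered linearly from its values on a basis, so analyticity
can be tested vector by vector. -/
theorem analyticAt_clm_of_apply [FiniteDimensional ℂ F] {A : D → F →L[ℂ] G} {x : D}
    (h : ∀ w, AnalyticAt ℂ (fun y => A y w) x) : AnalyticAt ℂ A x := by
  let b := Module.finBasis ℂ F
  have : A = fun y => ∑ j, ContinuousLinearMap.smulRightL ℂ F G
      (LinearMap.toContinuousLinearMap (b.coord j)) (A y (b j)) := by
    funext y
    ext w
    conv_lhs => rw [← b.sum_repr w, map_sum]
    simp
  rw [this]
  exact Finset.analyticAt_fun_sum _ fun j _ =>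
    ((ContinuousLinearMap.smulRightL ℂ F G
      (LinearMap.toContinuousLinearMap (b.coord j))).analyticAt _).comp (h (b j))

theorem exists_isOpen_analyticOnNhd_ringInverse {R : Type*} [NormedRing R] [NormedAlgebra ℂ R]
    [CompleteSpace R] {U : Set D} (hU : IsOpen U) {A : D → R} (hA : AnalyticOnNhd ℂ A U) {x : D}
    (hx : x ∈ U) (hu : IsUnit (A x)) :
    ∃ V, IsOpen V ∧ x ∈ V ∧ V ⊆ U ∧ (∀ y ∈ V, IsUnit (A y)) ∧
      AnalyticOnNhd ℂ (fun y => Ring.inverse (A y)) V := by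
  have h1 : ∀ᶠ y in 𝓝 x, IsUnit (A y) :=
    (hA x hx).continuousAt.eventually (Units.isOpen.mem_nhds hu)
  obtain ⟨V, hV, hVo, hxV⟩ := mem_nhds_iff.1 (h1.and (hU.mem_nhds hx))
  refine ⟨V, hVo, hxV, fun y hy => (hV hy).2, fun y hy => (hV hy).1, fun y hy => ?_⟩
  obtain ⟨z, hz⟩ := (hV hy).1
  have h2 := analyticAt_inverse (𝕜 := ℂ) z
  rw [hz] at h2
  exact h2.comp (hA y (hV hy).2)

/-- Let C be a complement of `E x`, S an inverse of `T x` on C, and P = 1 - S (T x) the projection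
onto `E x`. The family Ψ y = P + S (T y) is the identity at x, hence invertible nearby, and it
agrees with P on ker (T y). So it maps `E y` into `E x`, and by equality of dimensions the inverse
images of a basis of `E x` form a frame. -/
theorem isHolomorphicSubbundle_ker {n N : ℕ} [FiniteDimensional ℂ F] [FiniteDimensional ℂ G]
    {U : Set (Fin n → ℂ)} (hU : IsOpen U) {T : (Fin n → ℂ) → F →ₗ[ℂ] G}
    (hT : ∀ w, AnalyticOnNhd ℂ (fun y => T y w) U) {E : (Fin n → ℂ) → Submodule ℂ F}
    (hE : ∀ y ∈ U, E y = LinearMap.ker (T y)) (hN : ∀ y ∈ U, Module.finrank ℂ (E y) = N) :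
    IsHolomorphicSubbundle U E N := by
  have : CompleteSpace F := FiniteDimensional.complete ℂ F
  intro x hx
  obtain ⟨C, hC⟩ := Submodule.exists_isCompl (E x)
  have hinj : LinearMap.ker ((T x).comp C.subtype) = ⊥ := by
    rw [LinearMap.ker_comp, ← hE x hx, ← Submodule.disjoint_iff_comap_eq_bot]
    exact hC.disjoint.symm
  obtain ⟨S₀, hS₀⟩ := LinearMap.exists_leftInverse_of_injective _ hinj
  let S : G →ₗ[ℂ] F := C.subtype.comp S₀
  let P : F →ₗ[ℂ] F := LinearMap.id - S.comp (T x)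
  have hP : ∀ w, P w ∈ E x := by
    intro w
    obtain ⟨k, hk, c, hc, rfl⟩ := Submodule.mem_sup.1
      ((hC.sup_eq_top ▸ Submodule.mem_top : w ∈ E x ⊔ C))
    have hk0 : T x k = 0 := by
      rw [hE x hx] at hk
      exact hk
    have h1 : S (T x c) = c := by
      have := LinearMap.congr_fun hS₀ ⟨c, hc⟩
      exact congrArg Subtype.val this
    have : P (k + c) = k := by
      simp [P, hk0, h1]
    rwa [this]
  let Ψ : (Fin n → ℂ) → F →L[ℂ] F := fun y => LinearMap.toContinuousLinearMap (P + S.comp (T y))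
  have hΨ : AnalyticOnNhd ℂ Ψ U := fun y hy => analyticAt_clm_of_apply fun w => by
    simp only [Ψ, LinearMap.coe_toContinuousLinearMap', LinearMap.add_apply, LinearMap.comp_apply]
    exact analyticAt_const.add
      (((LinearMap.toContinuousLinearMap S).analyticAt _).comp (hT w y hy))
  have hΨx : Ψ x = 1 := by
    ext w
    simp [Ψ, P]
  obtain ⟨V, hVo, hxV, hVU, hunit, han⟩ :=
    exists_isOpen_analyticOnNhd_ringInverse hU hΨ hx (hΨx ▸ isUnit_one)
  let b : Module.Basis (Fin N) ℂ (E x) := Module.finBasisOfFinrankEq ℂ _ (hN x hx)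
  have hinv : ∀ y ∈ V, ∀ w, Ring.inverse (Ψ y) (Ψ y w) = w := fun y hy w => by
    have := Ring.inverse_mul_cancel _ (hunit y hy)
    exact DFunLike.congr_fun this w
  have hinv' : ∀ y ∈ V, ∀ w, Ψ y (Ring.inverse (Ψ y) w) = w := fun y hy w => by
    have := Ring.mul_inverse_cancel _ (hunit y hy)
    exact DFunLike.congr_fun this w
  refine ⟨V, hVo, hxV, hVU, fun j y => Ring.inverse (Ψ y) (b j), fun j y hy => ?_, fun y hy => ?_⟩
  · exact ((ContinuousLinearMap.apply ℂ F (b j : F)).analyticAt _).comp (han y hy)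
  · have hli : LinearIndependent ℂ fun j => Ring.inverse (Ψ y) (b j : F) := by
      have h1 : LinearIndependent ℂ fun j => (b j : F) :=
        b.linearIndependent.map' (E x).subtype (Submodule.ker_subtype _)
      refine h1.map' (Ring.inverse (Ψ y) : F →L[ℂ] F).toLinearMap ?_
      rw [LinearMap.ker_eq_bot]
      exact Function.LeftInverse.injective (hinv' y hy)
    refine ⟨hli, (Submodule.eq_of_le_of_finrank_eq ?_ ?_).symm⟩
    · intro w hw
      rw [hE y (hVU hy)] at hw
      have h1 : Ψ y w = P w := by
        simp only [Ψ, LinearMap.coe_toContinuousLinearMap', LinearMap.add_apply,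
          LinearMap.comp_apply]
        rw [LinearMap.mem_ker.1 hw, map_zero, add_zero]
      rw [← hinv y hy w, h1]
      have h2 : P w = ∑ j, b.repr ⟨P w, hP w⟩ j • (b j : F) := by
        have h3 := congrArg Subtype.val (b.sum_repr ⟨P w, hP w⟩)
        refine h3.symm.trans ?_
        simp only [Submodule.coe_sum, Submodule.coe_smul]
      rw [h2, map_sum]
      refine Submodule.sum_mem _ fun j _ => ?_
      rw [map_smul]
      exact Submodule.smul_mem _ _ (Submodule.subset_span ⟨j, rfl⟩)
    · rw [hN y (hVU hy), finrank_span_eq_card hli, Fintype.card_fin]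

end families

/-! ### Functions and forms that are basic for a submersion -/

section submersion

variable {E F G : Type*} [NormedAddCommGroup E] [NormedSpace ℂ E]
  [NormedAddCommGroup F] [NormedSpace ℂ F] [NormedAddCommGroup G] [NormedSpace ℂ G]

theorem exists_rightInverse_clm [FiniteDimensional ℂ F] {L : E →L[ℂ] F} (hL : Function.Surjective L) :
    ∃ ρ : F →L[ℂ] E, ∀ t, L (ρ t) = t := by
  obtain ⟨ρ, hρ⟩ := L.toLinearMap.exists_rightInverse_of_surjective (LinearMap.range_eq_top.2 hL)
  exact ⟨LinearMap.toContinuousLinearMap ρ, fun t => LinearMap.congr_fun hρ t⟩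

/-- Local analytic coordinates in which a submersion is affine. -/
theorem exists_straightening [FiniteDimensional ℂ E] [FiniteDimensional ℂ F] {u : E → F} {x : E} (hu : AnalyticAt ℂ u x)
    (hs : Function.Surjective (fderiv ℂ u x)) :
    ∃ Ψ Φ : E → E, AnalyticAt ℂ Ψ x ∧ AnalyticAt ℂ Φ x ∧ Ψ x = x ∧ Φ x = x ∧
      (∀ᶠ y in 𝓝 x, Φ (Ψ y) = y) ∧ (∀ᶠ y in 𝓝 x, Ψ (Φ y) = y) ∧
      ∀ y, u y = u x + fderiv ℂ u x (Ψ y - x) := by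
  have : CompleteSpace E := FiniteDimensional.complete ℂ E
  obtain ⟨ρ, hρ⟩ := exists_rightInverse_clm hs
  set L := fderiv ℂ u x with hL
  -- The correction is a section of L applied to the nonlinear remainder of u: its derivative
  -- vanishes at x, so Ψ is a local diffeomorphism, and L applied to Ψ y - x recovers u y - u x.
  let Ψ : E → E := fun y => y + ρ (u y - u x - L (y - x))
  have hΨ : AnalyticAt ℂ Ψ x := by
    refine analyticAt_id.add ((ρ.analyticAt _).comp ?_)
    exact (hu.sub analyticAt_const).sub ((L.analyticAt _).comp (analyticAt_id.sub analyticAt_const))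
  have hΨx : Ψ x = x := by simp [Ψ]
  have hd : HasFDerivAt Ψ ((ContinuousLinearEquiv.refl ℂ E : E ≃L[ℂ] E) : E →L[ℂ] E) x := by
    have h1 : HasFDerivAt u L x := hu.differentiableAt.hasFDerivAt
    have h2 : HasFDerivAt (fun y => L (y - x)) L x :=
      L.hasFDerivAt.comp x (hasFDerivAt_sub_const x)
    have h3 := (ρ.hasFDerivAt (x := u x - u x - L (x - x))).comp x ((h1.sub_const (u x)).sub h2)
    have h4 := (hasFDerivAt_id x).add h3
    refine h4.congr_fderiv ?_
    ext w
    simp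
  have hcd : ContDiffAt ℂ ⊤ Ψ x := hΨ.contDiffAt
  have hst := hcd.hasStrictFDerivAt' hd (by simp)
  let Φ := hst.localInverse Ψ _ x
  have hΦx : Φ x = x := by
    have := hst.localInverse_apply_image
    rwa [hΨx] at this
  have hΦ : AnalyticAt ℂ Φ x := by
    have := hcd.to_localInverse hd (by simp)
    rw [hΨx] at this
    exact this.analyticAt
  refine ⟨Ψ, Φ, hΨ, hΦ, hΨx, hΦx, hst.eventually_left_inverse, ?_, fun y => ?_⟩
  · have := hst.eventually_right_inverse
    rwa [hΨx] at this
  · simp only [Ψ]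
    rw [show y + ρ (u y - u x - L (y - x)) - x = (y - x) + ρ (u y - u x - L (y - x)) by abel,
      map_add, hρ]
    abel

/-- The trace of the ball on the affine space z + ker L is convex, hence connected, and h has zero
derivative along it. The point x + ρ(L(z - x)) lies in the same affine space as z. -/
theorem eventually_eq_comp_projection {h : E → G} {x : E} {L : E →L[ℂ] F} {ρ : F →L[ℂ] E}
    (hρ : ∀ t, L (ρ t) = t) (hh : ∀ᶠ z in 𝓝 x, DifferentiableAt ℂ h z)
    (hd : ∀ᶠ z in 𝓝 x, ∀ v, L v = 0 → fderiv ℂ h z v = 0) :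
    ∀ᶠ z in 𝓝 x, h z = h (x + ρ (L (z - x))) := by
  obtain ⟨r, hr, hB⟩ := Metric.eventually_nhds_iff_ball.1 (hh.and hd)
  have hc : Tendsto (fun z => x + ρ (L (z - x))) (𝓝 x) (𝓝 x) := by
    have : Continuous fun z => x + ρ (L (z - x)) := by fun_prop
    simpa using this.tendsto x
  filter_upwards [Metric.ball_mem_nhds x hr, hc (Metric.ball_mem_nhds x hr)] with z hz hz'
  let K := LinearMap.ker L.toLinearMap
  let a : K → E := fun v => z + v
  have ha : Continuous a := by fun_prop
  have hda : ∀ v, HasFDerivAt a K.subtypeL v := fun v => K.subtypeL.hasFDerivAt.const_add z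
  have hpre : IsPreconnected (a ⁻¹' Metric.ball x r) := by
    refine Convex.isPreconnected ?_
    intro v hv w hw s t hs ht hst
    have := convex_ball x r hv hw hs ht hst
    simp only [Set.mem_preimage, a] at this ⊢
    convert this using 1
    have h1 : z = s • z + t • z := by rw [← add_smul, hst, one_smul]
    push_cast
    nth_rewrite 1 [h1]
    simp only [smul_add]
    abel
  have hconst := IsOpen.is_const_of_fderiv_eq_zero (𝕜 := ℂ) (f := h ∘ a)
    (Metric.isOpen_ball.preimage ha) hpre ?_ ?_ 
    (x := 0) (y := ⟨x + ρ (L (z - x)) - z, ?_⟩) ?_ ?_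
  · simpa [a] using hconst
  · intro v hv
    exact ((hB _ hv).1.comp v (hda v).differentiableAt).differentiableWithinAt
  · intro v hv
    rw [((hB _ hv).1.hasFDerivAt.comp v (hda v)).fderiv]
    ext w
    exact (hB _ hv).2 w w.2
  · change L _ = 0
    rw [map_sub, map_add, hρ, map_sub]
    abel
  · simpa [a] using hz
  · simpa [a] using hz'

/-- In the straightened coordinates the fibres of u are affine, so g is constant along them; f is g
restricted to an affine section of the fibration. -/
theorem exists_eq_comp_of_fderiv_eq_zero [FiniteDimensional ℂ E] [FiniteDimensional ℂ F] {u : E → F} {x : E} (hu : AnalyticAt ℂ u x)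
    (hs : Function.Surjective (fderiv ℂ u x)) [CompleteSpace G] {g : E → G}
    (hg : AnalyticAt ℂ g x)
    (hd : ∀ᶠ y in 𝓝 x, ∀ v, fderiv ℂ u y v = 0 → fderiv ℂ g y v = 0) :
    ∃ f : F → G, AnalyticAt ℂ f (u x) ∧ ∀ᶠ y in 𝓝 x, g y = f (u y) := by
  have : CompleteSpace F := FiniteDimensional.complete ℂ F
  obtain ⟨Ψ, Φ, hΨ, hΦ, hΨx, hΦx, hl, hr, he⟩ := exists_straightening hu hs
  obtain ⟨ρ, hρ⟩ := exists_rightInverse_clm hs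
  set L := fderiv ℂ u x with hL
  have hΦt : Tendsto Φ (𝓝 x) (𝓝 x) := by simpa [hΦx] using hΦ.continuousAt.tendsto
  have hΨt : Tendsto Ψ (𝓝 x) (𝓝 x) := by simpa [hΨx] using hΨ.continuousAt.tendsto
  have huΦ : ∀ᶠ z in 𝓝 x, u (Φ z) = u x + L (z - x) := by
    filter_upwards [hr] with z hz
    rw [he, hz]
  have key := eventually_eq_comp_projection (h := g ∘ Φ) (x := x) hρ ?_ ?_
  · refine ⟨fun t => g (Φ (x + ρ (t - u x))), ?_, ?_⟩
    · have h1 : AnalyticAt ℂ (fun t => x + ρ (t - u x)) (u x) :=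
        analyticAt_const.add ((ρ.analyticAt _).comp (analyticAt_id.sub analyticAt_const))
      have h2 : AnalyticAt ℂ Φ (x + ρ (u x - u x)) := by simpa using hΦ
      have h3 : AnalyticAt ℂ g (Φ (x + ρ (u x - u x))) := by simpa [hΦx] using hg
      exact AnalyticAt.comp (g := g ∘ Φ ) (h3.comp h2) h1
    · filter_upwards [hl, hΨt.eventually key] with y hy hy'
      simp only [Function.comp_apply, hy] at hy'
      rw [hy', show L (Ψ y - x) = u y - u x by rw [he y]; abel]
  · filter_upwards [hΦ.eventually_analyticAt, hΦt.eventually hg.eventually_analyticAt] with z h1 h2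
    exact (h2.comp h1).differentiableAt
  · filter_upwards [hΦ.eventually_analyticAt, hΦt.eventually hg.eventually_analyticAt,
      hΦt.eventually hd, huΦ.eventually_nhds, hΦt.eventually hu.eventually_analyticAt]
      with z h1 h2 h3 h4 h5 v hv
    rw [(h2.differentiableAt.hasFDerivAt.comp z h1.differentiableAt.hasFDerivAt).fderiv]
    refine h3 _ ?_
    have h6 := (h5.differentiableAt.hasFDerivAt.comp z h1.differentiableAt.hasFDerivAt).fderiv
    have h7 : HasFDerivAt (fun z => u x + L (z - x)) L z :=
      (L.hasFDerivAt.comp z (hasFDerivAt_sub_const x)).const_add _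
    have h8 : (u ∘ Φ) =ᶠ[𝓝 z] fun z => u x + L (z - x) := h4
    rw [h8.fderiv_eq, h7.fderiv] at h6
    rw [← hv, h6]
    rfl

end submersion

/-! ### Coordinates on alternating forms -/

section forms

variable {r p : ℕ}

/-- The tuple of coordinate vectors with indices `v`. -/
def coordVec (v : Fin p → Fin r) : Fin p → (Fin r → ℂ) := fun a => Pi.single (v a) 1

/-- The form `dy_{α_1} ∧ … ∧ dy_{α_p}`. -/
def coordForm (A : IncIdx p r) : Form r p :=
  { (Matrix.detRowAlternating (R := ℂ) (n := Fin p)).compLinearMap (LinearMap.funLeft ℂ ℂ A) with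
    cont := by
      change Continuous fun m : Fin p → (Fin r → ℂ) =>
        (Matrix.of fun b a => m b (A a) : Matrix (Fin p) (Fin p) ℂ).det
      exact Continuous.matrix_det (continuous_matrix fun b a => by simp only [Matrix.of_apply]; fun_prop) }

theorem coordForm_apply (A : IncIdx p r) (m : Fin p → (Fin r → ℂ)) :
    coordForm A m = (Matrix.of fun a b : Fin p => m b (A a)).det := by
  rw [← Matrix.det_transpose]
  rfl

theorem coordForm_coordVec (A B : IncIdx p r) :
    coordForm A (coordVec B) = if A = B then 1 else 0 := by
  rw [coordForm_apply]
  split_ifs with h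
  · subst h
    convert Matrix.det_one (R := ℂ) (n := Fin p)
    ext a b
    simp [coordVec, Pi.single_apply, Matrix.one_apply]
  · have : ∃ a, ∀ b, A a ≠ B b := by
      by_contra! hc
      refine h (DFunLike.coe_injective ((StrictMono.range_inj A.strictMono B.strictMono).1 ?_))
      refine Set.eq_of_subset_of_ncard_le ?_ ?_ (Set.toFinite _)
      · rintro _ ⟨a, rfl⟩
        obtain ⟨b, hb⟩ := hc a
        exact ⟨b, hb.symm⟩
      · rw [← Set.image_univ, ← Set.image_univ, Set.ncard_image_of_injective _ A.injective,
          Set.ncard_image_of_injective _ B.injective]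
    obtain ⟨a, ha⟩ := this
    exact Matrix.det_eq_zero_of_row_eq_zero a fun b => by
      simp [coordVec, Pi.single_apply, ha b]

/-- An alternating map is determined on injective tuples of basis vectors, and sorting such a tuple
only changes a sign. -/
theorem form_ext {ω ω' : Form r p} (h : ∀ A : IncIdx p r, ω (coordVec A) = ω' (coordVec A)) :
    ω = ω' := by
  have : ω.toAlternatingMap = ω'.toAlternatingMap := by
    refine Module.Basis.ext_alternating (Pi.basisFun ℂ (Fin r)) fun v hv => ?_
    have hm : StrictMono (v ∘ Tuple.sort v) :=
      (Tuple.monotone_sort v).strictMono_of_injective (hv.comp (Tuple.sort v).injective)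
    have h1 := h (OrderEmbedding.ofStrictMono _ hm)
    have h2 : coordVec (OrderEmbedding.ofStrictMono _ hm) =
      (fun i => (Pi.basisFun ℂ (Fin r)) (v i)) ∘ Tuple.sort v := by
      funext i
      simp [coordVec]
    rw [h2] at h1
    have h3 := ω.toAlternatingMap.map_perm (fun i => (Pi.basisFun ℂ (Fin r)) (v i)) (Tuple.sort v)
    have h4 := ω'.toAlternatingMap.map_perm (fun i => (Pi.basisFun ℂ (Fin r)) (v i)) (Tuple.sort v)
    have h5 := h3.symm.trans (h1.trans h4)
    exact smul_left_cancel _ h5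
  ext m
  exact DFunLike.congr_fun this m

theorem form_eq_sum (ω : Form r p) : ω = ∑ A : IncIdx p r, ω (coordVec A) • coordForm A := by
  refine form_ext fun B => ?_
  simp [ContinuousAlternatingMap.sum_apply, coordForm_coordVec]

theorem form_apply_eq_sum (ω : Form r p) (m : Fin p → (Fin r → ℂ)) :
    ω m = ∑ A : IncIdx p r,
      ω (coordVec A) * (Matrix.of fun a b : Fin p => m b (A a)).det := by
  conv_lhs => rw [form_eq_sum ω]
  simp [ContinuousAlternatingMap.sum_apply, coordForm_apply]

variable {D : Type*} [NormedAddCommGroup D] [NormedSpace ℂ D] {x : D}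

theorem analyticAt_form {ω : D → Form r p}
    (h : ∀ A : IncIdx p r, AnalyticAt ℂ (fun y => ω y (coordVec A)) x) : AnalyticAt ℂ ω x := by
  rw [show ω = fun y => ∑ A : IncIdx p r, ω y (coordVec A) • coordForm A from
    funext fun y => form_eq_sum (ω y)]
  exact Finset.analyticAt_fun_sum _ fun A _ => (h A).smul analyticAt_const

theorem analyticAt_det {ι : Type*} [Fintype ι] [DecidableEq ι] {M : D → Matrix ι ι ℂ}
    (h : ∀ a b, AnalyticAt ℂ (fun y => M y a b) x) : AnalyticAt ℂ (fun y => (M y).det) x := by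
  simp only [Matrix.det_apply]
  exact Finset.analyticAt_fun_sum _ fun σ _ =>
    AnalyticAt.const_smul (Finset.analyticAt_fun_prod _ fun i _ => h _ _)

theorem analyticAt_form_eval {ω : D → Form r p} (h : AnalyticAt ℂ ω x) (m : Fin p → (Fin r → ℂ)) :
    AnalyticAt ℂ (fun y => ω y m) x :=
  ((ContinuousAlternatingMap.apply ℂ (Fin r → ℂ) ℂ m).analyticAt _).comp h

theorem analyticAt_clm_eval {F G : Type*} [NormedAddCommGroup F] [NormedSpace ℂ F]
    [NormedAddCommGroup G] [NormedSpace ℂ G] {A : D → F →L[ℂ] G} (h : AnalyticAt ℂ A x) (w : F) :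
    AnalyticAt ℂ (fun y => A y w) x :=
  ((ContinuousLinearMap.apply ℂ G w).analyticAt _).comp h

theorem analyticAt_form_comp {s : ℕ} {ω : D → Form r p}
    (h : AnalyticAt ℂ ω x) {A : D → (Fin s → ℂ) →L[ℂ] (Fin r → ℂ)} (hA : AnalyticAt ℂ A x) :
    AnalyticAt ℂ (fun y => (ω y).compContinuousLinearMap (A y)) x := by
  refine analyticAt_form fun B => ?_
  simp only [ContinuousAlternatingMap.compContinuousLinearMap_apply, Function.comp_def]
  rw [show (fun y => ω y fun i => A y (coordVec B i)) = fun y => ∑ C : IncIdx p r,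
      ω y (coordVec C) * (Matrix.of fun a b : Fin p => A y (coordVec B b) (C a)).det from
    funext fun y => form_apply_eq_sum _ _]
  refine Finset.analyticAt_fun_sum _ fun C _ => AnalyticAt.mul (analyticAt_form_eval h _) ?_
  exact analyticAt_det fun a b =>
    ((ContinuousLinearMap.proj (R := ℂ) (φ := fun _ : Fin r => ℂ) (C a)).analyticAt _).comp
      (analyticAt_clm_eval hA _)

/-- The arguments are exchanged one at a time; each exchange changes the value by the form evaluated
on a tuple with an entry in ker L. -/
theorem eq_of_semibasic {G : Type*} [AddCommGroup G] [Module ℂ G] {L : (Fin r → ℂ) →ₗ[ℂ] G}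
    {ω : Form r p} (h : ∀ (m : Fin p → (Fin r → ℂ)) (j : Fin p), L (m j) = 0 → ω m = 0)
    {m m' : Fin p → (Fin r → ℂ)} (hm : ∀ j, L (m j) = L (m' j)) : ω m = ω m' := by
  classical
  have key : ∀ s : Finset (Fin p), ω (s.piecewise m' m) = ω m := by
    intro s
    induction s using Finset.induction_on with
    | empty => simp
    | insert j s hj ih =>
      rw [Finset.piecewise_insert, ← ih]
      have h1 := ω.map_update_sub (s.piecewise m' m) j (m' j) (m j)
      rw [h _ j (by simp [hm])] at h1
      have h2 : Function.update (s.piecewise m' m) j (m j) = s.piecewise m' m := by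
        rw [Function.update_eq_self_iff]
        simp [hj]
      rw [h2] at h1
      exact (sub_eq_zero.1 h1.symm)
  rw [← key Finset.univ, Finset.piecewise_univ]

theorem extDeriv_eq_sum (ω : (Fin r → ℂ) → Form r p) (x : Fin r → ℂ)
    (m : Fin (p + 1) → (Fin r → ℂ)) :
    extDeriv ω x m = ∑ i : Fin (p + 1), (-1 : ℤ) ^ (i : ℕ) • fderiv ℂ ω x (m i) (i.removeNth m) :=
  ContinuousAlternatingMap.alternatizeUncurryFin_apply _ _

/-- Basic forms are locally pulled back from the target of the submersion. -/
theorem exists_eq_pullback_of_basic {s : ℕ} {u : (Fin r → ℂ) → (Fin s → ℂ)} {x : Fin r → ℂ}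
    (hu : AnalyticAt ℂ u x) (hs : Function.Surjective (fderiv ℂ u x))
    {ω : (Fin r → ℂ) → Form r p} (hω : AnalyticAt ℂ ω x)
    (h1 : ∀ᶠ y in 𝓝 x, ∀ (m : Fin p → (Fin r → ℂ)) (j : Fin p),
      fderiv ℂ u y (m j) = 0 → ω y m = 0)
    (h2 : ∀ᶠ y in 𝓝 x, ∀ (m : Fin (p + 1) → (Fin r → ℂ)) (j : Fin (p + 1)),
      fderiv ℂ u y (m j) = 0 → extDeriv ω y m = 0) :
    ∃ η : (Fin s → ℂ) → Form s p, AnalyticAt ℂ η (u x) ∧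
      ∀ᶠ y in 𝓝 x, ω y = (η (u y)).compContinuousLinearMap (fderiv ℂ u y) := by
  obtain ⟨Ψ, Φ, hΨ, hΦ, hΨx, hΦx, hl, hr, he⟩ := exists_straightening hu hs
  obtain ⟨ρ, hρ⟩ := exists_rightInverse_clm hs
  set L := fderiv ℂ u x with hL
  have hΦt : Tendsto Φ (𝓝 x) (𝓝 x) := by simpa [hΦx] using hΦ.continuousAt.tendsto
  have hΨt : Tendsto Ψ (𝓝 x) (𝓝 x) := by simpa [hΨx] using hΨ.continuousAt.tendsto
  have huΦ : ∀ᶠ z in 𝓝 x, (fderiv ℂ u (Φ z)).comp (fderiv ℂ Φ z) = L := by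
    have : ∀ᶠ z in 𝓝 x, u (Φ z) = u x + L (z - x) := by
      filter_upwards [hr] with z hz
      rw [he, hz]
    filter_upwards [hΦ.eventually_analyticAt, this.eventually_nhds,
      hΦt.eventually hu.eventually_analyticAt] with z h1 h4 h5
    have h6 := (h5.differentiableAt.hasFDerivAt.comp z h1.differentiableAt.hasFDerivAt).fderiv
    have h7 : HasFDerivAt (fun z => u x + L (z - x)) L z :=
      (L.hasFDerivAt.comp z (hasFDerivAt_sub_const x)).const_add _
    have h8 : (u ∘ Φ) =ᶠ[𝓝 z] fun z => u x + L (z - x) := h4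
    rw [h8.fderiv_eq, h7.fderiv] at h6
    exact h6.symm
  -- The form is transported to coordinates in which the foliation has the constant direction ker L.
  let ω' : (Fin r → ℂ) → Form r p := fun z => (ω (Φ z)).compContinuousLinearMap (fderiv ℂ Φ z)
  have hω' : AnalyticAt ℂ ω' x := analyticAt_form_comp
    (AnalyticAt.comp_of_eq hω hΦ hΦx) hΦ.fderiv
  have hsemi : ∀ᶠ z in 𝓝 x, ∀ (m : Fin p → (Fin r → ℂ)) (j : Fin p), L (m j) = 0 → ω' z m = 0 := by
    filter_upwards [huΦ, hΦt.eventually h1] with z hz hz1 m j hm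
    refine hz1 _ j ?_
    have := congrArg (fun T => T (m j)) hz
    exact this.trans hm
  have hext : ∀ᶠ z in 𝓝 x, ∀ (m : Fin (p + 1) → (Fin r → ℂ)) (j : Fin (p + 1)),
      L (m j) = 0 → extDeriv ω' z m = 0 := by
    filter_upwards [huΦ, hΦt.eventually h2, hΦ.eventually_analyticAt,
      hΦt.eventually hω.eventually_analyticAt] with z hz hz1 h3 h4 m j hm
    rw [extDeriv_pullback (r := ⊤) h4.differentiableAt h3.contDiffAt (by simp)]
    refine hz1 _ j ?_
    have := congrArg (fun T => T (m j)) hz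
    exact this.trans hm
  have hconst := eventually_eq_comp_projection (h := ω') hρ
    (hω'.eventually_analyticAt.mono fun z hz => hz.differentiableAt) (by
      filter_upwards [hsemi.eventually_nhds, hext, hω'.eventually_analyticAt] with z hz1 hz2 hz3 v hv
      -- As the kernel no longer depends on the point, semibasicity can be differentiated.
      have hzero : ∀ (w : Fin r → ℂ) (m : Fin p → (Fin r → ℂ)) (j : Fin p), L (m j) = 0 →
          fderiv ℂ ω' z w m = 0 := by
        intro w m j hm
        have h3 : HasFDerivAt (fun y => ω' y m) _ z :=
          (ContinuousAlternatingMap.apply ℂ (Fin r → ℂ) ℂ m).hasFDerivAt.comp z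
            hz3.differentiableAt.hasFDerivAt
        have h4 : (fun y => ω' y m) =ᶠ[𝓝 z] fun _ => 0 := hz1.mono fun y hy => hy m j hm
        have h5 := h3.fderiv
        rw [h4.fderiv_eq] at h5
        have h6 := congrArg (fun T => T w) h5
        simpa using h6.symm
      ext m
      -- In the expansion of dω'(v, m) every term but the first keeps v ∈ ker L among the arguments
      -- and vanishes by `hzero`. What remains says that the derivative of ω' along v is zero.
      have h3 := hz2 (Fin.cons v m) 0 (by simpa using hv)
      rw [extDeriv_eq_sum, Fin.sum_univ_succ] at h3
      rw [Finset.sum_eq_zero] at h3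
      · simpa using h3
      · intro i _
        cases p with
        | zero => exact i.elim0
        | succ p =>
          let c : Fin (p + 1 + 1) → (Fin r → ℂ) := Fin.cons v m
          have h4 : fderiv ℂ ω' z (c i.succ) (i.succ.removeNth c) = 0 :=
            hzero _ _ 0 (by simpa [Fin.removeNth, c] using hv)
          exact (congrArg _ h4).trans (smul_zero _))
  -- The form on the target is the restriction of ω' to the affine section t ↦ x + ρ(t - u x).
  refine ⟨fun t => (ω' (x + ρ (t - u x))).compContinuousLinearMap ρ, ?_, ?_⟩
  · refine analyticAt_form_comp (AnalyticAt.comp_of_eq hω' ?_ (by simp)) analyticAt_const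
    exact analyticAt_const.add ((ρ.analyticAt _).comp (analyticAt_id.sub analyticAt_const))
  · filter_upwards [hl.eventually_nhds, hΨt.eventually hconst, hΨ.eventually_analyticAt,
      hΨt.eventually hΦ.eventually_analyticAt, hΨt.eventually hsemi] with y hy1 hy2 hy3 hy4 hy5
    have e1 : (fderiv ℂ Φ (Ψ y)).comp (fderiv ℂ Ψ y) = ContinuousLinearMap.id ℂ _ := by
      have h5 := (hy4.differentiableAt.hasFDerivAt.comp y hy3.differentiableAt.hasFDerivAt).fderiv
      have h6 : (Φ ∘ Ψ) =ᶠ[𝓝 y] id := hy1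
      rw [h6.fderiv_eq, fderiv_id] at h5
      exact h5.symm
    have e2 : fderiv ℂ u y = L.comp (fderiv ℂ Ψ y) := by
      have h5 : HasFDerivAt (fun y => u x + L (Ψ y - x)) (L.comp (fderiv ℂ Ψ y)) y :=
        (L.hasFDerivAt.comp y (hy3.differentiableAt.hasFDerivAt.sub_const x)).const_add _
      rw [← h5.fderiv]
      exact congrArg (fun f => fderiv ℂ f y) (funext he)
    ext m
    have e3 : ω y m = ω' (Ψ y) (fun i => fderiv ℂ Ψ y (m i)) := by
      simp only [ω', ContinuousAlternatingMap.compContinuousLinearMap_apply, Function.comp_def]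
      have : ∀ i, fderiv ℂ Φ (Ψ y) (fderiv ℂ Ψ y (m i)) = m i := fun i =>
        congrArg (fun T => T (m i)) e1
      simp only [this, hy1.self_of_nhds]
    have e4 : L (Ψ y - x) = u y - u x := by rw [he y]; abel
    rw [e3, eq_of_semibasic (L := L.toLinearMap) hy5
      (m' := fun i => ρ (L (fderiv ℂ Ψ y (m i)))) (fun i => (hρ _).symm), hy2, e4, e2]
    rfl

end forms

/-! ### Linear differential systems -/

section uniqueness

variable {E X : Type*} [NormedAddCommGroup E] [NormedSpace ℂ E] [NormedAddCommGroup X]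
  [NormedSpace ℂ X]

/-- The derivative along a real ray of a complex differentiable function. -/
theorem hasDerivAt_comp_ray {g : E → X} {x y : E} {t : ℝ}
    (hg : DifferentiableAt ℂ g (x + (t : ℂ) • y)) :
    HasDerivAt (fun s : ℝ => g (x + (s : ℂ) • y)) (fderiv ℂ g (x + (t : ℂ) • y) y) t := by
  have h1 : HasDerivAt (fun s : ℝ => x + (s : ℂ) • y) y t := by
    simpa using ((Complex.ofRealCLM.hasDerivAt (x := t)).smul_const y).const_add x
  exact (hg.hasFDerivAt.restrictScalars ℝ).comp_hasDerivAt t h1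

theorem eventually_norm_lt {g : E → X} {x : E} (hg : AnalyticAt ℂ g x) :
    ∀ᶠ y in 𝓝 x, ‖g y‖ < ‖g x‖ + 1 :=
  hg.continuousAt.norm.eventually_lt_const (lt_add_one _)

/-- Along the real segment from x to a nearby point the system becomes a linear differential
equation with bounded coefficient, and Grönwall's inequality applies. -/
theorem eventually_eq_zero_of_linear_system {B : E → (E →L[ℂ] X →L[ℂ] X)} {g : E → X} {x : E}
    (hB : AnalyticAt ℂ B x) (hg : ∀ᶠ y in 𝓝 x, DifferentiableAt ℂ g y)
    (h : ∀ᶠ y in 𝓝 x, ∀ v, fderiv ℂ g y v = B y v (g y)) (h0 : g x = 0) :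
    ∀ᶠ y in 𝓝 x, g y = 0 := by
  have hb : ∀ᶠ y in 𝓝 x, ‖B y‖ < ‖B x‖ + 1 :=
    eventually_norm_lt hB
  obtain ⟨r, hr, H⟩ := Metric.eventually_nhds_iff_ball.1 ((hb.and hg).and h)
  filter_upwards [Metric.ball_mem_nhds x hr] with z hz
  have hin : ∀ t : ℝ, t ∈ Set.Icc (0 : ℝ) 1 → x + (t : ℂ) • (z - x) ∈ Metric.ball x r := by
    intro t ht
    rw [Metric.mem_ball, dist_eq_norm] at hz ⊢
    rw [add_sub_cancel_left, norm_smul, Complex.norm_real, Real.norm_of_nonneg ht.1]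
    exact (mul_le_of_le_one_left (norm_nonneg _) ht.2).trans_lt hz
  have hder : ∀ t : ℝ, t ∈ Set.Icc (0 : ℝ) 1 →
      HasDerivAt (fun s : ℝ => g (x + (s : ℂ) • (z - x)))
        (fderiv ℂ g (x + (t : ℂ) • (z - x)) (z - x)) t :=
    fun t ht => hasDerivAt_comp_ray (H _ (hin t ht)).1.2
  have := eq_zero_of_abs_deriv_le_mul_abs_self_of_eq_zero_right
    (f := fun s : ℝ => g (x + (s : ℂ) • (z - x))) (K := (‖B x‖ + 1) * ‖z - x‖) (a := 0) (b := 1)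
    (fun t ht => (hder t ht).continuousAt.continuousWithinAt)
    (fun t ht => (hder t ⟨ht.1, ht.2.le⟩).hasDerivWithinAt) (by simpa using h0) ?_ 1 (by simp)
  · simpa using this
  · intro t ht
    have h1 := H _ (hin t ⟨ht.1, ht.2.le⟩)
    rw [h1.2]
    refine (ContinuousLinearMap.le_opNorm _ _).trans ?_
    gcongr
    refine (ContinuousLinearMap.le_opNorm _ _).trans ?_
    gcongr
    exact h1.1.1.le

end uniqueness

/-! ### Path-valued analytic functions: restriction of an analytic function to rays. -/

section frobenius

open unitInterval

variable {A : Type*} [NormedRing A] [NormedAlgebra ℂ A]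

/-- Primitives of continuous functions on `[0, 1]`. -/
def primitive : C(I, A) →L[ℂ] C(I, A) :=
  LinearMap.mkContinuous
    { toFun := fun f => ⟨fun t => ∫ s in (0 : ℝ)..t, f (Set.projIcc 0 1 zero_le_one s), by
        have hf : Continuous fun s : ℝ => f (Set.projIcc 0 1 zero_le_one s) :=
          f.continuous.comp continuous_projIcc
        exact (intervalIntegral.continuous_primitive
          (fun a b => hf.intervalIntegrable a b) 0).comp continuous_subtype_val⟩
      map_add' := fun f g => by
        ext t
        simp only [ContinuousMap.coe_mk, ContinuousMap.add_apply]
        exact intervalIntegral.integral_add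
          ((f.continuous.comp continuous_projIcc).intervalIntegrable _ _)
          ((g.continuous.comp continuous_projIcc).intervalIntegrable _ _)
      map_smul' := fun c f => by
        ext t
        simp [intervalIntegral.integral_smul] } 1 fun f => by
    rw [one_mul]
    refine (ContinuousMap.norm_le _ (norm_nonneg f)).2 fun t => ?_
    refine (intervalIntegral.norm_integral_le_of_norm_le_const
      (C := ‖f‖) fun s _ => f.norm_coe_le_norm _).trans ?_
    rw [sub_zero, abs_of_nonneg t.2.1]
    exact mul_le_of_le_one_right (norm_nonneg _) t.2.2

/-- The inclusion `a ↦ (t ↦ t ^ k a)` of `A` in the space of paths. -/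
def monomialPath (k : ℕ) : A →L[ℂ] C(I, A) :=
  LinearMap.mkContinuous
    { toFun := fun a => ⟨fun t => ((t : ℝ) : ℂ) ^ k • a, by fun_prop⟩
      map_add' := fun a b => by
        ext t
        simp
      map_smul' := fun c a => by
        ext t
        simp [smul_comm c] } 1 fun a => by
    rw [one_mul]
    refine (ContinuousMap.norm_le _ (norm_nonneg a)).2 fun t => ?_
    simp only [LinearMap.coe_mk, AddHom.coe_mk, ContinuousMap.coe_mk, norm_smul, norm_pow,
      Complex.norm_real, Real.norm_of_nonneg t.2.1]
    exact mul_le_of_le_one_left (norm_nonneg _) (pow_le_one₀ t.2.1 t.2.2)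

theorem monomialPath_apply (k : ℕ) (a : A) (t : I) :
    monomialPath k a t = ((t : ℝ) : ℂ) ^ k • a := rfl

theorem norm_monomialPath_le (k : ℕ) : ‖(monomialPath k : A →L[ℂ] C(I, A))‖ ≤ 1 :=
  LinearMap.mkContinuous_norm_le _ zero_le_one _

variable {E : Type*} [NormedAddCommGroup E] [NormedSpace ℂ E]

/-- The expansion, in a space of paths, of the restriction of a power series to rays. -/
def raySeries (P : FormalMultilinearSeries ℂ E A) : FormalMultilinearSeries ℂ E C(I, A) :=
  fun k => (monomialPath k).compContinuousMultilinearMap (P k)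

theorem raySeries_apply (P : FormalMultilinearSeries ℂ E A) (k : ℕ) (y : E) (t : I) :
    raySeries P k (fun _ => y) t = P k (fun _ => ((t : ℝ) : ℂ) • y) := by
  rw [(P k).map_smul_univ (fun _ => ((t : ℝ) : ℂ)) (fun _ => y), Finset.prod_const,
    Finset.card_univ, Fintype.card_fin]
  exact monomialPath_apply k _ t

theorem norm_raySeries_le (P : FormalMultilinearSeries ℂ E A) (k : ℕ) :
    ‖raySeries P k‖ ≤ ‖P k‖ := by
  refine ContinuousMultilinearMap.opNorm_le_bound (norm_nonneg _) fun m => ?_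
  calc ‖monomialPath k (P k m)‖ ≤ ‖(monomialPath k : A →L[ℂ] C(I, A))‖ * ‖P k m‖ :=
        ContinuousLinearMap.le_opNorm _ _
    _ ≤ 1 * ‖P k m‖ := by gcongr; exact norm_monomialPath_le k
    _ = ‖P k m‖ := one_mul _
    _ ≤ _ := (P k).le_opNorm m

theorem radius_le_radius_raySeries (P : FormalMultilinearSeries ℂ E A) :
    P.radius ≤ (raySeries P).radius := by
  refine ENNReal.le_of_forall_nnreal_lt fun s hs => ?_
  obtain ⟨C, _, hC⟩ := P.norm_mul_pow_le_of_lt_radius hs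
  exact (raySeries P).le_radius_of_bound C fun k =>
    (mul_le_mul_of_nonneg_right (norm_raySeries_le P k) (by positivity)).trans (hC k)

variable [CompleteSpace A]

/-- The restriction of an analytic function to the rays issued from a point, as an analytic
function with values in a space of paths. -/
theorem exists_analyticAt_rays {b : E → A} {x : E} (hb : AnalyticAt ℂ b x) :
    ∃ β : E → C(I, A), AnalyticAt ℂ β 0 ∧
      ∀ᶠ y in 𝓝 (0 : E), ∀ t : I, β y t = b (x + ((t : ℝ) : ℂ) • y) := by
  obtain ⟨P, r, hP⟩ := hb
  have hr : r ≤ (raySeries P).radius := hP.r_le.trans (radius_le_radius_raySeries P)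
  have hsum : ∀ y ∈ Metric.eball (0 : E) r,
      HasSum (fun k => raySeries P k fun _ => y) ((raySeries P).sum y) := fun y hy =>
    (raySeries P).hasSum (Metric.eball_subset_eball hr hy)
  have hball : HasFPowerSeriesOnBall (raySeries P).sum (raySeries P) 0 r :=
    ⟨hr, hP.r_pos, fun {y} hy => by rw [zero_add]; exact hsum y hy⟩
  refine ⟨(raySeries P).sum, hball.analyticAt, ?_⟩
  filter_upwards [Metric.eball_mem_nhds (0 : E) hP.r_pos] with y hy t
  have h1 := (ContinuousMap.evalCLM ℂ t : C(I, A) →L[ℂ] A).hasSum (hsum y hy)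
  have hty : ((t : ℝ) : ℂ) • y ∈ Metric.eball (0 : E) r := by
    rw [Metric.mem_eball, edist_zero_right] at hy ⊢
    refine lt_of_le_of_lt ?_ hy
    rw [← ofReal_norm, ← ofReal_norm]
    refine ENNReal.ofReal_le_ofReal ?_
    rw [norm_smul, Complex.norm_real, Real.norm_of_nonneg t.2.1]
    exact mul_le_of_le_one_left (norm_nonneg _) t.2.2
  have h2 := hP.hasSum hty
  refine h1.unique ?_
  have h3 : (fun k => (ContinuousMap.evalCLM ℂ t : C(I, A) →L[ℂ] A) (raySeries P k fun _ => y)) =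
      fun k => P k fun _ => ((t : ℝ) : ℂ) • y := funext fun k => raySeries_apply P k y t
  exact h3 ▸ h2

end frobenius

/-! ### Radial integration and the holomorphic Frobenius theorem. -/

section frobenius

open unitInterval

theorem analyticAt_comp_mul {D R : Type*} [NormedAddCommGroup D] [NormedSpace ℂ D] [NormedRing R]
    [NormedAlgebra ℂ R] (K : R →L[ℂ] R) {c : D → R} {x : D} (hc : AnalyticAt ℂ c x) :
    AnalyticAt ℂ (fun y => K.comp (ContinuousLinearMap.mul ℂ R (c y))) x :=
  ((ContinuousLinearMap.compL ℂ R R R K).analyticAt _).comp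
    (((ContinuousLinearMap.mul ℂ R).analyticAt _).comp hc)

/-- The solution is (1 - T y)⁻¹ w, analytic in y because inversion is. Working in a Banach space of
paths, this replaces the theorem on analytic dependence of solutions on parameters; the uniqueness
clause serves for rescaling along rays. -/
theorem exists_analyticAt_fixedPoint {D Y : Type*} [NormedAddCommGroup D] [NormedSpace ℂ D]
    [NormedAddCommGroup Y] [NormedSpace ℂ Y] [CompleteSpace Y] {T : D → Y →L[ℂ] Y} {x : D}
    (hT : AnalyticAt ℂ T x) (h0 : T x = 0) (w : Y) :
    ∃ G : D → Y, AnalyticAt ℂ G x ∧ G x = w ∧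
      ∀ᶠ y in 𝓝 x, G y = w + T y (G y) ∧ ∀ h, h = w + T y h → h = G y := by
  have h1T : AnalyticAt ℂ (fun y => 1 - T y) x := analyticAt_const.sub hT
  have hu0 : IsUnit (1 - T x) := by simp [h0]
  have hunit : ∀ᶠ y in 𝓝 x, IsUnit (1 - T y) :=
    h1T.continuousAt.eventually (Units.isOpen.mem_nhds hu0)
  refine ⟨fun y => Ring.inverse (1 - T y) w, ?_, by simp [h0], ?_⟩
  · obtain ⟨z, hz⟩ := hu0
    have h2 := analyticAt_inverse (𝕜 := ℂ) z
    rw [hz] at h2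
    exact analyticAt_clm_eval (AnalyticAt.comp (g := Ring.inverse) (f := fun y => 1 - T y) h2 h1T) _
  · filter_upwards [hunit] with y hy
    constructor
    · have h1 : (1 - T y) (Ring.inverse (1 - T y) w) = w :=
        DFunLike.congr_fun (Ring.mul_inverse_cancel _ hy) w
      exact sub_eq_iff_eq_add.1 h1
    · intro h hh
      have h2 : Ring.inverse (1 - T y) ((1 - T y) h) = h :=
        DFunLike.congr_fun (Ring.inverse_mul_cancel _ hy) h
      rw [← h2, show (1 - T y) h = w from sub_eq_iff_eq_add.2 hh]

variable {A : Type*} [NormedRing A] [NormedAlgebra ℂ A] [CompleteSpace A]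
  {n : ℕ} {B : (Fin n → ℂ) → ((Fin n → ℂ) →L[ℂ] A)} {x : Fin n → ℂ}

/-- The solution of a linear differential system along the rays issued from a point. -/
theorem exists_radial_solution (hB : AnalyticAt ℂ B x) :
    ∃ S : (Fin n → ℂ) → A, AnalyticAt ℂ S x ∧ S x = 1 ∧
      ∀ᶠ z in 𝓝 x, fderiv ℂ S z (z - x) = B z (z - x) * S z := by
  choose β hβ hβ' using fun l : Fin n =>
    exists_analyticAt_rays (analyticAt_clm_eval hB (Pi.single l (1 : ℂ)))
  -- The path t ↦ B(x + t y) y, written in coordinates so that its analytic dependence on y is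
  -- visible.
  let C : (Fin n → ℂ) → C(I, A) := fun y => ∑ l, y l • β l y
  have hC : AnalyticAt ℂ C 0 := Finset.analyticAt_fun_sum _ fun l _ =>
    ((ContinuousLinearMap.proj (R := ℂ) (φ := fun _ : Fin n => ℂ) l).analyticAt _).smul (hβ l)
  have hC' : ∀ᶠ y in 𝓝 (0 : Fin n → ℂ), ∀ t : I, C y t = B (x + ((t : ℝ) : ℂ) • y) y := by
    filter_upwards [eventually_all.2 hβ'] with y hy t
    simp only [C, ContinuousMap.sum_apply, ContinuousMap.smul_apply, hy]
    have := map_sum (B (x + ((t : ℝ) : ℂ) • y)) (fun i => y i • Pi.single i (1 : ℂ)) Finset.univ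
    simp only [map_smul] at this
    rw [← this]
    congr 1
    ext i
    simp [Finset.sum_apply, Pi.single_apply]
  let T : (Fin n → ℂ) → (C(I, A) →L[ℂ] C(I, A)) := fun y =>
    primitive.comp (ContinuousLinearMap.mul ℂ C(I, A) (C y))
  have hT : AnalyticAt ℂ T 0 := analyticAt_comp_mul primitive hC
  have hT0 : T 0 = 0 := by
    have : C 0 = 0 := by
      ext t
      simp [C, ContinuousMap.sum_apply]
    ext f t
    simp [T, this]
  have hTa : ∀ y f (t : I), T y f t = ∫ s in (0 : ℝ)..t, C y (Set.projIcc 0 1 zero_le_one s) *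
      f (Set.projIcc 0 1 zero_le_one s) := fun y f t => rfl
  obtain ⟨G, hG, hG0, hG1⟩ := exists_analyticAt_fixedPoint hT hT0 (1 : C(I, A))
  obtain ⟨r, hr, H⟩ := Metric.eventually_nhds_iff_ball.1 (hG1.and hC')
  have hfix : ∀ y ∈ Metric.ball (0 : Fin n → ℂ) r, ∀ t : I, G y t = 1 + T y (G y) t :=
    fun y hy t => DFunLike.congr_fun (H y hy).1.1 t
  have huniq : ∀ y ∈ Metric.ball (0 : Fin n → ℂ) r, ∀ h : C(I, A),
      (∀ t : I, h t = 1 + T y h t) → h = G y :=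
    fun y hy h hh => (H y hy).1.2 h (ContinuousMap.ext hh)
  have hball : ∀ y ∈ Metric.ball (0 : Fin n → ℂ) r, ∀ t : I,
      ((t : ℝ) : ℂ) • y ∈ Metric.ball (0 : Fin n → ℂ) r := by
    intro y hy t
    rw [mem_ball_zero_iff] at hy ⊢
    rw [norm_smul, Complex.norm_real, Real.norm_of_nonneg t.2.1]
    exact (mul_le_of_le_one_left (norm_nonneg _) t.2.2).trans_lt hy
  -- The path s ↦ G_y(ts) solves the integral equation attached to t y, so by uniqueness G_{ty}(1) =
  -- G_y(t). Hence S(z) = G_{z-x}(1) follows, on each ray, the solution of one differential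
  -- equation.
  have hscale : ∀ y ∈ Metric.ball (0 : Fin n → ℂ) r, ∀ t : I,
      G (((t : ℝ) : ℂ) • y) 1 = G y t := by
    intro y hy t
    let h : C(I, A) := (G y).comp ⟨fun s => t * s, by fun_prop⟩
    have hh : h = G (((t : ℝ) : ℂ) • y) := by
      refine huniq _ (hball y hy t) h fun s => ?_
      have h1 : h s = G y (t * s) := rfl
      rw [h1, hfix y hy, hTa, hTa]
      congr 1
      have h2 := intervalIntegral.smul_integral_comp_mul_left (a := 0) (b := (s : ℝ))
        (fun τ => C y (Set.projIcc 0 1 zero_le_one τ) * G y (Set.projIcc 0 1 zero_le_one τ)) (t : ℝ)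
      rw [mul_zero] at h2
      rw [show ((t * s : I) : ℝ) = (t : ℝ) * s from rfl, ← h2, ← intervalIntegral.integral_smul]
      refine intervalIntegral.integral_congr fun τ hτ => ?_
      rw [Set.uIcc_of_le s.2.1] at hτ
      have hτ1 : τ ∈ Set.Icc (0 : ℝ) 1 := ⟨hτ.1, hτ.2.trans s.2.2⟩
      have hτ2 : (t : ℝ) * τ ∈ Set.Icc (0 : ℝ) 1 :=
        ⟨mul_nonneg t.2.1 hτ1.1, mul_le_one₀ t.2.2 hτ1.1 hτ1.2⟩
      rw [Set.projIcc_of_mem _ hτ1, Set.projIcc_of_mem _ hτ2, (H _ (hball y hy t)).2, (H y hy).2]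
      have h3 : h ⟨τ, hτ1⟩ = G y ⟨t * τ, hτ2⟩ := rfl
      rw [h3, map_smul, smul_smul, ← smul_mul_assoc,
        mul_comm ((τ : ℝ) : ℂ), ← Complex.ofReal_mul]
      rfl
    rw [← hh]
    exact congrArg (G y) (mul_one t)
  have hSan : AnalyticAt ℂ (fun z => G (z - x) 1) x :=
    ((ContinuousMap.evalCLM ℂ (1 : I) : C(I, A) →L[ℂ] A).analyticAt _).comp
      (AnalyticAt.comp_of_eq (g := G) (f := fun z => z - x) hG
        (analyticAt_id.sub analyticAt_const) (sub_self x))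
  refine ⟨fun z => G (z - x) 1, hSan, ?_, ?_⟩
  · simp [hG0]
  · filter_upwards [hSan.eventually_analyticAt, Metric.ball_mem_nhds x hr] with z hz hzr
    set y := z - x with hy
    have hyr : y ∈ Metric.ball (0 : Fin n → ℂ) r := by
      rwa [mem_ball_zero_iff, hy, ← dist_eq_norm]
    have hzy : x + ((1 : ℝ) : ℂ) • y = z := by simp [hy]
    have d1 := hasDerivAt_comp_ray (g := fun z => G (z - x) 1) (x := x) (y := y) (t := 1)
      (by rw [hzy]; exact hz.differentiableAt)
    rw [hzy] at d1
    have hcont : Continuous fun τ : ℝ =>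
        C y (Set.projIcc 0 1 zero_le_one τ) * G y (Set.projIcc 0 1 zero_le_one τ) :=
      ((C y).continuous.comp continuous_projIcc).mul ((G y).continuous.comp continuous_projIcc)
    have d2 := ((hcont.integral_hasStrictDerivAt 0 1).hasDerivAt).const_add (1 : A)
    -- The paths live on [0, 1], so at the endpoint 1 only the derivative within the interval can be
    -- compared.
    have d3 : HasDerivWithinAt (fun s : ℝ => G (x + (s : ℂ) • y - x) 1) _ (Set.Icc 0 1) 1 :=
      (d2.hasDerivWithinAt).congr (fun s hs => by
        rw [add_sub_cancel_left]
        have := hscale y hyr ⟨s, hs⟩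
        rw [hfix y hyr, hTa] at this
        exact this) (by
        rw [add_sub_cancel_left]
        have := hscale y hyr 1
        rw [hfix y hyr, hTa] at this
        exact this)
    have h4 := (uniqueDiffOn_Icc (zero_lt_one' ℝ) 1 (by simp)).eq_deriv _ d1.hasDerivWithinAt d3
    rw [h4, Set.projIcc_of_mem _ (show (1 : ℝ) ∈ Set.Icc (0 : ℝ) 1 by simp), (H y hyr).2, hzy]
    rfl

/-- The holomorphic Frobenius theorem for a flat linear system `∂_v S = B(v) S`. -/
theorem exists_fundamental_solution (hB : AnalyticAt ℂ B x)
    (hflat : ∀ᶠ y in 𝓝 x, ∀ v w, fderiv ℂ B y v w + B y w * B y v =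
      fderiv ℂ B y w v + B y v * B y w) :
    ∃ S : (Fin n → ℂ) → A, AnalyticAt ℂ S x ∧ S x = 1 ∧
      ∀ᶠ z in 𝓝 x, ∀ v, fderiv ℂ S z v = B z v * S z := by
  obtain ⟨S, hS, hSx, hrad⟩ := exists_radial_solution hB
  refine ⟨S, hS, hSx, ?_⟩
  -- The defect dS - B S, known so far to vanish only in the radial direction z - x.
  let θ : (Fin n → ℂ) → ((Fin n → ℂ) →L[ℂ] A) := fun z =>
    fderiv ℂ S z - ((ContinuousLinearMap.mul ℂ A).flip (S z)).comp (B z)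
  have hθa : ∀ z v, θ z v = fderiv ℂ S z v - B z v * S z := fun z v => rfl
  have hθ : AnalyticAt ℂ θ x := analyticAt_clm_of_apply fun v =>
    (analyticAt_clm_eval hS.fderiv v).sub ((analyticAt_clm_eval hB v).mul hS)
  have hder : ∀ᶠ z in 𝓝 x, ∀ v w, fderiv ℂ θ z w v = fderiv ℂ (fderiv ℂ S) z w v -
      (B z v * fderiv ℂ S z w + fderiv ℂ B z w v * S z) := by
    filter_upwards [hS.eventually_analyticAt, hB.eventually_analyticAt,
      hθ.eventually_analyticAt] with z h1 h2 h3 v w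
    have e1 : HasFDerivAt (fun z => θ z v) _ z :=
      (ContinuousLinearMap.apply ℂ A v).hasFDerivAt.comp z h3.differentiableAt.hasFDerivAt
    have e2 : HasFDerivAt (fun z => fderiv ℂ S z v) _ z :=
      (ContinuousLinearMap.apply ℂ A v).hasFDerivAt.comp z h1.fderiv.differentiableAt.hasFDerivAt
    have e3 : HasFDerivAt (fun z => B z v) _ z :=
      (ContinuousLinearMap.apply ℂ A v).hasFDerivAt.comp z h2.differentiableAt.hasFDerivAt
    have e4 := e2.sub (e3.mul' h1.differentiableAt.hasFDerivAt)
    have e5 := DFunLike.congr_fun (e1.unique e4) w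
    exact e5
  -- Derivative in the direction v of the identity θ_z(z - x) = 0.
  have hzero : ∀ᶠ z in 𝓝 x, ∀ v, fderiv ℂ θ z v (z - x) + θ z v = 0 := by
    have h0 : (fun z => θ z (z - x)) =ᶠ[𝓝 x] fun _ => 0 := by
      filter_upwards [hrad] with z hz
      rw [hθa, hz, sub_self]
    filter_upwards [h0.eventuallyEq_nhds, hθ.eventually_analyticAt] with z h1 h2 v
    have e1 := h2.differentiableAt.hasFDerivAt.clm_apply (hasFDerivAt_sub_const (x := z) x)
    have e2 := e1.fderiv
    rw [h1.fderiv_eq] at e2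
    have e3 := DFunLike.congr_fun e2 v
    simp at e3
    rw [add_comm, map_sub]
    exact e3.symm
  -- Exchanging the radial direction and v by the symmetry of second derivatives and by flatness
  -- turns `hzero` into a differential equation for θ along rays.
  have hradial : ∀ᶠ z in 𝓝 x, ∀ v,
      fderiv ℂ θ z (z - x) v = B z (z - x) * θ z v - θ z v := by
    filter_upwards [hder, hzero, hflat, hS.eventually_analyticAt, hrad] with z h1 h2 h3 h4 h5 v
    have hsymm : fderiv ℂ (fderiv ℂ S) z (z - x) v = fderiv ℂ (fderiv ℂ S) z v (z - x) := by
      have h6 : ContDiffAt ℂ ⊤ S z := h4.contDiffAt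
      exact (h6.isSymmSndFDerivAt (by simp)) _ _
    have e1 := h2 v
    rw [h1] at e1
    rw [h1, hsymm]
    have e2 := congrArg (· * S z) (h3 (z - x) v)
    simp only [add_mul] at e2
    have e3 : B z v * fderiv ℂ S z (z - x) = B z v * B z (z - x) * S z := by
      rw [h5, mul_assoc]
    rw [e3]
    rw [show fderiv ℂ (fderiv ℂ S) z v (z - x) = B z (z - x) * fderiv ℂ S z v +
      fderiv ℂ B z v (z - x) * S z - θ z v by rw [← sub_eq_zero, ← e1]; abel]
    have e4 : B z (z - x) * θ z v = B z (z - x) * fderiv ℂ S z v - B z (z - x) * B z v * S z := by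
      rw [hθa, mul_sub, mul_assoc]
    rw [e4]
    rw [← sub_eq_zero] at e2 ⊢
    rw [← neg_eq_zero, ← e2]
    abel
  obtain ⟨r, hr, H⟩ := Metric.eventually_nhds_iff_ball.1
    ((hradial.and hθ.eventually_analyticAt).and (eventually_norm_lt hB))
  filter_upwards [Metric.ball_mem_nhds x hr] with z hz v
  rw [← sub_eq_zero, ← hθa]
  have hin : ∀ t : ℝ, t ∈ Set.Icc (0 : ℝ) 1 → x + (t : ℂ) • (z - x) ∈ Metric.ball x r := by
    intro t ht
    rw [Metric.mem_ball, dist_eq_norm] at hz ⊢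
    rw [add_sub_cancel_left, norm_smul, Complex.norm_real, Real.norm_of_nonneg ht.1]
    exact (mul_le_of_le_one_left (norm_nonneg _) ht.2).trans_lt hz
  -- The factor s absorbs the term -θ of the radial equation and supplies the initial value 0
  -- without knowing θ at x.
  have hd : ∀ t : ℝ, t ∈ Set.Icc (0 : ℝ) 1 →
      HasDerivAt (fun s : ℝ => s • θ (x + (s : ℂ) • (z - x)) v)
        (B (x + (t : ℂ) • (z - x)) (z - x) * (t • θ (x + (t : ℂ) • (z - x)) v)) t := by
    intro t ht
    obtain ⟨⟨h1, h2⟩, -⟩ := H _ (hin t ht)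
    set y := x + (t : ℂ) • (z - x) with hy
    have e0 : HasFDerivAt (fun y => θ y v) _ y :=
      (ContinuousLinearMap.apply ℂ A v).hasFDerivAt.comp y h2.differentiableAt.hasFDerivAt
    have e1 := hasDerivAt_comp_ray (g := fun y => θ y v) (x := x) (y := z - x) (t := t)
      e0.differentiableAt
    rw [← hy, e0.fderiv] at e1
    have e2 := (hasDerivAt_id t).smul e1
    refine e2.congr_deriv ?_
    have e3 := h1 v
    rw [show y - x = (t : ℂ) • (z - x) by rw [hy, add_sub_cancel_left]] at e3
    simp only [map_smul, smul_apply] at e3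
    simp only [Complex.coe_smul] at e3
    simp only [id_eq, ContinuousLinearMap.comp_apply, ContinuousLinearMap.apply_apply, one_smul]
    rw [e3, mul_smul_comm, ← hy, smul_mul_assoc]
    abel
  have := eq_zero_of_abs_deriv_le_mul_abs_self_of_eq_zero_right
    (f := fun s : ℝ => s • θ (x + (s : ℂ) • (z - x)) v) (K := (‖B x‖ + 1) * ‖z - x‖)
    (a := 0) (b := 1)
    (fun t ht => (hd t ht).continuousAt.continuousWithinAt)
    (fun t ht => (hd t ⟨ht.1, ht.2.le⟩).hasDerivWithinAt) (by simp) ?_ 1 (by simp)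
  · simpa using this
  · intro t ht
    refine (norm_mul_le _ _).trans ?_
    gcongr
    refine (ContinuousLinearMap.le_opNorm _ _).trans ?_
    gcongr
    exact (H _ (hin t ⟨ht.1, ht.2.le⟩)).2.le

end frobenius

/-! ### Iterated partial derivatives -/

theorem hasFDerivAt_clm_eval {D F G : Type*} [NormedAddCommGroup D] [NormedSpace ℂ D]
    [NormedAddCommGroup F] [NormedSpace ℂ F] [NormedAddCommGroup G] [NormedSpace ℂ G]
    {A : D → F →L[ℂ] G} {x : D} (h : DifferentiableAt ℂ A x) (w : F) :
    HasFDerivAt (fun y => A y w) ((ContinuousLinearMap.apply ℂ G w).comp (fderiv ℂ A x)) x :=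
  ((ContinuousLinearMap.apply ℂ G w).hasFDerivAt (x := A x)).comp x h.hasFDerivAt

section partialDerivatives

variable {q : ℕ} {f g : (Fin q → ℂ) → ℂ} {y : Fin q → ℂ}

theorem analyticAt_partialDeriv (hf : AnalyticAt ℂ f y) (L : List (Fin q)) :
    AnalyticAt ℂ (partialDeriv L f) y := by
  induction L with
  | nil => exact hf
  | cons a L ih => exact analyticAt_clm_eval ih.fderiv _

theorem partialDeriv_congr (h : f =ᶠ[𝓝 y] g) (L : List (Fin q)) :
    partialDeriv L f =ᶠ[𝓝 y] partialDeriv L g := by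
  induction L with
  | nil => exact h
  | cons a L ih => exact (ih.fderiv).mono fun z hz => congrArg (fun T : (Fin q → ℂ) →L[ℂ] ℂ => T (Pi.single a 1)) hz

theorem partialDeriv_perm {L L' : List (Fin q)} (hL : L.Perm L') (hf : AnalyticAt ℂ f y) :
    partialDeriv L f =ᶠ[𝓝 y] partialDeriv L' f := by
  induction hL with
  | nil => exact EventuallyEq.rfl
  | cons a _ ih => exact (ih.fderiv).mono fun z hz => congrArg (fun T : (Fin q → ℂ) →L[ℂ] ℂ => T (Pi.single a 1)) hz
  | swap a b L =>
    filter_upwards [(analyticAt_partialDeriv hf L).eventually_analyticAt] with z hz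
    have key : ∀ a b : Fin q, partialDeriv (a :: b :: L) f z =
        fderiv ℂ (fderiv ℂ (partialDeriv L f)) z (Pi.single a 1) (Pi.single b 1) := by
      intro a b
      have e1 : HasFDerivAt (fun z => fderiv ℂ (partialDeriv L f) z (Pi.single b 1)) _ z :=
        hasFDerivAt_clm_eval hz.fderiv.differentiableAt _
      change fderiv ℂ (fun z => fderiv ℂ (partialDeriv L f) z (Pi.single b 1)) z (Pi.single a 1) = _
      rw [e1.fderiv]
      rfl
    rw [key, key]
    have h6 : ContDiffAt ℂ ⊤ (partialDeriv L f) z := hz.contDiffAt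
    exact (h6.isSymmSndFDerivAt (by simp)) _ _
  | trans _ _ ih1 ih2 => exact ih1.trans ih2

theorem partialDeriv_append (L L' : List (Fin q)) (f : (Fin q → ℂ) → ℂ) :
    partialDeriv (L ++ L') f = partialDeriv L (partialDeriv L' f) := by
  induction L with
  | nil => rfl
  | cons a L ih => rw [List.cons_append, partialDeriv, ih, partialDeriv]

theorem partialDeriv_zero (L : List (Fin q)) : partialDeriv L (fun _ => (0 : ℂ)) = fun _ => 0 := by
  induction L with
  | nil => rfl
  | cons a L ih =>
    funext z
    simp [partialDeriv, ih]

theorem partialDeriv_sum {ι : Type*} (s : Finset ι) (c : ι → ℂ) {F : ι → (Fin q → ℂ) → ℂ}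
    (hF : ∀ i ∈ s, AnalyticAt ℂ (F i) y) (L : List (Fin q)) :
    partialDeriv L (fun z => ∑ i ∈ s, c i * F i z) =ᶠ[𝓝 y]
      fun z => ∑ i ∈ s, c i * partialDeriv L (F i) z := by
  induction L with
  | nil => exact EventuallyEq.rfl
  | cons a L ih =>
    have h : ∀ᶠ z in 𝓝 y, ∀ i ∈ s, AnalyticAt ℂ (partialDeriv L (F i)) z :=
      (Finset.eventually_all s).2 fun i hi =>
        (analyticAt_partialDeriv (hF i hi) L).eventually_analyticAt
    filter_upwards [ih.eventuallyEq_nhds, h] with z hz h'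
    have e1 : HasFDerivAt (fun z => ∑ i ∈ s, c i * partialDeriv L (F i) z)
        (∑ i ∈ s, c i • fderiv ℂ (partialDeriv L (F i)) z) z :=
      HasFDerivAt.fun_sum fun i hi => (h' i hi).differentiableAt.hasFDerivAt.const_mul (c i)
    simp only [partialDeriv]
    rw [hz.fderiv_eq, e1.fderiv]
    simp

/-- The partial derivative attached to an unordered multi-index. -/
def partialD (f : (Fin q → ℂ) → ℂ) (K : Multiset (Fin q)) : (Fin q → ℂ) → ℂ :=
  partialDeriv (K.sort (· ≤ ·)) f

theorem partialD_zero (f : (Fin q → ℂ) → ℂ) : partialD f 0 = f := by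
  simp [partialD, partialDeriv]

theorem partialDeriv_eq_partialD (hf : AnalyticAt ℂ f y) (L : List (Fin q)) :
    partialDeriv L f =ᶠ[𝓝 y] partialD f L :=
  partialDeriv_perm (Multiset.coe_eq_coe.1 (by rw [Multiset.sort_eq])) hf

theorem analyticAt_partialD (hf : AnalyticAt ℂ f y) (K : Multiset (Fin q)) :
    AnalyticAt ℂ (partialD f K) y := analyticAt_partialDeriv hf _

theorem partialD_congr (h : f =ᶠ[𝓝 y] g) (K : Multiset (Fin q)) :
    partialD f K =ᶠ[𝓝 y] partialD g K := partialDeriv_congr h _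

theorem partialD_cons (hf : AnalyticAt ℂ f y) (K : Multiset (Fin q)) (a : Fin q) :
    partialD f (a ::ₘ K) =ᶠ[𝓝 y] fun z => fderiv ℂ (partialD f K) z (Pi.single a 1) := by
  have h := partialDeriv_eq_partialD hf (a :: K.sort (· ≤ ·))
  rw [← Multiset.cons_coe, Multiset.sort_eq] at h
  exact h.symm

theorem fderiv_eq_sum_single {G : Type*} [NormedAddCommGroup G] [NormedSpace ℂ G]
    (T : (Fin q → ℂ) →L[ℂ] G) (v : Fin q → ℂ) : T v = ∑ a, v a • T (Pi.single a 1) := by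
  have := map_sum T (fun i => v i • Pi.single i (1 : ℂ)) Finset.univ
  simp only [map_smul] at this
  rw [← this]
  congr 1
  ext i
  simp [Finset.sum_apply, Pi.single_apply]

theorem partialD_cons_of_fderiv {K : Multiset (Fin q)} (hf : AnalyticAt ℂ f y) (a : Fin q) :
    partialD (fun z => fderiv ℂ f z (Pi.single a 1)) K =ᶠ[𝓝 y] partialD f (a ::ₘ K) := by
  have h := partialDeriv_eq_partialD hf (K.sort (· ≤ ·) ++ [a])
  rw [partialDeriv_append] at h
  have e : ((K.sort (· ≤ ·) ++ [a] : List (Fin q)) : Multiset (Fin q)) = a ::ₘ K := by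
    rw [← Multiset.coe_add, Multiset.sort_eq, add_comm]
    rfl
  rw [e] at h
  exact h

end partialDerivatives

/-! ### Polynomials with prescribed derivatives at a point -/

section taylor

variable {q : ℕ}

/-- The homogeneous polynomial `(∑_α y_α ∂_α)^h`, applied to a function of multi-indices. -/
def taylorHom (w : Multiset (Fin q) → ℂ) : ℕ → Multiset (Fin q) → (Fin q → ℂ) → ℂ
  | 0, K => fun _ => w K
  | h + 1, K => fun y => ∑ a, y a * taylorHom w h (a ::ₘ K) y

/-- The polynomial of degree `< N` whose derivatives of order `< N` at `0` are `w (K + ·)`. -/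
def taylorPoly (w : Multiset (Fin q) → ℂ) (N : ℕ) (K : Multiset (Fin q)) (y : Fin q → ℂ) : ℂ :=
  ∑ h ∈ Finset.range N, ((h.factorial : ℂ)⁻¹) * taylorHom w h K y

theorem differentiable_taylorHom (w : Multiset (Fin q) → ℂ) (h : ℕ) (K : Multiset (Fin q)) :
    Differentiable ℂ (taylorHom w h K) := by
  induction h generalizing K with
  | zero => exact differentiable_const _
  | succ h ih =>
    simp only [taylorHom]
    fun_prop

theorem analyticAt_taylorHom (w : Multiset (Fin q) → ℂ) (h : ℕ) (K : Multiset (Fin q))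
    (y : Fin q → ℂ) : AnalyticAt ℂ (taylorHom w h K) y := by
  induction h generalizing K with
  | zero => exact analyticAt_const
  | succ h ih =>
    exact Finset.analyticAt_fun_sum _ fun a _ => AnalyticAt.mul
      ((ContinuousLinearMap.proj (R := ℂ) (φ := fun _ : Fin q => ℂ) a).analyticAt _) (ih _)

/-- Differentiating the outer factor y_a gives one term of the wanted form; the inner polynomials
give h more of them, since the order in which indices are added to a multiset is irrelevant. -/
theorem fderiv_taylorHom_succ (w : Multiset (Fin q) → ℂ) (h : ℕ) (K : Multiset (Fin q)) (y : Fin q → ℂ)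
    (a : Fin q) : fderiv ℂ (taylorHom w (h + 1) K) y (Pi.single a 1) =
      (h + 1) * taylorHom w h (a ::ₘ K) y := by
  have e1 : ∀ (h : ℕ) (K : Multiset (Fin q)), HasFDerivAt (taylorHom w (h + 1) K) (∑ b,
      (y b • fderiv ℂ (taylorHom w h (b ::ₘ K)) y + taylorHom w h (b ::ₘ K) y •
        ContinuousLinearMap.proj (R := ℂ) (φ := fun _ : Fin q => ℂ) b)) y := fun h K =>
    HasFDerivAt.fun_sum fun b _ => HasFDerivAt.mul
      (ContinuousLinearMap.proj (R := ℂ) (φ := fun _ : Fin q => ℂ) b).hasFDerivAt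
      (differentiable_taylorHom w h _ y).hasFDerivAt
  induction h generalizing K with
  | zero =>
    rw [(e1 0 K).fderiv]
    simp [taylorHom, Pi.single_apply]
  | succ h ih =>
    rw [(e1 (h + 1) K).fderiv]
    simp only [sum_apply, add_apply,
      smul_apply, ContinuousLinearMap.proj_apply, ih, smul_eq_mul,
      Pi.single_apply, mul_ite, mul_one, mul_zero, Finset.sum_add_distrib, Finset.sum_ite_eq',
      Finset.mem_univ, if_true]
    have : ∑ b, y b * ((h + 1 : ℂ) * taylorHom w h (a ::ₘ b ::ₘ K) y) =
        (h + 1) * taylorHom w (h + 1) (a ::ₘ K) y := by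
      simp only [taylorHom, Finset.mul_sum]
      refine Finset.sum_congr rfl fun b _ => ?_
      rw [Multiset.cons_swap]
      ring
    rw [this]
    push_cast
    ring

theorem analyticAt_taylorPoly (w : Multiset (Fin q) → ℂ) (N : ℕ) (K : Multiset (Fin q))
    (y : Fin q → ℂ) : AnalyticAt ℂ (taylorPoly w N K) y :=
  Finset.analyticAt_fun_sum _ fun h _ => analyticAt_const.mul (analyticAt_taylorHom w h K y)

theorem fderiv_taylorPoly_succ (w : Multiset (Fin q) → ℂ) (N : ℕ) (K : Multiset (Fin q))
    (y : Fin q → ℂ) (a : Fin q) :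
    fderiv ℂ (taylorPoly w (N + 1) K) y (Pi.single a 1) = taylorPoly w N (a ::ₘ K) y := by
  have e1 : HasFDerivAt (taylorPoly w (N + 1) K) (∑ h ∈ Finset.range (N + 1),
      ((h.factorial : ℂ)⁻¹) • fderiv ℂ (taylorHom w h K) y) y :=
    HasFDerivAt.fun_sum fun h _ => (differentiable_taylorHom w h K y).hasFDerivAt.const_mul _
  have e2 : fderiv ℂ (taylorPoly w (N + 1) K) y (Pi.single a 1) = ∑ h ∈ Finset.range (N + 1),
      ((h.factorial : ℂ)⁻¹) * fderiv ℂ (taylorHom w h K) y (Pi.single a 1) := by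
    rw [e1.fderiv]
    simp
  have e0 : fderiv ℂ (taylorHom w 0 K) y (Pi.single a 1) = 0 := by
    change fderiv ℂ (fun _ => w K) y _ = 0
    simp
  rw [e2, Finset.sum_range_succ', e0, mul_zero, add_zero, taylorPoly]
  simp only [fderiv_taylorHom_succ]
  refine Finset.sum_congr rfl fun h _ => ?_
  have : (h.factorial : ℂ) ≠ 0 := by exact_mod_cast h.factorial_ne_zero
  have h2 : (h + 1 : ℂ) ≠ 0 := by exact_mod_cast h.succ_ne_zero
  rw [Nat.factorial_succ]
  push_cast
  field_simp

theorem taylorPoly_apply_zero (w : Multiset (Fin q) → ℂ) (N : ℕ) (K : Multiset (Fin q)) :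
    taylorPoly w (N + 1) K 0 = w K := by
  rw [taylorPoly, Finset.sum_range_succ']
  simp [taylorHom]

/-- Each derivation lowers the truncation order by one, hence the shift of N by the length of L. -/
theorem partialDeriv_taylorPoly (w : Multiset (Fin q) → ℂ) (y₀ : Fin q → ℂ) (N : ℕ)
    (K : Multiset (Fin q)) (L : List (Fin q)) :
    partialDeriv L (fun y => taylorPoly w (N + L.length) K (y - y₀)) =
      fun y => taylorPoly w N ((L : Multiset (Fin q)) + K) (y - y₀) := by
  induction L generalizing N with
  | nil => simp [partialDeriv]
  | cons a L ih =>
    have h := ih (N + 1)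
    funext y
    rw [partialDeriv, show N + (a :: L).length = N + 1 + L.length by simp; ring, h]
    have e1 := ((analyticAt_taylorPoly w (N + 1) ((L : Multiset (Fin q)) + K)
      (y - y₀)).differentiableAt.hasFDerivAt.comp y (hasFDerivAt_sub_const y₀)).fderiv
    change fderiv ℂ (taylorPoly w (N + 1) ((L : Multiset (Fin q)) + K) ∘ fun y => y - y₀) y _ = _
    rw [e1]
    simp only [ContinuousLinearMap.comp_id]
    rw [fderiv_taylorPoly_succ, ← Multiset.cons_add]
    rfl

theorem partialDeriv_taylorPoly_self (w : Multiset (Fin q) → ℂ) (y₀ : Fin q → ℂ) {N : ℕ}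
    {L : List (Fin q)} (hL : L.length < N) :
    partialDeriv L (fun y => taylorPoly w N 0 (y - y₀)) y₀ = w L := by
  obtain ⟨M, rfl⟩ := Nat.exists_eq_add_of_lt hL
  rw [show L.length + M + 1 = M + 1 + L.length by ring, partialDeriv_taylorPoly]
  simp only [sub_self, taylorPoly_apply_zero, add_zero]

/-- Any formal vector is thus the vector of derivatives of an actual function, so identities between
the coefficients of the derived equations follow from identities between functions. -/
theorem partialD_taylorPoly_self (w : Multiset (Fin q) → ℂ) (y₀ : Fin q → ℂ) {N : ℕ}
    {K : Multiset (Fin q)} (hK : K.card < N) :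
    partialD (fun y => taylorPoly w N 0 (y - y₀)) K y₀ = w K := by
  rw [partialD, partialDeriv_taylorPoly_self _ _ (by simpa using hK), Multiset.sort_eq]

theorem analyticAt_taylorPoly_sub (w : Multiset (Fin q) → ℂ) (N : ℕ) (K : Multiset (Fin q))
    (y₀ y : Fin q → ℂ) : AnalyticAt ℂ (fun y => taylorPoly w N K (y - y₀)) y :=
  AnalyticAt.comp (g := taylorPoly w N K) (f := fun y => y - y₀)
    (analyticAt_taylorPoly w N K (y - y₀)) (analyticAt_id.sub analyticAt_const)

end taylor

/-! ### The coefficients of the derived equations -/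

section coefficients

variable {n q : ℕ} {v : (Fin n → ℂ) → (Fin q → ℂ)} {J : (Fin n → ℂ) → ℂ} {x : Fin n → ℂ}

/-- Derivatives of order greater than |L| do not occur in the equation of index L: this is the block
triangularity of the system. -/
theorem coef_eq_zero (v : (Fin n → ℂ) → (Fin q → ℂ)) (J : (Fin n → ℂ) → ℂ) {L : List (Fin n)}
    {K : Multiset (Fin q)} (h : L.length < K.card) : coef v J L K = fun _ => 0 := by
  induction L generalizing K with
  | nil =>
    have : K ≠ 0 := by
      rintro rfl
      simp at h
    simp [coef, this]
  | cons l L ih =>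
    rw [List.length_cons] at h
    funext y
    rw [coef, ih (by omega)]
    simp only [fderiv_fun_const, Pi.zero_apply, zero_apply, zero_add]
    refine Finset.sum_eq_zero fun α hα => ?_
    rw [ih, zero_mul]
    rw [Multiset.card_erase_of_mem (Multiset.mem_toFinset.1 hα), Nat.pred_eq_sub_one]
    omega

theorem analyticAt_coef (hv : AnalyticAt ℂ v x) (hJ : AnalyticAt ℂ J x) (L : List (Fin n))
    (K : Multiset (Fin q)) : AnalyticAt ℂ (coef v J L K) x := by
  induction L generalizing K with
  | nil =>
    by_cases h : K = 0
    · simpa [coef, h] using hJ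
    · simpa [coef, h] using analyticAt_const
  | cons l L ih =>
    refine (analyticAt_clm_eval (ih K).fderiv _).add (Finset.analyticAt_fun_sum _ fun α _ =>
      (ih _).mul ?_)
    exact ((ContinuousLinearMap.proj (R := ℂ) (φ := fun _ : Fin q => ℂ) α).analyticAt _).comp
      (analyticAt_clm_eval hv.fderiv _)

/-- The left side of a derived equation: the sum of the `M_L^K w_K` for `|K| < N`. -/
def evalCoef (N : ℕ) (v : (Fin n → ℂ) → (Fin q → ℂ)) (J : (Fin n → ℂ) → ℂ) (L : List (Fin n))
    (w : Multiset (Fin q) → ℂ) (x : Fin n → ℂ) : ℂ :=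
  ∑ h ∈ Finset.range N, ∑ K : Sym (Fin q) h, coef v J L K x * w K

theorem evalCoef_congr {N : ℕ} {L : List (Fin n)} {w w' : Multiset (Fin q) → ℂ}
    (h : ∀ K : Multiset (Fin q), K.card < N → w K = w' K) :
    evalCoef N v J L w x = evalCoef N v J L w' x := by
  refine Finset.sum_congr rfl fun k hk => Finset.sum_congr rfl fun K _ => ?_
  rw [h _ (by simpa using hk)]

theorem evalCoef_eq_of_le {N M : ℕ} {L : List (Fin n)} (w : Multiset (Fin q) → ℂ)
    (hN : L.length < N) (hM : N ≤ M) : evalCoef N v J L w x = evalCoef M v J L w x := by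
  refine Finset.sum_subset (Finset.range_mono hM) fun h _ hN' => ?_
  refine Finset.sum_eq_zero fun K _ => ?_
  have hK : (K : Multiset (Fin q)).card = h := K.2
  rw [coef_eq_zero v J (by rw [hK]; exact hN.trans_le (by simpa using hN')), zero_mul]

/-- Reindexing by the bijection (K, α ∈ K) ↔ (K - 1_α, α). -/
theorem sum_sym_succ_erase (h : ℕ) (g : Fin q → Multiset (Fin q) → ℂ) :
    ∑ K : Sym (Fin q) (h + 1), ∑ α ∈ (K : Multiset (Fin q)).toFinset,
      g α ((K : Multiset (Fin q)).erase α) = ∑ K : Sym (Fin q) h, ∑ α, g α K := by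
  rw [Finset.sum_sigma', Finset.sum_sigma']
  refine Finset.sum_bij' (fun a ha => ⟨a.1.erase a.2 (by simpa using ha), a.2⟩)
    (fun a _ => ⟨a.2 ::ₛ a.1, a.2⟩) ?_ ?_ ?_ ?_ ?_
  · simp
  · simp
  · rintro ⟨K, α⟩ ha
    simp
  · rintro ⟨K, α⟩ ha
    simp
  · rintro ⟨K, α⟩ ha
    simp [Sym.coe_erase]

/-- The recursion satisfied by the derived equations. -/
theorem evalCoef_cons (N : ℕ) (l : Fin n) (L : List (Fin n)) (w : Multiset (Fin q) → ℂ) :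
    evalCoef (N + 1) v J (l :: L) w x =
      (∑ h ∈ Finset.range (N + 1), ∑ K : Sym (Fin q) h,
        fderiv ℂ (coef v J L K) x (Pi.single l 1) * w K) +
      ∑ α, evalCoef N v J L (fun K => w (α ::ₘ K)) x * fderiv ℂ v x (Pi.single l 1) α := by
  have h1 : evalCoef (N + 1) v J (l :: L) w x =
      (∑ h ∈ Finset.range (N + 1), ∑ K : Sym (Fin q) h,
        fderiv ℂ (coef v J L K) x (Pi.single l 1) * w K) +
      ∑ h ∈ Finset.range (N + 1), ∑ K : Sym (Fin q) h, ∑ α ∈ (K : Multiset (Fin q)).toFinset,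
        coef v J L ((K : Multiset (Fin q)).erase α) x * fderiv ℂ v x (Pi.single l 1) α *
          w (α ::ₘ (K : Multiset (Fin q)).erase α) := by
    simp only [evalCoef, ← Finset.sum_add_distrib, coef, add_mul, Finset.sum_mul]
    refine Finset.sum_congr rfl fun h _ => Finset.sum_congr rfl fun K _ => ?_
    congr 1
    refine Finset.sum_congr rfl fun α hα => ?_
    rw [Multiset.cons_erase (Multiset.mem_toFinset.1 hα)]
  rw [h1]
  congr 1
  rw [Finset.sum_range_succ']
  have h0 : ∑ K : Sym (Fin q) 0, ∑ α ∈ (K : Multiset (Fin q)).toFinset,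
      coef v J L ((K : Multiset (Fin q)).erase α) x * fderiv ℂ v x (Pi.single l 1) α *
        w (α ::ₘ (K : Multiset (Fin q)).erase α) = 0 := by
    refine Finset.sum_eq_zero fun K _ => ?_
    have : (K : Multiset (Fin q)) = 0 := Multiset.card_eq_zero.1 K.2
    simp [this]
  rw [h0, add_zero]
  simp only [sum_sym_succ_erase _ fun α K =>
    coef v J L K x * fderiv ℂ v x (Pi.single l 1) α * w (α ::ₘ K)]
  simp only [evalCoef, Finset.sum_mul]
  rw [Finset.sum_comm (s := Finset.univ)]
  refine Finset.sum_congr rfl fun h _ => ?_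
  rw [Finset.sum_comm]
  refine Finset.sum_congr rfl fun α _ => Finset.sum_congr rfl fun K _ => ?_
  ring

/-- The derivatives of `(f ∘ v) J`. -/
theorem partialDeriv_comp_mul (hv : AnalyticAt ℂ v x) (hJ : AnalyticAt ℂ J x)
    {f : (Fin q → ℂ) → ℂ} (hf : AnalyticAt ℂ f (v x)) {L : List (Fin n)} {N : ℕ}
    (hN : L.length < N) :
    partialDeriv L (fun y => f (v y) * J y) =ᶠ[𝓝 x]
      fun y => evalCoef N v J L (fun K => partialD f K (v y)) y := by
  induction L generalizing N with
  | nil =>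
    refine Eventually.of_forall fun y => ?_
    beta_reduce
    rw [← evalCoef_eq_of_le (N := 1) (L := []) _ (by simp) hN]
    simp only [partialDeriv, evalCoef, Finset.range_one, Finset.sum_singleton, coef]
    rw [Finset.sum_eq_single (Sym.nil : Sym (Fin q) 0)]
    · simp [partialD_zero, mul_comm]
    · intro K _ hK
      exact (hK (Subsingleton.elim _ _)).elim
    · exact fun h => (h (Finset.mem_univ _)).elim
  | cons l L ih =>
    obtain ⟨M, rfl⟩ := Nat.exists_eq_add_of_le' (Nat.one_le_of_lt hN)
    rw [List.length_cons] at hN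
    have hf' : ∀ᶠ y in 𝓝 x, AnalyticAt ℂ f (v y) :=
      hv.continuousAt.eventually hf.eventually_analyticAt
    filter_upwards [(ih (N := M + 1) (by omega)).eventuallyEq_nhds, hv.eventually_analyticAt,
      hJ.eventually_analyticAt, hf'] with y hy hvy hJy hfy
    rw [partialDeriv]
    beta_reduce
    rw [hy.fderiv_eq, evalCoef_cons]
    have hdv := hvy.differentiableAt.hasFDerivAt
    have hterm : ∀ K : Multiset (Fin q), HasFDerivAt (fun z => coef v J L K z * partialD f K (v z))
        (coef v J L K y • (fderiv ℂ (partialD f K) (v y)).comp (fderiv ℂ v y) +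
          partialD f K (v y) • fderiv ℂ (coef v J L K) y) y := fun K =>
      (analyticAt_coef hvy hJy L K).differentiableAt.hasFDerivAt.mul
        ((analyticAt_partialD hfy K).differentiableAt.hasFDerivAt.comp y hdv)
    have hsum : HasFDerivAt
        (fun z => evalCoef (M + 1) v J L (fun K => partialD f K (v z)) z) _ y :=
      HasFDerivAt.fun_sum fun h _ => HasFDerivAt.fun_sum fun K _ => hterm K
    rw [hsum.fderiv]
    have e1 : ∀ K : Multiset (Fin q), fderiv ℂ (partialD f K) (v y) (fderiv ℂ v y (Pi.single l 1)) =
        ∑ α, partialD f (α ::ₘ K) (v y) * fderiv ℂ v y (Pi.single l 1) α := by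
      intro K
      rw [fderiv_eq_sum_single]
      refine Finset.sum_congr rfl fun α _ => ?_
      rw [(partialD_cons hfy K α).self_of_nhds, smul_eq_mul, mul_comm]
    simp only [sum_apply, add_apply, smul_apply, ContinuousLinearMap.comp_apply, smul_eq_mul, e1,
      Finset.sum_add_distrib]
    rw [add_comm]
    congr 1
    · simp only [mul_comm]
    -- The two truncations agree because both exceed the length of L, above which all coefficients
    -- vanish.
    · have e2 : ∀ α, evalCoef M v J L (fun K => partialD f (α ::ₘ K) (v y)) y =
          evalCoef (M + 1) v J L (fun K => partialD f (α ::ₘ K) (v y)) y := fun α =>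
        evalCoef_eq_of_le _ (by omega) (by omega)
      simp only [e2]
      simp only [evalCoef, Finset.sum_mul, Finset.mul_sum]
      rw [Finset.sum_comm (s := Finset.univ)]
      refine Finset.sum_congr rfl fun h _ => ?_
      rw [Finset.sum_comm]
      refine Finset.sum_congr rfl fun α _ => Finset.sum_congr rfl fun K _ => ?_
      ring

/-- The coefficient is read off by differentiating (f ∘ v) J for a polynomial f whose only nonzero
derivative of order less than N at v x is the one of index K; derivatives commute. This reconciles
the sorted lists used in `block` with lists obtained by adding a direction in front. -/
theorem coef_perm (hv : AnalyticAt ℂ v x) (hJ : AnalyticAt ℂ J x) {L L' : List (Fin n)}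
    (hL : L.Perm L') (K : Multiset (Fin q)) : coef v J L K x = coef v J L' K x := by
  classical
  let N := max L.length K.card + 1
  let w : Multiset (Fin q) → ℂ := fun K' => if K' = K then 1 else 0
  let f : (Fin q → ℂ) → ℂ := fun y => taylorPoly w N 0 (y - v x)
  have hf : AnalyticAt ℂ f (v x) := analyticAt_taylorPoly_sub _ _ _ _ _
  have key : ∀ L : List (Fin n), L.length < N →
      partialDeriv L (fun y => f (v y) * J y) x = coef v J L K x := by
    intro L hL
    rw [(partialDeriv_comp_mul hv hJ hf hL).self_of_nhds]
    beta_reduce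
    rw [evalCoef_congr (w' := w)
      fun K' hK' => partialD_taylorPoly_self w (v x) hK', evalCoef,
      Finset.sum_eq_single K.card]
    · rw [Finset.sum_eq_single ⟨K, rfl⟩]
      · simp [w]
      · intro K' _ hK'
        have : (K' : Multiset (Fin q)) ≠ K := fun h => hK' (Subtype.ext h)
        simp [w, this]
      · exact fun h => (h (Finset.mem_univ _)).elim
    · intro h _ hh
      refine Finset.sum_eq_zero fun K' _ => ?_
      have : (K' : Multiset (Fin q)) ≠ K := by
        rintro rfl
        exact hh K'.2.symm
      simp [w, this]
    · intro h
      exact (h (by simp [N])).elim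
  rw [← key L (by simp [N]), ← key L' (by simp [N, hL.length_eq])]
  refine (partialDeriv_perm hL ?_).self_of_nhds
  exact (AnalyticAt.comp (g := f) hf hv).mul hJ

theorem evalCoef_perm (hv : AnalyticAt ℂ v x) (hJ : AnalyticAt ℂ J x) {L L' : List (Fin n)}
    (hL : L.Perm L') (N : ℕ) (w : Multiset (Fin q) → ℂ) :
    evalCoef N v J L w x = evalCoef N v J L' w x := by
  simp only [evalCoef, coef_perm hv hJ hL]

end coefficients

/-! ### The Koszul complex -/

section koszul

variable {r p : ℕ}

theorem card_incIdx (p r : ℕ) : Fintype.card (IncIdx p r) = r.choose p := by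
  rw [← Nat.card_eq_fintype_card, Nat.card_congr Set.powersetCard.ofFinEmbEquiv,
    Set.powersetCard.card, Nat.card_eq_fintype_card, Fintype.card_fin]

theorem card_sym_fin {r : ℕ} (hr : 1 ≤ r) (h : ℕ) : Fintype.card (Sym (Fin r) h) = homDim r h := by
  rw [Sym.card_sym_eq_choose, Fintype.card_fin, homDim]
  congr 1
  omega

/-- The linear map with given values on the coordinate vectors. -/
def ofCoord {G : Type*} [NormedAddCommGroup G] [NormedSpace ℂ G] (c : Fin r → G) :
    (Fin r → ℂ) →L[ℂ] G :=
  ∑ α, (ContinuousLinearMap.proj (R := ℂ) (φ := fun _ : Fin r => ℂ) α).smulRight (c α)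

theorem ofCoord_apply {G : Type*} [NormedAddCommGroup G] [NormedSpace ℂ G] (c : Fin r → G)
    (v : Fin r → ℂ) : ofCoord c v = ∑ α, v α • c α := by
  simp [ofCoord]

theorem ofCoord_single {G : Type*} [NormedAddCommGroup G] [NormedSpace ℂ G] (c : Fin r → G)
    (α : Fin r) : ofCoord c (Pi.single α 1) = c α := by
  rw [ofCoord_apply, Finset.sum_eq_single α]
  · simp
  · intro β _ hβ
    simp [hβ]
  · simp

/-- The linear map `e_α ↦ η (α + K)` attached to a form-valued function of multi-indices. -/
def shiftMap (η : Multiset (Fin r) → Form r p) (K : Multiset (Fin r)) :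
    (Fin r → ℂ) →L[ℂ] Form r p :=
  ofCoord fun α => η (α ::ₘ K)

/-- The Koszul differential on form-valued functions of multi-indices. -/
def kosD (η : Multiset (Fin r) → Form r p) (K : Multiset (Fin r)) : Form r (p + 1) :=
  .alternatizeUncurryFin (shiftMap η K)

theorem kosD_apply (η : Multiset (Fin r) → Form r p) (K : Multiset (Fin r))
    (m : Fin (p + 1) → (Fin r → ℂ)) :
    kosD η K m = ∑ j : Fin (p + 1), (-1 : ℂ) ^ (j : ℕ) * shiftMap η K (m j) (j.removeNth m) := by
  rw [kosD, ContinuousAlternatingMap.alternatizeUncurryFin_apply]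
  refine Finset.sum_congr rfl fun j _ => ?_
  simp

theorem kosD_coordVec (η : Multiset (Fin r) → Form r p) (K : Multiset (Fin r))
    (c : Fin (p + 1) → Fin r) :
    kosD η K (coordVec c) = ∑ j : Fin (p + 1),
      (-1 : ℂ) ^ (j : ℕ) * η (c j ::ₘ K) (coordVec (c ∘ j.succAbove)) := by
  rw [kosD_apply]
  refine Finset.sum_congr rfl fun j _ => ?_
  rw [show coordVec c j = Pi.single (c j) 1 from rfl, shiftMap, ofCoord_single]
  rfl

/-- Applying the differential twice alternates a bilinear map that is symmetric, since the indices α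
and β are added to the same multiset; the argument is the one for d² = 0. -/
theorem kosD_kosD (η : Multiset (Fin r) → Form r p) (K : Multiset (Fin r)) :
    kosD (kosD η) K = 0 := by
  let f : (Fin r → ℂ) →L[ℂ] (Fin r → ℂ) →L[ℂ] Form r p := ofCoord fun α => shiftMap η (α ::ₘ K)
  have hf : ∀ v w, f v w = ∑ α, v α • ∑ β, w β • η (β ::ₘ α ::ₘ K) := by
    intro v w
    have h1 : f v = ∑ α, v α • shiftMap η (α ::ₘ K) := ofCoord_apply _ v
    rw [h1]
    simp only [sum_apply, smul_apply]
    simp only [shiftMap, ofCoord_apply]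
  have hsymm : ∀ v w, f v w = f w v := by
    intro v w
    rw [hf, hf]
    simp only [Finset.smul_sum]
    rw [Finset.sum_comm]
    refine Finset.sum_congr rfl fun β _ => Finset.sum_congr rfl fun α _ => ?_
    rw [smul_comm, Multiset.cons_swap]
  have h :=
    ContinuousAlternatingMap.alternatizeUncurryFin_alternatizeUncurryFinCLM_comp_of_symmetric hsymm
  rw [kosD, ← h]
  congr 1
  ext1 v
  have h1 : f v = ∑ α, v α • shiftMap η (α ::ₘ K) := ofCoord_apply _ v
  rw [ContinuousLinearMap.comp_apply, h1, shiftMap, ofCoord_apply]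
  simp only [map_sum, map_smul]
  rfl

/-- Contraction with the Euler field. -/
def kosI (η : Multiset (Fin r) → Form r (p + 1)) (K : Multiset (Fin r)) : Form r p :=
  (K.map fun α => (η (K.erase α)).curryLeft (Pi.single α 1)).sum

theorem kosI_cons (η : Multiset (Fin r) → Form r (p + 1)) (K : Multiset (Fin r)) (α : Fin r) :
    kosI η (α ::ₘ K) = (η K).curryLeft (Pi.single α 1) +
      (K.map fun β => (η (α ::ₘ K.erase β)).curryLeft (Pi.single β 1)).sum := by
  rw [kosI, Multiset.map_cons, Multiset.sum_cons, Multiset.erase_cons_head]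
  congr 2
  refine Multiset.map_congr rfl fun β hβ => ?_
  by_cases h : α = β
  · subst h
    rw [Multiset.erase_cons_head, Multiset.cons_erase hβ]
  · rw [Multiset.erase_cons_tail _ h]

/-- Expansion of the differential along a first argument e_β. For a cycle the left side is zero,
which evaluates the sum on the right in `kosD_kosI`. -/
theorem sum_neg_one_pow_curryLeft (η : Multiset (Fin r) → Form r (p + 1)) (K : Multiset (Fin r))
    (β : Fin r) (m : Fin (p + 1) → (Fin r → ℂ)) :
    kosD η K (Matrix.vecCons (Pi.single β 1) m) = η (β ::ₘ K) m -
      ∑ j : Fin (p + 1), (-1 : ℂ) ^ (j : ℕ) *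
        (shiftMap η K (m j)).curryLeft (Pi.single β 1) (j.removeNth m) := by
  rw [kosD_apply, Fin.sum_univ_succ]
  have h0 : (0 : Fin (p + 1 + 1)).removeNth (Matrix.vecCons (Pi.single β (1 : ℂ)) m) = m := by
    ext j
    simp [Fin.removeNth]
  rw [h0, Matrix.cons_val_zero, shiftMap, ofCoord_single, sub_eq_add_neg, ← Finset.sum_neg_distrib]
  congr 1
  · simp
  · refine Finset.sum_congr rfl fun j _ => ?_
    rw [ContinuousAlternatingMap.curryLeft_apply_apply, Matrix.cons_val_succ]
    have h1 : (j.succ).removeNth (Matrix.vecCons (Pi.single β (1 : ℂ)) m) =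
        Matrix.vecCons (Pi.single β (1 : ℂ)) (j.removeNth m) := by
      funext i
      refine Fin.cases ?_ (fun i => ?_) i
      · simp [Fin.removeNth]
      · simp [Fin.removeNth]
    rw [h1, Fin.val_succ, pow_succ]
    ring

theorem shiftMap_kosI (η : Multiset (Fin r) → Form r (p + 1)) (K : Multiset (Fin r))
    (v : Fin r → ℂ) : shiftMap (kosI η) K v = (η K).curryLeft v +
      (K.map fun β => (shiftMap η (K.erase β) v).curryLeft (Pi.single β 1)).sum := by
  rw [shiftMap, ofCoord_apply]
  simp only [kosI_cons, smul_add, Finset.sum_add_distrib]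
  congr 1
  · exact (fderiv_eq_sum_single (η K).curryLeft v).symm
  · simp only [Multiset.smul_sum, Multiset.map_map, Function.comp_def]
    refine (Multiset.sum_map_sum_map Finset.univ.val K).trans ?_
    refine congrArg _ (Multiset.map_congr rfl fun β _ => ?_)
    change ∑ α, v α • (η (α ::ₘ K.erase β)).curryLeft (Pi.single β 1) = _
    ext m
    rw [ContinuousAlternatingMap.curryLeft_apply_apply, shiftMap, ofCoord_apply,
      ContinuousAlternatingMap.sum_apply, ContinuousAlternatingMap.sum_apply]
    rfl

/-- The homotopy formula, on Koszul cycles. -/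
theorem kosD_kosI (η : Multiset (Fin r) → Form r (p + 1)) (h : ∀ K, kosD η K = 0)
    (K : Multiset (Fin r)) : kosD (kosI η) K = ((p + 1 + K.card : ℕ) : ℂ) • η K := by
  ext m
  rw [kosD_apply]
  -- Alternating a form already alternating multiplies it by its degree p + 1.
  have h2 : (∑ j : Fin (p + 1), (-1 : ℂ) ^ (j : ℕ) * (η K).curryLeft (m j) (j.removeNth m)) =
      (p + 1 : ℂ) * η K m := by
    have := DFunLike.congr_fun (ContinuousAlternatingMap.alternatizeUncurryFin_curryLeft (η K)) m
    rw [ContinuousAlternatingMap.alternatizeUncurryFin_apply] at this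
    simpa using this
  -- The cycle condition turns the contribution of each element of K into one copy of η K, so that
  -- altogether they give |K| copies.
  have h3 : ∀ β ∈ K, ∑ j : Fin (p + 1), (-1 : ℂ) ^ (j : ℕ) *
      (shiftMap η (K.erase β) (m j)).curryLeft (Pi.single β 1) (j.removeNth m) = η K m := by
    intro β hβ
    have := sum_neg_one_pow_curryLeft η (K.erase β) β m
    rw [h, Multiset.cons_erase hβ] at this
    exact (sub_eq_zero.1 this.symm).symm
  have h4 : ∀ (F : Fin r → Form r p) (m' : Fin p → (Fin r → ℂ)),
      (K.map F).sum m' = (K.map fun β => F β m').sum := by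
    intro F m'
    have := map_multiset_sum (ContinuousAlternatingMap.apply ℂ (Fin r → ℂ) ℂ m') (K.map F)
    rw [Multiset.map_map] at this
    exact this
  simp only [shiftMap_kosI, ContinuousAlternatingMap.add_apply, mul_add, Finset.sum_add_distrib,
    h2, h4, ← Multiset.sum_map_mul_left]
  have h5 := Multiset.sum_map_sum_map (Finset.univ : Finset (Fin (p + 1))).val K
    (f := fun j β => (-1 : ℂ) ^ (j : ℕ) *
      (shiftMap η (K.erase β) (m j)).curryLeft (Pi.single β 1) (j.removeNth m))
  have h6 := h5.trans (congrArg _ (Multiset.map_congr rfl h3))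
  rw [Multiset.map_const', Multiset.sum_replicate] at h6
  refine (congrArg _ h6).trans ?_
  simp only [ContinuousAlternatingMap.smul_apply, smul_eq_mul, nsmul_eq_mul]
  push_cast
  ring

end koszul

/-! ### Dimensions of the spaces of symbols -/

section symbolDimensions

variable {r p : ℕ}

/-- The form-valued function of multi-indices with given coefficients. -/
def toForms (w : IncIdx p r → Multiset (Fin r) → ℂ) (K : Multiset (Fin r)) : Form r p :=
  ∑ A, w A K • coordForm A

theorem toForms_coordVec (w : IncIdx p r → Multiset (Fin r) → ℂ) (K : Multiset (Fin r))
    (A : IncIdx p r) : toForms w K (coordVec A) = w A K := by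
  rw [toForms, ContinuousAlternatingMap.sum_apply, Finset.sum_eq_single A]
  · simp [coordForm_coordVec]
  · intro B _ hB
    simp [coordForm_coordVec, hB]
  · simp

theorem kosD_toForms_coordVec (w : IncIdx p r → Multiset (Fin r) → ℂ) (K : Multiset (Fin r))
    (C : IncIdx (p + 1) r) : kosD (toForms w) K (coordVec C) =
      ∑ j : Fin (p + 1), (-1 : ℂ) ^ (j : ℕ) * w (C.drop j) (C j ::ₘ K) := by
  rw [kosD_coordVec]
  exact Finset.sum_congr rfl fun j _ => congrArg _ (toForms_coordVec w _ (C.drop j))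

theorem kosD_toForms_eq_zero_iff (w : IncIdx p r → Multiset (Fin r) → ℂ) (K : Multiset (Fin r)) :
    kosD (toForms w) K = 0 ↔ ∀ C : IncIdx (p + 1) r,
      ∑ j : Fin (p + 1), (-1 : ℂ) ^ (j : ℕ) * w (C.drop j) (C j ::ₘ K) = 0 := by
  simp_rw [← kosD_toForms_coordVec]
  exact ⟨fun h C => by rw [h]; rfl, fun h => form_ext fun C => h C⟩

/-- The extension by zero of a vector indexed by the multi-indices of order `h`. -/
def symbExt {h : ℕ} (w : IncIdx p r × Sym (Fin r) h → ℂ) (A : IncIdx p r)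
    (K : Multiset (Fin r)) : ℂ :=
  if hK : K.card = h then w (A, ⟨K, hK⟩) else 0

theorem symbExt_coe {h : ℕ} (w : IncIdx p r × Sym (Fin r) h → ℂ) (A : IncIdx p r)
    (K : Sym (Fin r) h) : symbExt w A K = w (A, K) := by
  have hK : (K : Multiset (Fin r)).card = h := K.2
  rw [symbExt, dif_pos hK]
  rfl

theorem symbExt_of_ne {h : ℕ} (w : IncIdx p r × Sym (Fin r) h → ℂ) (A : IncIdx p r)
    {K : Multiset (Fin r)} (hK : K.card ≠ h) : symbExt w A K = 0 := dif_neg hK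

/-- The Koszul differential in coordinates. -/
def kosMap (r p h : ℕ) : (IncIdx p r × Sym (Fin r) (h + 1) → ℂ) →ₗ[ℂ]
    (IncIdx (p + 1) r × Sym (Fin r) h → ℂ) where
  toFun w CK := ∑ j : Fin (p + 1), (-1 : ℂ) ^ (j : ℕ) * w (CK.1.drop j, CK.1 j ::ₛ CK.2)
  map_add' a b := by
    ext
    simp [mul_add, Finset.sum_add_distrib]
  map_smul' c a := by
    ext
    simp [mul_left_comm _ c, Finset.mul_sum]

theorem kosMap_apply {h : ℕ} (w : IncIdx p r × Sym (Fin r) (h + 1) → ℂ) (C : IncIdx (p + 1) r)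
    (K : Sym (Fin r) h) : kosMap r p h w (C, K) =
      ∑ j : Fin (p + 1), (-1 : ℂ) ^ (j : ℕ) * w (C.drop j, C j ::ₛ K) := rfl

/-- The symbols of order `h` of (closed) `p`-forms in `r` variables. -/
def formSymbols (κ : RelKind) (r p : ℕ) : (h : ℕ) → Submodule ℂ (IncIdx p r × Sym (Fin r) h → ℂ)
  | 0 => ⊤
  | h + 1 => match κ with
    | .all => ⊤
    | .closed => LinearMap.ker (kosMap r p h)

/-- Thanks to the extension by zero, the condition can be stated for multi-indices of all orders:
outside the relevant order every term is zero. -/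
theorem mem_formSymbols_iff {κ : RelKind} {h : ℕ} {w : IncIdx p r × Sym (Fin r) h → ℂ} :
    w ∈ formSymbols κ r p h ↔ (κ = .closed → ∀ (C : IncIdx (p + 1) r) (K : Multiset (Fin r)),
      ∑ j : Fin (p + 1), (-1 : ℂ) ^ (j : ℕ) * symbExt w (C.drop j) (C j ::ₘ K) = 0) := by
  cases h with
  | zero =>
    refine ⟨fun _ _ C K => Finset.sum_eq_zero fun j _ => ?_, fun _ => trivial⟩
    rw [symbExt_of_ne _ _ (by simp), mul_zero]
  | succ h =>
    cases κ with
    | all => exact ⟨fun _ h => (by cases h), fun _ => trivial⟩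
    | closed =>
      change w ∈ LinearMap.ker (kosMap r p h) ↔ _
      rw [LinearMap.mem_ker]
      constructor
      · intro hw _ C K
        by_cases hK : K.card = h
        · obtain ⟨K, rfl⟩ : ∃ K' : Sym (Fin r) h, (K' : Multiset (Fin r)) = K := ⟨⟨K, hK⟩, rfl⟩
          have := congrFun hw (C, K)
          refine Eq.trans (Finset.sum_congr rfl fun j _ => ?_) this
          rw [← Sym.coe_cons, symbExt_coe]
        · refine Finset.sum_eq_zero fun j _ => ?_
          rw [symbExt_of_ne _ _ (by simpa using hK), mul_zero]
      · intro hw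
        ext ⟨C, K⟩
        rw [kosMap_apply, Pi.zero_apply, ← hw rfl C K]
        refine Finset.sum_congr rfl fun j _ => ?_
        change _ = (-1 : ℂ) ^ (j : ℕ) * symbExt w (C.drop j) (C j ::ₛ K : Sym (Fin r) (h + 1))
        rw [symbExt_coe]

/-- Exactness of the Koszul complex: one inclusion is `kosD_kosD`, the other is the homotopy formula
`kosD_kosI`. -/
theorem range_kosMap (r p h : ℕ) :
    LinearMap.range (kosMap r p h) = formSymbols .closed r (p + 1) h := by
  ext w
  rw [mem_formSymbols_iff]
  simp only [forall_const, LinearMap.mem_range]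
  have key : ∀ y : IncIdx p r × Sym (Fin r) (h + 1) → ℂ,
      toForms (symbExt (kosMap r p h y)) = kosD (toForms (symbExt y)) := by
    intro y
    funext K
    refine form_ext fun C => ?_
    rw [toForms_coordVec, kosD_toForms_coordVec]
    by_cases hK : K.card = h
    · obtain ⟨K, rfl⟩ : ∃ K' : Sym (Fin r) h, (K' : Multiset (Fin r)) = K := ⟨⟨K, hK⟩, rfl⟩
      rw [symbExt_coe, kosMap_apply]
      refine Finset.sum_congr rfl fun j _ => ?_
      rw [← Sym.coe_cons, symbExt_coe]
    · rw [symbExt_of_ne _ _ hK]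
      refine (Finset.sum_eq_zero fun j _ => ?_).symm
      rw [symbExt_of_ne _ _ (by simpa using hK), mul_zero]
  constructor
  · rintro ⟨y, rfl⟩ C K
    rw [← kosD_toForms_coordVec, key, kosD_kosD]
    rfl
  · intro hw
    have hw' : ∀ K, kosD (toForms (symbExt w)) K = 0 := fun K =>
      (kosD_toForms_eq_zero_iff _ K).2 fun C => hw C K
    have hne : ((p + 1 + h : ℕ) : ℂ) ≠ 0 := by exact_mod_cast (by omega : p + 1 + h ≠ 0)
    -- The primitive is the contraction with the Euler field, divided by the total degree p + 1 + h,
    -- nonzero in ℂ.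
    refine ⟨fun AK => ((p + 1 + h : ℕ) : ℂ)⁻¹ *
      kosI (toForms (symbExt w)) AK.2 (coordVec AK.1), ?_⟩
    ext ⟨C, K⟩
    have h1 := DFunLike.congr_fun (kosD_kosI _ hw' K) (coordVec C)
    rw [kosD_coordVec, ContinuousAlternatingMap.smul_apply, toForms_coordVec, symbExt_coe,
      show (K : Multiset (Fin r)).card = h from K.2] at h1
    change ∑ j : Fin (p + 1), (-1 : ℂ) ^ (j : ℕ) * (((p + 1 + h : ℕ) : ℂ)⁻¹ *
      kosI (toForms (symbExt w)) (C j ::ₘ K) (coordVec (C ∘ j.succAbove))) = _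
    simp only [mul_left_comm _ (((p + 1 + h : ℕ) : ℂ)⁻¹), ← Finset.mul_sum]
    rw [h1, smul_eq_mul, inv_mul_cancel_left₀ hne]

theorem finrank_vectors (hr : 1 ≤ r) (h : ℕ) :
    Module.finrank ℂ (IncIdx p r × Sym (Fin r) h → ℂ) = r.choose p * homDim r h := by
  rw [Module.finrank_fintype_fun_eq_card, Fintype.card_prod, card_incIdx, card_sym_fin hr]

/-- For closed symbols, induction on the order with p varying: the rank-nullity theorem for `kosMap`
relates order h + 1 in degree p to order h in degree p + 1, as does `symbDim_closed_recursion`. -/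
theorem finrank_formSymbols (κ : RelKind) (hp : 1 ≤ p) (hpr : p ≤ r) (h : ℕ) :
    Module.finrank ℂ (formSymbols κ r p h) = symbDim κ r p h := by
  cases κ with
  | all =>
    have : formSymbols .all r p h = ⊤ := by cases h <;> rfl
    rw [this, finrank_top, finrank_vectors (hp.trans hpr)]
    rfl
  | closed =>
    induction h generalizing p with
    | zero =>
      rw [show formSymbols .closed r p 0 = ⊤ from rfl, finrank_top, finrank_vectors (hp.trans hpr)]
      simp [symbDim, homDim, Nat.choose_symm hpr]
    | succ h ih =>
      have h1 := LinearMap.finrank_range_add_finrank_ker (kosMap r p h)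
      rw [range_kosMap, finrank_vectors (hp.trans hpr)] at h1
      change _ + Module.finrank ℂ (formSymbols .closed r p (h + 1)) = _ at h1
      rcases hpr.lt_or_eq with hlt | rfl
      · rw [ih (by omega) (by omega)] at h1
        have h2 := symbDim_closed_recursion hp hlt h
        omega
      -- In top degree p = r there are no forms of degree p + 1, so every symbol is closed.
      · have : IsEmpty (IncIdx (p + 1) p) := ⟨fun C => by
          have := Fintype.card_le_of_injective C C.injective
          simp at this⟩
        have h3 : Module.finrank ℂ (formSymbols .closed p (p + 1) h) = 0 := by
          have := Submodule.finrank_le (formSymbols .closed p (p + 1) h)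
          simpa using this
        rw [h3, zero_add] at h1
        rw [h1]
        simp [symbDim]

theorem mem_symbols_iff {κ : RelKind} {d q h : ℕ} {w : Symb d q p h} :
    w ∈ symbols κ d q p h ↔ ∀ i, (fun AK => w (i, AK)) ∈ formSymbols κ q p h := by
  cases h with
  | zero => exact ⟨fun _ _ => trivial, fun _ => trivial⟩
  | succ h =>
    cases κ with
    | all => exact ⟨fun _ _ => trivial, fun _ h => (by cases h)⟩
    | closed =>
      constructor
      · intro hw i
        change _ ∈ LinearMap.ker _
        rw [LinearMap.mem_ker]
        ext ⟨C, K⟩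
        exact hw rfl i C K
      · intro hw _ i C K
        exact congrFun (LinearMap.mem_ker.1 (hw i)) (C, K)

theorem finrank_symbols (κ : RelKind) (d : ℕ) {q : ℕ} (hp : 1 ≤ p) (hpq : p ≤ q) (h : ℕ) :
    Module.finrank ℂ (symbols κ d q p h) = d * symbDim κ q p h := by
  let e : symbols κ d q p h ≃ₗ[ℂ] (Fin d → formSymbols κ q p h) :=
    { toFun := fun w i => ⟨fun AK => w.1 (i, AK), mem_symbols_iff.1 w.2 i⟩
      invFun := fun g => ⟨fun iAK => (g iAK.1).1 iAK.2, mem_symbols_iff.2 fun i => (g i).2⟩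
      map_add' := fun _ _ => rfl
      map_smul' := fun _ _ => rfl
      left_inv := fun _ => rfl
      right_inv := fun _ => rfl }
  rw [e.finrank_eq, Module.finrank_pi_fintype]
  simp [finrank_formSymbols κ hp hpq]

end symbolDimensions

/-! ### Forms with given coefficients -/

section families

variable {r p : ℕ}

/-- The form with given coefficients. -/
def famForm (f : IncIdx p r → (Fin r → ℂ) → ℂ) (y : Fin r → ℂ) : Form r p :=
  ∑ A, f A y • coordForm A

theorem famForm_coordVec (f : IncIdx p r → (Fin r → ℂ) → ℂ) (y : Fin r → ℂ) (A : IncIdx p r) :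
    famForm f y (coordVec A) = f A y := by
  rw [famForm, ContinuousAlternatingMap.sum_apply, Finset.sum_eq_single A]
  · simp [coordForm_coordVec]
  · intro B _ hB
    simp [coordForm_coordVec, hB]
  · simp

theorem analyticAt_famForm {f : IncIdx p r → (Fin r → ℂ) → ℂ} {y : Fin r → ℂ}
    (hf : ∀ A, AnalyticAt ℂ (f A) y) : AnalyticAt ℂ (famForm f) y :=
  analyticAt_form fun A => by simpa only [famForm_coordVec] using hf A

theorem extDeriv_coordVec {ω : (Fin r → ℂ) → Form r p} {y : Fin r → ℂ}
    (hω : DifferentiableAt ℂ ω y) (C : IncIdx (p + 1) r) :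
    extDeriv ω y (coordVec C) = ∑ j : Fin (p + 1), (-1 : ℂ) ^ (j : ℕ) *
      fderiv ℂ (fun z => ω z (coordVec (C.drop j))) y (Pi.single (C j) 1) := by
  rw [extDeriv_eq_sum]
  refine Finset.sum_congr rfl fun j _ => ?_
  have h := ((ContinuousAlternatingMap.apply ℂ (Fin r → ℂ) ℂ
    (coordVec (C.drop j))).hasFDerivAt.comp y hω.hasFDerivAt).fderiv
  have e : fderiv ℂ (fun z => ω z (coordVec (C.drop j))) y (Pi.single (C j) 1) =
      fderiv ℂ ω y (Pi.single (C j) 1) (coordVec (C.drop j)) :=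
    DFunLike.congr_fun h (Pi.single (C j) 1)
  rw [e, zsmul_eq_mul]
  push_cast
  rfl

theorem extDeriv_famForm_eq_zero_iff {f : IncIdx p r → (Fin r → ℂ) → ℂ} {y : Fin r → ℂ}
    (hf : ∀ A, AnalyticAt ℂ (f A) y) :
    extDeriv (famForm f) y = 0 ↔ ∀ C : IncIdx (p + 1) r, ∑ j : Fin (p + 1),
      (-1 : ℂ) ^ (j : ℕ) * fderiv ℂ (f (C.drop j)) y (Pi.single (C j) 1) = 0 := by
  have h := extDeriv_coordVec (analyticAt_famForm hf).differentiableAt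
  simp only [famForm_coordVec] at h
  simp_rw [← h]
  exact ⟨fun h C => by rw [h]; rfl, fun h => form_ext fun C => h C⟩

/-- The derivatives of the coefficients of a closed form. -/
theorem sum_partialD_of_closed {ω : (Fin r → ℂ) → Form r p} {y : Fin r → ℂ}
    (hω : AnalyticAt ℂ ω y) (hd : ∀ᶠ z in 𝓝 y, extDeriv ω z = 0) (C : IncIdx (p + 1) r)
    (K : Multiset (Fin r)) : ∑ j : Fin (p + 1), (-1 : ℂ) ^ (j : ℕ) *
      partialD (fun z => ω z (coordVec (C.drop j))) (C j ::ₘ K) y = 0 := by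
  have hf : ∀ j, AnalyticAt ℂ (fun z => ω z (coordVec (C.drop j))) y := fun j =>
    analyticAt_form_eval hω _
  -- The zero function is written as an empty sum so that `partialDeriv_sum` treats both sides at
  -- once.
  have h1 : (fun z => ∑ j ∈ (Finset.univ : Finset (Fin (p + 1))), (-1 : ℂ) ^ (j : ℕ) *
      fderiv ℂ (fun z => ω z (coordVec (C.drop j))) z (Pi.single (C j) 1)) =ᶠ[𝓝 y]
      fun z => ∑ j ∈ (∅ : Finset (Fin (p + 1))), (-1 : ℂ) ^ (j : ℕ) *
        fderiv ℂ (fun z => ω z (coordVec (C.drop j))) z (Pi.single (C j) 1) := by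
    filter_upwards [hd, hω.eventually_analyticAt] with z hz hωz
    rw [← extDeriv_coordVec hωz.differentiableAt C, hz]
    simp
  have h2 := (partialD_congr h1 K).self_of_nhds
  have h3 := fun s : Finset (Fin (p + 1)) =>
    (partialDeriv_sum s (fun j => (-1 : ℂ) ^ (j : ℕ)) (fun j _ =>
      analyticAt_clm_eval (hf j).fderiv (Pi.single (C j) 1)) (K.sort (· ≤ ·))).self_of_nhds
  have h4 := (h3 Finset.univ).symm.trans (h2.trans (h3 ∅))
  beta_reduce at h4
  rw [Finset.sum_empty] at h4
  rw [← h4]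
  exact Finset.sum_congr rfl fun j _ =>
    congrArg _ (partialD_cons_of_fderiv (hf j) (C j)).self_of_nhds.symm

theorem sum_taylorHom_eq_zero {ι : Type*} (s : Finset ι) (c : ι → ℂ)
    (w : ι → Multiset (Fin r) → ℂ) (a : ι → Fin r)
    (hw : ∀ K, ∑ i ∈ s, c i * w i (a i ::ₘ K) = 0) (h : ℕ) (K : Multiset (Fin r))
    (y : Fin r → ℂ) : ∑ i ∈ s, c i * taylorHom (w i) h (a i ::ₘ K) y = 0 := by
  induction h generalizing K with
  | zero => exact hw K
  | succ h ih =>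
    simp only [taylorHom, Finset.mul_sum]
    rw [Finset.sum_comm]
    refine Finset.sum_eq_zero fun b _ => ?_
    rw [← mul_zero (y b), ← ih (b ::ₘ K), Finset.mul_sum]
    refine Finset.sum_congr rfl fun i _ => ?_
    rw [Multiset.cons_swap]
    ring

theorem sum_taylorPoly_eq_zero {ι : Type*} (s : Finset ι) (c : ι → ℂ)
    (w : ι → Multiset (Fin r) → ℂ) (a : ι → Fin r)
    (hw : ∀ K, ∑ i ∈ s, c i * w i (a i ::ₘ K) = 0) (N : ℕ) (K : Multiset (Fin r))
    (y : Fin r → ℂ) : ∑ i ∈ s, c i * taylorPoly (w i) N (a i ::ₘ K) y = 0 := by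
  simp only [taylorPoly, Finset.mul_sum]
  rw [Finset.sum_comm]
  refine Finset.sum_eq_zero fun h _ => ?_
  rw [← mul_zero ((h.factorial : ℂ)⁻¹), ← sum_taylorHom_eq_zero s c w a hw h K y, Finset.mul_sum]
  refine Finset.sum_congr rfl fun i _ => ?_
  ring

/-- Functions of multi-indices that may be the derivatives of the coefficients of a closed form. -/
def IsClosedFamily (w : IncIdx p r → Multiset (Fin r) → ℂ) : Prop :=
  ∀ (C : IncIdx (p + 1) r) (K : Multiset (Fin r)),
    ∑ j : Fin (p + 1), (-1 : ℂ) ^ (j : ℕ) * w (C.drop j) (C j ::ₘ K) = 0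

/-- The Koszul relations hold for every shift K, so they pass to the Taylor polynomials: a closed
formal family is realised by forms that are closed everywhere, not only to some order at y₀. -/
theorem extDeriv_famForm_taylorPoly {w : IncIdx p r → Multiset (Fin r) → ℂ}
    (hw : IsClosedFamily w) (N : ℕ) (y₀ y : Fin r → ℂ) :
    extDeriv (famForm fun A z => taylorPoly (w A) (N + 1) 0 (z - y₀)) y = 0 := by
  rw [extDeriv_famForm_eq_zero_iff fun A => analyticAt_taylorPoly_sub _ _ _ _ _]
  intro C
  rw [← sum_taylorPoly_eq_zero Finset.univ (fun j : Fin (p + 1) => (-1 : ℂ) ^ (j : ℕ))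
    (fun j => w (C.drop j)) C (hw C) N 0 (y - y₀)]
  refine Finset.sum_congr rfl fun j _ => congrArg _ ?_
  have := congrFun (partialDeriv_taylorPoly (w (C.drop j)) y₀ N 0 [C j]) y
  simpa [partialDeriv] using this

end families

/-! ### Pull-backs by the submersions and the derived equations of a web. -/

namespace Web

variable {n d q p : ℕ} (W : Web n d q)

theorem analyticAt_jac (i : Fin d) (A : IncIdx p q) (B : IncIdx p n) {x : Fin n → ℂ}
    (hx : x ∈ W.U) : AnalyticAt ℂ (W.jac i A B) x :=
  analyticAt_det fun a _ => ((ContinuousLinearMap.proj (R := ℂ)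
    (φ := fun _ : Fin q => ℂ) (A a)).analyticAt _).comp
      (analyticAt_clm_eval (W.holomorphic_u i x hx).fderiv _)

/-- The pull-back of the form with given coefficients. -/
def pull (i : Fin d) (f : IncIdx p q → (Fin q → ℂ) → ℂ) (y : Fin n → ℂ) : Form n p :=
  (famForm f (W.u i y)).compContinuousLinearMap (fderiv ℂ (W.u i) y)

theorem pull_apply (i : Fin d) (f : IncIdx p q → (Fin q → ℂ) → ℂ) (y : Fin n → ℂ)
    (m : Fin p → (Fin n → ℂ)) : W.pull i f y m = ∑ A : IncIdx p q, f A (W.u i y) *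
      (Matrix.of fun a b : Fin p => fderiv ℂ (W.u i) y (m b) (A a)).det := by
  rw [pull, ContinuousAlternatingMap.compContinuousLinearMap_apply, form_apply_eq_sum]
  simp only [famForm_coordVec]
  rfl

theorem pull_coordVec (i : Fin d) (f : IncIdx p q → (Fin q → ℂ) → ℂ) (y : Fin n → ℂ)
    (B : IncIdx p n) : W.pull i f y (coordVec B) = ∑ A, f A (W.u i y) * W.jac i A B y :=
  W.pull_apply i f y _

theorem analyticAt_pull (i : Fin d) {f : IncIdx p q → (Fin q → ℂ) → ℂ} {x : Fin n → ℂ}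
    (hx : x ∈ W.U) (hf : ∀ A, AnalyticAt ℂ (f A) (W.u i x)) : AnalyticAt ℂ (W.pull i f) x :=
  analyticAt_form_comp (AnalyticAt.comp (g := famForm f) (analyticAt_famForm hf)
    (W.holomorphic_u i x hx)) (W.holomorphic_u i x hx).fderiv

theorem extDeriv_pull (i : Fin d) {f : IncIdx p q → (Fin q → ℂ) → ℂ} {x : Fin n → ℂ}
    (hx : x ∈ W.U) (hf : ∀ A, AnalyticAt ℂ (f A) (W.u i x)) : extDeriv (W.pull i f) x =
      (extDeriv (famForm f) (W.u i x)).compContinuousLinearMap (fderiv ℂ (W.u i) x) :=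
  extDeriv_pullback (r := ⊤) (analyticAt_famForm hf).differentiableAt
    (W.holomorphic_u i x hx).contDiffAt (by simp)

/-- The left side of the derived equation `(E_B)'_L`, with `w i A K` in place of the derivative of
multi-index `K` of the coefficient `f_{i,A}`. -/
def eqs (N : ℕ) (w : Fin d → IncIdx p q → Multiset (Fin q) → ℂ) (B : IncIdx p n)
    (L : List (Fin n)) (x : Fin n → ℂ) : ℂ :=
  ∑ i, ∑ A, evalCoef N (W.u i) (W.jac i A B) L (w i A) x

theorem eqs_perm {N : ℕ} {w : Fin d → IncIdx p q → Multiset (Fin q) → ℂ} {B : IncIdx p n}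
    {L L' : List (Fin n)} (hL : L.Perm L') {x : Fin n → ℂ} (hx : x ∈ W.U) :
    W.eqs N w B L x = W.eqs N w B L' x :=
  Finset.sum_congr rfl fun i _ => Finset.sum_congr rfl fun A _ =>
    evalCoef_perm (W.holomorphic_u i x hx) (W.analyticAt_jac i A B hx) hL N _

theorem partialDeriv_trace {f : Fin d → IncIdx p q → (Fin q → ℂ) → ℂ} {x : Fin n → ℂ}
    (hx : x ∈ W.U) (hf : ∀ i A, AnalyticAt ℂ (f i A) (W.u i x)) (B : IncIdx p n)
    {L : List (Fin n)} {N : ℕ} (hN : L.length < N) :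
    partialDeriv L (fun y => ∑ i, W.pull i (f i) y (coordVec B)) =ᶠ[𝓝 x]
      fun y => W.eqs N (fun i A K => partialD (f i A) K (W.u i y)) B L y := by
  have hterm : ∀ i A, AnalyticAt ℂ (fun y => f i A (W.u i y) * W.jac i A B y) x := fun i A =>
    (AnalyticAt.comp (g := f i A) (hf i A) (W.holomorphic_u i x hx)).mul (W.analyticAt_jac i A B hx)
  have h1 : (fun y => ∑ i, W.pull i (f i) y (coordVec B)) =
      fun y => ∑ iA ∈ (Finset.univ : Finset (Fin d × IncIdx p q)),
        1 * (f iA.1 iA.2 (W.u iA.1 y) * W.jac iA.1 iA.2 B y) := by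
    funext y
    simp only [one_mul, Fintype.sum_prod_type, pull_coordVec]
  rw [h1]
  have h2 : ∀ᶠ y in 𝓝 x, ∀ iA : Fin d × IncIdx p q,
      partialDeriv L (fun y => f iA.1 iA.2 (W.u iA.1 y) * W.jac iA.1 iA.2 B y) y =
        evalCoef N (W.u iA.1) (W.jac iA.1 iA.2 B) L
          (fun K => partialD (f iA.1 iA.2) K (W.u iA.1 y)) y :=
    eventually_all.2 fun iA => partialDeriv_comp_mul (W.holomorphic_u iA.1 x hx)
      (W.analyticAt_jac iA.1 iA.2 B hx) (hf iA.1 iA.2) hN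
  filter_upwards [partialDeriv_sum Finset.univ (fun _ => (1 : ℂ))
    (fun (iA : Fin d × IncIdx p q) _ => hterm iA.1 iA.2) L, h2] with y h3 h4
  rw [h3]
  simp only [h4, one_mul, eqs, Fintype.sum_prod_type]

theorem eqs_congr {N : ℕ} {w w' : Fin d → IncIdx p q → Multiset (Fin q) → ℂ} {B : IncIdx p n}
    {L : List (Fin n)} {x : Fin n → ℂ}
    (h : ∀ i A (K : Multiset (Fin q)), K.card < N → w i A K = w' i A K) :
    W.eqs N w B L x = W.eqs N w' B L x :=
  Finset.sum_congr rfl fun i _ => Finset.sum_congr rfl fun A _ => evalCoef_congr (h i A)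

/-- The derived equations of a family of closed forms are those of a closed form. -/
theorem sum_eqs_of_closed {w : Fin d → IncIdx p q → Multiset (Fin q) → ℂ}
    (hw : ∀ i, IsClosedFamily (w i)) {x : Fin n → ℂ} (hx : x ∈ W.U) {N : ℕ}
    (C : IncIdx (p + 1) n) (L : Multiset (Fin n)) (hL : L.card + 1 < N) :
    ∑ j : Fin (p + 1), (-1 : ℂ) ^ (j : ℕ) *
      W.eqs N w (C.drop j) ((C j ::ₘ L).sort (· ≤ ·)) x = 0 := by
  obtain ⟨M, rfl⟩ : ∃ M, N = M + 1 := ⟨N - 1, by omega⟩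
  -- The formal family is realised at u_i(x) by closed polynomial forms. The sum ω of their
  -- pull-backs is then closed on U, and its derivatives at x are the left sides of the derived
  -- equations.
  let f : Fin d → IncIdx p q → (Fin q → ℂ) → ℂ := fun i A z =>
    taylorPoly (w i A) (M + 1) 0 (z - W.u i x)
  have hf : ∀ i A z, AnalyticAt ℂ (f i A) z := fun i A z => analyticAt_taylorPoly_sub _ _ _ _ _
  let ω : (Fin n → ℂ) → Form n p := fun y => ∑ i, W.pull i (f i) y
  have hωa : AnalyticAt ℂ ω x :=
    Finset.analyticAt_fun_sum _ fun i _ => W.analyticAt_pull i hx fun A => hf i A _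
  have hd : ∀ᶠ y in 𝓝 x, extDeriv ω y = 0 := by
    filter_upwards [W.isOpen_U.mem_nhds hx] with y hy
    have hpd : ∀ i, extDeriv (W.pull i (f i)) y = 0 := by
      intro i
      rw [W.extDeriv_pull i hy fun A => hf i A _, extDeriv_famForm_taylorPoly (hw i)]
      ext m
      simp
    have hfd : fderiv ℂ ω y = ∑ i, fderiv ℂ (W.pull i (f i)) y :=
      fderiv_fun_sum fun i _ => (W.analyticAt_pull i hy fun A => hf i A _).differentiableAt
    ext m
    rw [extDeriv_eq_sum, hfd]
    have h1 : ∀ j : Fin (p + 1), (-1 : ℤ) ^ (j : ℕ) •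
        (∑ i, fderiv ℂ (W.pull i (f i)) y) (m j) (j.removeNth m) =
        ∑ i, (-1 : ℤ) ^ (j : ℕ) • fderiv ℂ (W.pull i (f i)) y (m j) (j.removeNth m) := by
      intro j
      rw [sum_apply, ContinuousAlternatingMap.sum_apply, Finset.smul_sum]
    rw [Finset.sum_congr rfl fun j _ => h1 j, Finset.sum_comm]
    refine Finset.sum_eq_zero fun i _ => ?_
    rw [← extDeriv_eq_sum, hpd]
    rfl
  rw [← sum_partialD_of_closed hωa hd C L]
  refine Finset.sum_congr rfl fun j _ => congrArg _ ?_
  have h2 := (W.partialDeriv_trace hx (fun i A => hf i A _) (C.drop j)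
    (L := (C j ::ₘ L).sort (· ≤ ·)) (N := M + 1) (by simpa using hL)).self_of_nhds
  have h3 : (fun z => ω z (coordVec (C.drop j))) =
      fun y => ∑ i, W.pull i (f i) y (coordVec (C.drop j)) := by
    funext y
    exact ContinuousAlternatingMap.sum_apply _ _
  rw [partialD, h3, h2]
  exact W.eqs_congr fun i A K hK => (partialD_taylorPoly_self _ _ hK).symm

/-- In the closed case the equations are not independent: their left sides obey the Koszul relations
in n variables. This is why a(n,k), and not the number of rows, is the largest possible rank of P_k.
-/
theorem eqs_mem_formSymbols {κ : RelKind} {w : Fin d → IncIdx p q → Multiset (Fin q) → ℂ}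
    (hw : κ = .closed → ∀ i, IsClosedFamily (w i)) {x : Fin n → ℂ} (hx : x ∈ W.U) {l N : ℕ}
    (hl : l < N) : (fun BL : IncIdx p n × Sym (Fin n) l =>
      W.eqs N w BL.1 ((BL.2 : Multiset (Fin n)).sort (· ≤ ·)) x) ∈ formSymbols κ n p l := by
  rw [mem_formSymbols_iff]
  intro hκ C K
  by_cases hK : K.card + 1 = l
  · rw [← W.sum_eqs_of_closed (hw hκ) hx C K (hK.trans_lt hl)]
    refine Finset.sum_congr rfl fun j _ => congrArg _ ?_
    rw [symbExt, dif_pos (by simpa using hK)]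
    rfl
  · refine Finset.sum_eq_zero fun j _ => ?_
    rw [symbExt_of_ne _ _ (by simpa using hK), mul_zero]

end Web

/-! ### The spaces of formal abelian relations -/

theorem finrank_map_add_finrank_inf_ker {V V' : Type*} [AddCommGroup V] [Module ℂ V]
    [AddCommGroup V'] [Module ℂ V'] [FiniteDimensional ℂ V] (f : V →ₗ[ℂ] V') (S : Submodule ℂ V) :
    Module.finrank ℂ (S.map f) + Module.finrank ℂ (S ⊓ LinearMap.ker f : Submodule ℂ V) =
      Module.finrank ℂ S := by
  have h := (f.domRestrict S).finrank_range_add_finrank_ker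
  rw [LinearMap.range_domRestrict, LinearMap.ker_domRestrict] at h
  rw [← h, ← Submodule.map_comap_subtype,
    ← (Submodule.equivMapOfInjective _ S.subtype_injective _).finrank_eq]

section jets

variable {d q p r : ℕ}

/-- The extension by zero of a jet. -/
def jetExt (w : Jet d q p r) (i : Fin d) (A : IncIdx p q) (K : Multiset (Fin q)) : ℂ :=
  if h : K.card < r then w ⟨K.card, h⟩ (i, A, ⟨K, rfl⟩) else 0

theorem jetExt_coe (w : Jet d q p r) (i : Fin d) (A : IncIdx p q) (h : Fin r)
    (K : Sym (Fin q) h) : jetExt w i A K = w h (i, A, K) := by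
  obtain ⟨h, hh⟩ := h
  obtain ⟨K, hK⟩ := K
  change K.card = h at hK
  subst hK
  exact dif_pos hh

theorem jetExt_eq {w : Jet d q p r} {i : Fin d} {A : IncIdx p q} {K : Multiset (Fin q)}
    {h : ℕ} (hK : K.card = h) (hh : h < r) : jetExt w i A K = w ⟨h, hh⟩ (i, A, ⟨K, hK⟩) :=
  jetExt_coe w i A ⟨h, hh⟩ ⟨K, hK⟩

theorem jetExt_of_le (w : Jet d q p r) (i : Fin d) (A : IncIdx p q) {K : Multiset (Fin q)}
    (hK : r ≤ K.card) : jetExt w i A K = 0 := dif_neg (not_lt.2 hK)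

theorem jetExt_proj (w : Jet d q p (r + 1)) (i : Fin d) (A : IncIdx p q) {K : Multiset (Fin q)}
    (hK : K.card < r) : jetExt w.proj i A K = jetExt w i A K := by
  rw [jetExt_eq rfl hK, jetExt_eq rfl (hK.trans r.lt_succ_self)]
  rfl

theorem forall_mem_symbols_iff {κ : RelKind} {w : Jet d q p r} :
    (∀ h : Fin r, w h ∈ symbols κ d q p h) ↔
      (κ = .closed → ∀ i, IsClosedFamily (jetExt w i)) := by
  simp only [mem_symbols_iff, mem_formSymbols_iff]
  constructor
  · intro hw hκ i C K
    by_cases hK : K.card + 1 < r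
    · rw [← hw ⟨K.card + 1, hK⟩ i hκ C K]
      refine Finset.sum_congr rfl fun j _ => congrArg _ ?_
      rw [jetExt_eq (by simp) hK, symbExt, dif_pos]
    · refine Finset.sum_eq_zero fun j _ => ?_
      rw [jetExt_of_le _ _ _ (by simpa using hK), mul_zero]
  · intro hw h i hκ C K
    by_cases hK : K.card + 1 = h
    · rw [← hw hκ i C K]
      refine Finset.sum_congr rfl fun j _ => congrArg _ ?_
      rw [symbExt, dif_pos (by simpa using hK), jetExt_eq (by simpa using hK) h.2]
    · refine Finset.sum_eq_zero fun j _ => ?_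
      rw [symbExt_of_ne _ _ (by simpa using hK), mul_zero]

/-- The projection of jets, as a linear map. -/
def projL (d q p r : ℕ) : Jet d q p (r + 1) →ₗ[ℂ] Jet d q p r where
  toFun := Jet.proj
  map_add' _ _ := rfl
  map_smul' _ _ := rfl

/-- The jet with a given part of top order and nothing else. -/
def topL (d q p r : ℕ) : Symb d q p r →ₗ[ℂ] Jet d q p (r + 1) :=
  LinearMap.single ℂ (fun h : Fin (r + 1) => Symb d q p h) (Fin.last r)

theorem topL_last (t : Symb d q p r) : topL d q p r t (Fin.last r) = t :=
  Pi.single_eq_same (M := fun h : Fin (r + 1) => Symb d q p h) (Fin.last r) t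

theorem topL_castSucc (t : Symb d q p r) (h : Fin r) : topL d q p r t h.castSucc = 0 :=
  Pi.single_eq_of_ne (M := fun h : Fin (r + 1) => Symb d q p h) (Fin.castSucc_lt_last h).ne t

theorem topL_injective : Function.Injective (topL d q p r) := fun a b h => by
  rw [← topL_last a, h, topL_last]

/-- The jet with a given lower part and a given part of top order. -/
def snocJet (w : Jet d q p r) (t : Symb d q p r) : Jet d q p (r + 1) :=
  Fin.snoc (α := fun h : Fin (r + 1) => Symb d q p h) w t

theorem snocJet_last (w : Jet d q p r) (t : Symb d q p r) : snocJet w t (Fin.last r) = t :=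
  Fin.snoc_last (α := fun h : Fin (r + 1) => Symb d q p h) _ _

theorem snocJet_castSucc (w : Jet d q p r) (t : Symb d q p r) (h : Fin r) :
    snocJet w t h.castSucc = w h :=
  Fin.snoc_castSucc (α := fun h : Fin (r + 1) => Symb d q p h) _ _ _

theorem proj_snocJet (w : Jet d q p r) (t : Symb d q p r) : (snocJet w t).proj = w :=
  funext fun h => snocJet_castSucc w t h

end jets

namespace Web

variable {n d q p : ℕ} (W : Web n d q)

/-- The truncation N may exceed r because jets are extended by zero. With N = r + 1 the equations of
order r can be evaluated on a jet that has no entry of order r. -/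
theorem sum_block_mulVec {r : ℕ} (w : Jet d q p r) {l N : ℕ} (hN : r ≤ N) (x : Fin n → ℂ)
    (B : IncIdx p n) (L : Sym (Fin n) l) :
    (∑ h : Fin r, (W.block p l h x).mulVec (w h)) (B, L) =
      W.eqs N (jetExt w) B ((L : Multiset (Fin n)).sort (· ≤ ·)) x := by
  have h1 : ∀ i A, evalCoef N (W.u i) (W.jac i A B) ((L : Multiset (Fin n)).sort (· ≤ ·))
      (jetExt w i A) x = ∑ h : Fin r, ∑ K : Sym (Fin q) h,
        coef (W.u i) (W.jac i A B) ((L : Multiset (Fin n)).sort (· ≤ ·)) K x * w h (i, A, K) := by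
    intro i A
    rw [evalCoef, ← Finset.sum_subset (Finset.range_mono hN), Finset.sum_range]
    · simp only [jetExt_coe]
    · intro h _ hh
      refine Finset.sum_eq_zero fun K _ => ?_
      have hK : (K : Multiset (Fin q)).card = h := K.2
      rw [jetExt_of_le _ _ _ (by simpa [hK] using hh), mul_zero]
  simp only [eqs, h1]
  rw [Finset.sum_congr rfl fun i _ => Finset.sum_comm, Finset.sum_comm, Finset.sum_apply]
  refine Finset.sum_congr rfl fun h _ => ?_
  simp only [Matrix.mulVec, dotProduct, Fintype.sum_prod_type]
  rfl

theorem mem_R_iff {κ : RelKind} {r : ℕ} {x : Fin n → ℂ} {w : Jet d q p r} :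
    w ∈ W.R κ p r x ↔ (κ = .closed → ∀ i, IsClosedFamily (jetExt w i)) ∧
      ∀ (B : IncIdx p n) (L : Multiset (Fin n)), L.card < r →
        W.eqs r (jetExt w) B (L.sort (· ≤ ·)) x = 0 := by
  rw [← forall_mem_symbols_iff]
  refine and_congr_right fun _ => ⟨fun h B L hL => ?_, fun h l => ?_⟩
  · have := congrFun (h ⟨L.card, hL⟩) (B, ⟨L, rfl⟩)
    exact (W.sum_block_mulVec w le_rfl x B ⟨L, rfl⟩).symm.trans this
  · ext ⟨B, L⟩
    rw [W.sum_block_mulVec w le_rfl]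
    exact h B L (lt_of_eq_of_lt L.2 l.2)

theorem block_eq_zero {l h : ℕ} (hlh : l < h) (x : Fin n → ℂ) : W.block p l h x = 0 := by
  ext ⟨B, L⟩ ⟨i, A, K⟩
  have hL : (L : Multiset (Fin n)).card = l := L.2
  have hK : (K : Multiset (Fin q)).card = h := K.2
  exact congrFun (coef_eq_zero (W.u i) (W.jac i A B) (by simpa [hL, hK] using hlh)) x

/-- By block triangularity the entry of top order appears only in the equations of top order, and
there through P_r. -/
theorem mem_R_succ_iff {κ : RelKind} {r : ℕ} {x : Fin n → ℂ} {w : Jet d q p (r + 1)} :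
    w ∈ W.R κ p (r + 1) x ↔ w.proj ∈ W.R κ p r x ∧ w (Fin.last r) ∈ symbols κ d q p r ∧
      ∑ h : Fin r, (W.block p r h x).mulVec (w h.castSucc) +
        (W.block p r r x).mulVec (w (Fin.last r)) = 0 := by
  have h0 : ∀ l : Fin r, ∑ h : Fin (r + 1), (W.block p l h x).mulVec (w h) =
      ∑ h : Fin r, (W.block p l h x).mulVec (w.proj h) := by
    intro l
    rw [Fin.sum_univ_castSucc]
    have : W.block p l (Fin.last r : Fin (r + 1)) x = 0 := W.block_eq_zero l.2 x
    rw [this, Matrix.zero_mulVec, add_zero]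
    rfl
  have h1 : ∑ h : Fin (r + 1), (W.block p r h x).mulVec (w h) =
      ∑ h : Fin r, (W.block p r h x).mulVec (w h.castSucc) +
        (W.block p r r x).mulVec (w (Fin.last r)) := Fin.sum_univ_castSucc _
  constructor
  · rintro ⟨hs, he⟩
    exact ⟨⟨fun h => hs h.castSucc, fun l => (h0 l).symm.trans (he l.castSucc)⟩, hs (Fin.last r),
      h1.symm.trans (he (Fin.last r))⟩
  · rintro ⟨⟨hs, he⟩, hs', he'⟩
    refine ⟨fun h => ?_, fun l => ?_⟩
    · refine Fin.lastCases ?_ (fun h => ?_) h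
      · exact hs'
      · exact hs h
    · refine Fin.lastCases ?_ (fun l => ?_) l
      · exact h1.trans he'
      · exact (h0 l).trans (he l)

theorem proj_mem {κ : RelKind} {r : ℕ} {x : Fin n → ℂ} {w : Jet d q p (r + 1)}
    (hw : w ∈ W.R κ p (r + 1) x) : w.proj ∈ W.R κ p r x := (W.mem_R_succ_iff.1 hw).1

/-- P_h applied to a symbol t is the left side of the equations of order h on the jet whose only
nonzero entry is t, so `eqs_mem_formSymbols` applies. -/
theorem map_block_le (κ : RelKind) {x : Fin n → ℂ} (hx : x ∈ W.U) (h : ℕ) :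
    (symbols κ d q p h).map (W.block p h h x).mulVecLin ≤ formSymbols κ n p h := by
  rintro _ ⟨t, ht, rfl⟩
  have hs : ∀ k : Fin (h + 1), topL d q p h t k ∈ symbols κ d q p k := by
    refine Fin.lastCases ?_ fun k => ?_
    · rw [topL_last]
      exact ht
    · rw [topL_castSucc]
      exact zero_mem _
  have h1 : (W.block p h h x).mulVec t =
      ∑ k : Fin (h + 1), (W.block p h k x).mulVec (topL d q p h t k) := by
    rw [Fin.sum_univ_castSucc, topL_last, Finset.sum_eq_zero, zero_add]
    · rfl
    · intro k _
      rw [topL_castSucc, Matrix.mulVec_zero]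
  rw [Matrix.mulVecLin_apply, h1]
  convert W.eqs_mem_formSymbols (forall_mem_symbols_iff.1 hs) hx h.lt_succ_self using 1
  ext ⟨B, L⟩
  exact W.sum_block_mulVec _ le_rfl x B L

theorem R_inf_ker (κ : RelKind) (r : ℕ) (x : Fin n → ℂ) :
    W.R κ p (r + 1) x ⊓ LinearMap.ker (projL d q p r) =
      (symbols κ d q p r ⊓ LinearMap.ker (W.block p r r x).mulVecLin).map (topL d q p r) := by
  ext w
  constructor
  · rintro ⟨hw, hw0⟩
    have h0 : ∀ h : Fin r, w h.castSucc = 0 := fun h => congrFun hw0 h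
    have hR := W.mem_R_succ_iff.1 hw
    refine ⟨w (Fin.last r), ⟨hR.2.1, ?_⟩, ?_⟩
    · have := hR.2.2
      simp only [h0, Matrix.mulVec_zero, Finset.sum_const_zero, zero_add] at this
      exact this
    · funext h
      refine Fin.lastCases ?_ (fun h => ?_) h
      · exact topL_last _
      · rw [topL_castSucc, h0]
  · rintro ⟨t, ⟨ht, ht0⟩, rfl⟩
    have h0 : (topL d q p r t).proj = 0 := funext fun h => topL_castSucc t h
    refine ⟨W.mem_R_succ_iff.2 ⟨?_, ?_, ?_⟩, h0⟩
    · rw [h0]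
      exact zero_mem _
    · rw [topL_last]
      exact ht
    · simp only [topL_last, topL_castSucc, Matrix.mulVec_zero, Finset.sum_const_zero, zero_add]
      exact ht0

/-! ### Dimensions of the fibres and surjectivity of the projections up to `kZero`. -/

section calibrated

variable {W} {κ : RelKind} (hp : 1 ≤ p) (hpq : p ≤ q) (hqn : q < n) (hord : W.IsOrdinary κ p)
  (hcal : IsCalibrated κ n d q p) {x : Fin n → ℂ} (hx : x ∈ W.U) {r : ℕ}
  (hr : r ≤ kZero κ n d q p)
include hp hpq hqn hord hcal hx hr

theorem finrank_map_block : Module.finrank ℂ ((symbols κ d q p r).map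
    (W.block p r r x).mulVecLin) = symbDim κ n p r := by
  rw [hord x hx r, min_eq_left (symbDim_le_of_le_kZero hp hpq hqn hcal hr)]

/-- Maximal rank equals the dimension of the space of symbols in which the image is known to lie. -/
theorem map_block_eq :
    (symbols κ d q p r).map (W.block p r r x).mulVecLin = formSymbols κ n p r :=
  Submodule.eq_of_le_of_finrank_eq (W.map_block_le κ hx r) (by
    rw [finrank_map_block hp hpq hqn hord hcal hx hr,
      finrank_formSymbols κ hp (hpq.trans hqn.le)])

/-- The lower orders contribute to the equations of order r a vector of `formSymbols κ n p r`, which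
is the image of P_r; a top-order entry cancelling it therefore exists. -/
theorem map_projL_R : (W.R κ p (r + 1) x).map (projL d q p r) = W.R κ p r x := by
  refine le_antisymm ?_ fun w hw => ?_
  · rintro _ ⟨w, hw, rfl⟩
    exact W.proj_mem hw
  have h1 : ∑ h : Fin r, (W.block p r h x).mulVec (w h) ∈ formSymbols κ n p r := by
    convert W.eqs_mem_formSymbols (forall_mem_symbols_iff.1 hw.1) hx r.lt_succ_self using 1
    ext ⟨B, L⟩
    exact W.sum_block_mulVec _ r.le_succ x B L
  rw [← map_block_eq hp hpq hqn hord hcal hx hr] at h1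
  obtain ⟨t, ht, hte⟩ := h1
  rw [Matrix.mulVecLin_apply] at hte
  refine ⟨snocJet w (-t), W.mem_R_succ_iff.2 ⟨?_, ?_, ?_⟩, proj_snocJet w _⟩
  · rwa [proj_snocJet]
  · rw [snocJet_last]
    exact neg_mem ht
  · simp only [snocJet_castSucc, snocJet_last, Matrix.mulVec_neg]
    rw [hte, add_neg_cancel]

theorem finrank_symbols_inf_ker : Module.finrank ℂ
    (symbols κ d q p r ⊓ LinearMap.ker (W.block p r r x).mulVecLin : Submodule ℂ (Symb d q p r)) =
      d * symbDim κ q p r - symbDim κ n p r := by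
  have h := finrank_map_add_finrank_inf_ker (W.block p r r x).mulVecLin (symbols κ d q p r)
  rw [finrank_map_block hp hpq hqn hord hcal hx hr, finrank_symbols κ d hp hpq] at h
  exact Nat.eq_sub_of_add_eq' h

theorem finrank_R_succ : Module.finrank ℂ (W.R κ p (r + 1) x) =
    Module.finrank ℂ (W.R κ p r x) + (d * symbDim κ q p r - symbDim κ n p r) := by
  have h := finrank_map_add_finrank_inf_ker (projL d q p r) (W.R κ p (r + 1) x)
  rw [map_projL_R hp hpq hqn hord hcal hx hr, R_inf_ker,
    ← (Submodule.equivMapOfInjective _ topL_injective _).finrank_eq,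
    finrank_symbols_inf_ker hp hpq hqn hord hcal hx hr] at h
  exact h.symm

end calibrated

section calibrated

variable {W} {κ : RelKind} (hp : 1 ≤ p) (hpq : p ≤ q) (hqn : q < n) (hord : W.IsOrdinary κ p)
  (hcal : IsCalibrated κ n d q p) {x : Fin n → ℂ} (hx : x ∈ W.U)
include hp hpq hqn hord hcal hx

theorem finrank_R_of_le {r : ℕ} (hr : r ≤ kZero κ n d q p + 1) :
    Module.finrank ℂ (W.R κ p r x) =
      ∑ h ∈ Finset.range r, (d * symbDim κ q p h - symbDim κ n p h) := by
  induction r with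
  | zero =>
    rw [Finset.range_zero, Finset.sum_empty]
    exact Module.finrank_zero_of_subsingleton
  | succ r ih =>
    rw [finrank_R_succ hp hpq hqn hord hcal hx (by omega), ih (by omega), Finset.sum_range_succ]

theorem finrank_R : Module.finrank ℂ (W.R κ p (kZero κ n d q p) x) = maxRank κ n d q p := by
  rw [finrank_R_of_le hp hpq hqn hord hcal hx (Nat.le_succ _),
    maxRank_eq_sum hp hpq hqn hcal]

theorem finrank_R_kZero_succ :
    Module.finrank ℂ (W.R κ p (kZero κ n d q p + 1) x) = maxRank κ n d q p := by
  rw [finrank_R_succ hp hpq hqn hord hcal hx le_rfl, finrank_R hp hpq hqn hord hcal hx,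
    Nat.sub_eq_zero_of_le (symbDim_le_of_kZero_le hp hpq hqn hcal le_rfl), add_zero]

/-- At order `kZero` calibration makes the kernel of P on the symbols zero, which gives injectivity;
surjectivity is `map_projL_R`, still valid at this order. -/
theorem bijOn_proj : Set.BijOn Jet.proj
    (W.R κ p (kZero κ n d q p + 1) x : Set (Jet d q p (kZero κ n d q p + 1)))
    (W.R κ p (kZero κ n d q p) x : Set (Jet d q p (kZero κ n d q p))) := by
  refine ⟨fun w hw => W.proj_mem hw, fun w hw w' hw' h => ?_, fun w hw => ?_⟩
  · have h0 : w - w' ∈ W.R κ p (kZero κ n d q p + 1) x ⊓ LinearMap.ker (projL d q p _) :=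
      ⟨sub_mem hw hw', (map_sub (projL d q p _) w w').trans (sub_eq_zero.2 h)⟩
    have h1 := finrank_symbols_inf_ker hp hpq hqn hord hcal hx le_rfl
    rw [Nat.sub_eq_zero_of_le (symbDim_le_of_kZero_le hp hpq hqn hcal le_rfl),
      Submodule.finrank_eq_zero] at h1
    rw [R_inf_ker, h1, Submodule.map_bot, Submodule.mem_bot] at h0
    exact sub_eq_zero.1 h0
  · have h1 : w ∈ (W.R κ p (kZero κ n d q p + 1) x).map (projL d q p _) := by
      rw [map_projL_R hp hpq hqn hord hcal hx le_rfl]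
      exact hw
    exact h1

end calibrated

/-- The condition on symbols does not depend on the point and is expressed by constant maps Q; the
remaining equations have analytic coefficients. This puts `R` in the form required by
`isHolomorphicSubbundle_ker`. -/
theorem exists_equations (κ : RelKind) (r : ℕ) : ∃ T : (Fin n → ℂ) → Jet d q p r →ₗ[ℂ]
    ((h : Fin r) → Symb d q p h) × ((l : Fin r) → IncIdx p n × Sym (Fin n) l → ℂ),
    (∀ w, AnalyticOnNhd ℂ (fun y => T y w) W.U) ∧ ∀ y, W.R κ p r y = LinearMap.ker (T y) := by
  have hQ : ∀ h : ℕ, ∃ Q : Symb d q p h →ₗ[ℂ] Symb d q p h,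
      LinearMap.ker Q = symbols κ d q p h := by
    intro h
    obtain ⟨S, hS⟩ := Submodule.exists_isCompl (symbols κ d q p h)
    refine ⟨S.subtype.comp (S.projectionOnto _ hS.symm), ?_⟩
    rw [LinearMap.ker_comp, Submodule.ker_subtype, ← LinearMap.ker,
      Submodule.ker_projectionOnto]
  choose Q hQ using hQ
  refine ⟨fun y => LinearMap.prod (LinearMap.pi fun h => (Q h).comp (LinearMap.proj h))
    (LinearMap.pi fun l => ∑ h : Fin r, (W.block p l h y).mulVecLin.comp (LinearMap.proj h)),
    fun w x hx => ?_, fun y => ?_⟩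
  · refine AnalyticAt.prod analyticAt_const (AnalyticAt.pi fun l => AnalyticAt.pi fun BL => ?_)
    simp only [LinearMap.pi_apply, LinearMap.sum_apply, LinearMap.comp_apply,
      Matrix.mulVecLin_apply, Finset.sum_apply, Matrix.mulVec, dotProduct]
    refine Finset.analyticAt_fun_sum _ fun h _ => Finset.analyticAt_fun_sum _ fun K _ => ?_
    exact (analyticAt_coef (W.holomorphic_u _ x hx) (W.analyticAt_jac _ _ _ hx) _ _).mul
      analyticAt_const
  · ext w
    rw [LinearMap.mem_ker, LinearMap.prod_apply]
    refine Iff.trans ?_ Prod.mk_eq_zero.symm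
    refine and_congr ?_ ?_
    · rw [funext_iff]
      refine forall_congr' fun h => ?_
      rw [← hQ, LinearMap.mem_ker]
      rfl
    · rw [funext_iff]
      refine forall_congr' fun l => ?_
      simp only [LinearMap.pi_apply, LinearMap.sum_apply]
      rfl

theorem isHolomorphicSubbundle_R {κ : RelKind} {r N : ℕ}
    (hN : ∀ x ∈ W.U, Module.finrank ℂ (W.R κ p r x) = N) :
    IsHolomorphicSubbundle W.U (W.R κ p r) N := by
  obtain ⟨T, hT, hR⟩ := W.exists_equations (p := p) κ r
  exact isHolomorphicSubbundle_ker W.isOpen_U hT (fun y _ => hR y) hN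

end Web

/-! ### Frames -/

section frames

variable {n N : ℕ} {F : Type*} [NormedAddCommGroup F] [NormedSpace ℂ F] [FiniteDimensional ℂ F]

theorem analyticAt_clm_apply {D E G : Type*} [NormedAddCommGroup D] [NormedSpace ℂ D]
    [NormedAddCommGroup E] [NormedSpace ℂ E] [NormedAddCommGroup G] [NormedSpace ℂ G]
    {A : D → E →L[ℂ] G} {g : D → E} {x : D} (hA : AnalyticAt ℂ A x) (hg : AnalyticAt ℂ g x) :
    AnalyticAt ℂ (fun y => A y (g y)) x :=
  AnalyticAt.comp (f := fun y => (A y, g y)) (g := fun a : (E →L[ℂ] G) × E => a.1 a.2)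
    ((ContinuousLinearMap.id ℂ (E →L[ℂ] G)).analyticAt_bilinear _) (hA.prod hg)

/-- An injective analytic family of linear maps has an analytic left inverse. -/
theorem exists_analytic_leftInverse {V : Set (Fin n → ℂ)} (hV : IsOpen V)
    {e : (Fin n → ℂ) → (Fin N → ℂ) →L[ℂ] F} (he : AnalyticOnNhd ℂ e V) {x : Fin n → ℂ}
    (hx : x ∈ V) (hinj : Function.Injective (e x)) :
    ∃ V' : Set (Fin n → ℂ), IsOpen V' ∧ x ∈ V' ∧ V' ⊆ V ∧
      ∃ c : (Fin n → ℂ) → F →L[ℂ] (Fin N → ℂ), AnalyticOnNhd ℂ c V' ∧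
        ∀ y ∈ V', ∀ g, c y (e y g) = g := by
  obtain ⟨L, hL⟩ := LinearMap.exists_leftInverse_of_injective (e x : (Fin N → ℂ) →ₗ[ℂ] F)
    (LinearMap.ker_eq_bot.2 hinj)
  let L' : F →L[ℂ] (Fin N → ℂ) := LinearMap.toContinuousLinearMap L
  let A : (Fin n → ℂ) → (Fin N → ℂ) →L[ℂ] (Fin N → ℂ) := fun y => L'.comp (e y)
  have hA : AnalyticOnNhd ℂ A V := fun y hy => analyticAt_clm_of_apply fun w =>
    (L'.analyticAt _).comp (analyticAt_clm_eval (he y hy) w)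
  have hAx : A x = 1 := by
    ext1 w
    exact LinearMap.congr_fun hL w
  obtain ⟨V', hV'o, hxV', hV'V, hu, han⟩ :=
    exists_isOpen_analyticOnNhd_ringInverse hV hA hx (hAx ▸ isUnit_one)
  refine ⟨V', hV'o, hxV', hV'V, fun y => (Ring.inverse (A y)).comp L', fun y hy => ?_,
    fun y hy g => ?_⟩
  · exact analyticAt_clm_of_apply fun w => analyticAt_clm_eval (han y hy) (L' w)
  · exact DFunLike.congr_fun (Ring.inverse_mul_cancel _ (hu y hy)) g

theorem IsHolomorphicSubbundle.exists_frame {U : Set (Fin n → ℂ)}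
    {E : (Fin n → ℂ) → Submodule ℂ F} (h : IsHolomorphicSubbundle U E N) {x : Fin n → ℂ}
    (hx : x ∈ U) : ∃ V : Set (Fin n → ℂ), IsOpen V ∧ x ∈ V ∧ V ⊆ U ∧
      ∃ (e : (Fin n → ℂ) → (Fin N → ℂ) →L[ℂ] F) (c : (Fin n → ℂ) → F →L[ℂ] (Fin N → ℂ)),
        AnalyticOnNhd ℂ e V ∧ AnalyticOnNhd ℂ c V ∧ (∀ y ∈ V, ∀ g, c y (e y g) = g) ∧
          ∀ y ∈ V, ∀ w, w ∈ E y ↔ ∃ g, e y g = w := by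
  obtain ⟨V, hVo, hxV, hVU, b, hb, hbE⟩ := h x hx
  have he : AnalyticOnNhd ℂ (fun y => ofCoord fun j => b j y) V := fun y hy =>
    analyticAt_clm_of_apply fun w => by
      simp only [ofCoord_apply]
      exact Finset.analyticAt_fun_sum _ fun j _ => analyticAt_const.smul (hb j y hy)
  have hinj : Function.Injective (ofCoord fun j => b j x) := by
    refine (injective_iff_map_eq_zero _).2 fun g hg => ?_
    rw [ofCoord_apply] at hg
    exact funext (Fintype.linearIndependent_iff.1 (hbE x hxV).1 g hg)
  obtain ⟨V', hV'o, hxV', hV'V, c, hc, hce⟩ := exists_analytic_leftInverse hVo he hxV hinj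
  refine ⟨V', hV'o, hxV', hV'V.trans hVU, _, c, he.mono hV'V, hc, hce, fun y hy w => ?_⟩
  rw [← (hbE y (hV'V hy)).2, Submodule.mem_span_range_iff_exists_fun]
  simp only [ofCoord_apply]

/-- A projection with kernel S composed with f is locally zero, hence so is its derivative. -/
theorem fderiv_mem_of_forall_mem {S : Submodule ℂ F} {f : (Fin n → ℂ) → F} {x : Fin n → ℂ}
    (hf : DifferentiableAt ℂ f x) (h : ∀ᶠ y in 𝓝 x, f y ∈ S) (v : Fin n → ℂ) :
    fderiv ℂ f x v ∈ S := by
  obtain ⟨C, hC⟩ := Submodule.exists_isCompl S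
  let Q : F →L[ℂ] C := LinearMap.toContinuousLinearMap (C.projectionOnto S hC.symm)
  have hQ : ∀ w, Q w = 0 ↔ w ∈ S := fun w => by
    conv_rhs => rw [← Submodule.ker_projectionOnto hC.symm]
    rfl
  have h1 : (fun y => Q (f y)) =ᶠ[𝓝 x] fun _ => 0 := h.mono fun y hy => (hQ _).2 hy
  have h2 : fderiv ℂ (fun y => Q (f y)) x = Q.comp (fderiv ℂ f x) :=
    (Q.hasFDerivAt.comp x hf.hasFDerivAt).fderiv
  rw [← hQ, ← ContinuousLinearMap.comp_apply, ← h2, h1.fderiv_eq]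
  simp

end frames

/-! ### The tautological connection -/

namespace Web

variable {n d q p : ℕ} (W : Web n d q)

theorem jetExt_jetDeriv {r : ℕ} (x : Fin n → ℂ) (w : Jet d q p (r + 1)) (v : Fin n → ℂ)
    (i : Fin d) (A : IncIdx p q) (K : Multiset (Fin q)) :
    jetExt (W.jetDeriv x w v) i A K =
      ∑ α, jetExt w i A (α ::ₘ K) * fderiv ℂ (W.u i) x v α := by
  by_cases hK : K.card < r
  · rw [jetExt_eq rfl hK]
    refine Finset.sum_congr rfl fun α _ => ?_
    rw [jetExt_eq (Multiset.card_cons α K) (by omega)]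
    rfl
  · rw [jetExt_of_le _ _ _ (not_lt.1 hK)]
    refine (Finset.sum_eq_zero fun α _ => ?_).symm
    rw [jetExt_of_le _ _ _ (by rw [Multiset.card_cons]; omega), zero_mul]

theorem isClosedFamily_jetDeriv {r : ℕ} (x : Fin n → ℂ) {w : Jet d q p (r + 1)} (v : Fin n → ℂ)
    {i : Fin d} (hw : IsClosedFamily (jetExt w i)) :
    IsClosedFamily (jetExt (W.jetDeriv x w v) i) := by
  intro C K
  simp only [jetExt_jetDeriv, Finset.mul_sum]
  rw [Finset.sum_comm]
  refine Finset.sum_eq_zero fun α _ => ?_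
  rw [← zero_mul (fderiv ℂ (W.u i) x v α), ← hw C (α ::ₘ K), Finset.sum_mul]
  refine Finset.sum_congr rfl fun j _ => ?_
  rw [Multiset.cons_swap]
  ring

theorem isLinearMap_jetDeriv {r : ℕ} (x : Fin n → ℂ) (w : Jet d q p (r + 1)) :
    IsLinearMap ℂ (W.jetDeriv x w) where
  map_add a b := by
    funext h iAK
    simp [jetDeriv, mul_add, Finset.sum_add_distrib]
  map_smul c a := by
    funext h iAK
    simp [jetDeriv, Finset.mul_sum, mul_left_comm]

theorem jetDeriv_add {r : ℕ} (x : Fin n → ℂ) (w w' : Jet d q p (r + 1)) (v : Fin n → ℂ) :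
    W.jetDeriv x (w + w') v = W.jetDeriv x w v + W.jetDeriv x w' v := by
  funext h iAK
  simp [jetDeriv, add_mul, Finset.sum_add_distrib]

theorem jetDeriv_smul {r : ℕ} (x : Fin n → ℂ) (c : ℂ) (w : Jet d q p (r + 1)) (v : Fin n → ℂ) :
    W.jetDeriv x (c • w) v = c • W.jetDeriv x w v := by
  funext h iAK
  simp [jetDeriv, Finset.mul_sum, mul_assoc]

theorem isLinearMap_nabla (κ : RelKind) {r : ℕ} (s : (Fin n → ℂ) → Jet d q p r) (x : Fin n → ℂ) :
    IsLinearMap ℂ (W.nabla κ p r s x) where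
  map_add a b := by
    rw [nabla, (W.isLinearMap_jetDeriv x _).map_add, map_add, nabla, nabla]
    abel
  map_smul c a := by
    rw [nabla, (W.isLinearMap_jetDeriv x _).map_smul, map_smul, nabla, smul_sub]

theorem jetExt_fderiv {r : ℕ} {s : (Fin n → ℂ) → Jet d q p r} {x : Fin n → ℂ}
    (hs : DifferentiableAt ℂ s x) (v : Fin n → ℂ) (i : Fin d) (A : IncIdx p q)
    (K : Multiset (Fin q)) : HasFDerivAt (fun y => jetExt (s y) i A K)
      (fderiv ℂ (fun y => jetExt (s y) i A K) x) x ∧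
      fderiv ℂ (fun y => jetExt (s y) i A K) x v = jetExt (fderiv ℂ s x v) i A K := by
  by_cases hK : K.card < r
  · let P : Jet d q p r →L[ℂ] ℂ := (ContinuousLinearMap.proj (R := ℂ)
      (φ := fun _ : SymbIdx d q p K.card => ℂ) (i, A, ⟨K, rfl⟩)).comp
        (ContinuousLinearMap.proj (R := ℂ) (φ := fun h : Fin r => Symb d q p h) ⟨K.card, hK⟩)
    have h1 : (fun y => jetExt (s y) i A K) = fun y => P (s y) := by
      funext y
      exact jetExt_eq rfl hK
    have h2 := P.hasFDerivAt.comp x hs.hasFDerivAt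
    rw [h1, jetExt_eq rfl hK]
    exact ⟨h2.differentiableAt.hasFDerivAt, DFunLike.congr_fun h2.fderiv v⟩
  · have h1 : (fun y => jetExt (s y) i A K) = fun _ => 0 := by
      funext y
      exact jetExt_of_le _ _ _ (not_lt.1 hK)
    rw [h1, jetExt_of_le _ _ _ (not_lt.1 hK)]
    exact ⟨(hasFDerivAt_const _ _).differentiableAt.hasFDerivAt, by simp⟩

/-- The derivative of the derived equations along a section. -/
theorem fderiv_eqs {r : ℕ} {s : (Fin n → ℂ) → Jet d q p r} {x : Fin n → ℂ} (hx : x ∈ W.U)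
    (hs : DifferentiableAt ℂ s x) (B : IncIdx p n) (L : List (Fin n)) (v : Fin n → ℂ) :
    fderiv ℂ (fun y => W.eqs r (jetExt (s y)) B L y) x v =
      (∑ i, ∑ A, ∑ h ∈ Finset.range r, ∑ K : Sym (Fin q) h,
        fderiv ℂ (coef (W.u i) (W.jac i A B) L K) x v * jetExt (s x) i A K) +
      W.eqs r (jetExt (fderiv ℂ s x v)) B L x := by
  have hterm : ∀ i A (K : Multiset (Fin q)), HasFDerivAt
      (fun y => coef (W.u i) (W.jac i A B) L K y * jetExt (s y) i A K) _ x := fun i A K =>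
    (analyticAt_coef (W.holomorphic_u i x hx) (W.analyticAt_jac i A B hx) L
      K).differentiableAt.hasFDerivAt.mul (jetExt_fderiv hs v i A K).1
  have hsum : HasFDerivAt (fun y => W.eqs r (jetExt (s y)) B L y) _ x :=
    HasFDerivAt.fun_sum fun i _ => HasFDerivAt.fun_sum fun A _ => HasFDerivAt.fun_sum fun h _ =>
      HasFDerivAt.fun_sum fun K _ => hterm i A K
  rw [hsum.fderiv]
  simp only [sum_apply, add_apply, smul_apply, smul_eq_mul, (jetExt_fderiv hs v _ _ _).2,
    Finset.sum_add_distrib, eqs, evalCoef]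
  rw [add_comm]
  congr 1
  refine Finset.sum_congr rfl fun i _ => Finset.sum_congr rfl fun A _ =>
    Finset.sum_congr rfl fun h _ => Finset.sum_congr rfl fun K _ => mul_comm _ _

/-- The recursion for the coefficients, split so that the first sum is the one of `fderiv_eqs`: the
two can then be subtracted. -/
theorem eqs_cons {r : ℕ} (w : Jet d q p (r + 1)) (B : IncIdx p n) (l : Fin n) {L : List (Fin n)}
    (hL : L.length < r) (x : Fin n → ℂ) : W.eqs (r + 1) (jetExt w) B (l :: L) x =
      (∑ i, ∑ A, ∑ h ∈ Finset.range r, ∑ K : Sym (Fin q) h,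
        fderiv ℂ (coef (W.u i) (W.jac i A B) L K) x (Pi.single l 1) * jetExt w.proj i A K) +
      W.eqs r (jetExt (W.jetDeriv x w (Pi.single l 1))) B L x := by
  simp only [eqs, evalCoef_cons, ← Finset.sum_add_distrib]
  refine Finset.sum_congr rfl fun i _ => Finset.sum_congr rfl fun A _ => ?_
  congr 1
  · rw [Finset.sum_range_succ, Finset.sum_eq_zero (s := (Finset.univ : Finset (Sym (Fin q) r))),
      add_zero]
    · refine Finset.sum_congr rfl fun h hh => Finset.sum_congr rfl fun K _ => ?_
      have hK : (K : Multiset (Fin q)).card = h := K.2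
      rw [jetExt_proj _ _ _ (by simpa [hK] using hh)]
    · intro K _
      have hK : (K : Multiset (Fin q)).card = r := K.2
      rw [coef_eq_zero (W.u i) (W.jac i A B) (hL.trans_eq hK.symm)]
      simp
  · simp only [evalCoef, jetExt_jetDeriv, Finset.sum_mul, Finset.mul_sum]
    rw [Finset.sum_comm]
    refine Finset.sum_congr rfl fun h _ => ?_
    rw [Finset.sum_comm]
    refine Finset.sum_congr rfl fun K _ => Finset.sum_congr rfl fun α _ => ?_
    ring

/-- The equation of index L holds along s, so its derivative in the direction l is zero; the
equation of index L + 1_l holds for w. Both contain the same sum of derivatives of coefficients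
times entries of s x, and their difference is the equation of index L for the derivative of s minus
`jetDeriv`. -/
theorem fderiv_sub_jetDeriv_mem {κ : RelKind} {r : ℕ} {s : (Fin n → ℂ) → Jet d q p r}
    {x : Fin n → ℂ} (hx : x ∈ W.U) (hs : DifferentiableAt ℂ s x)
    (hR : ∀ᶠ y in 𝓝 x, s y ∈ W.R κ p r y) {w : Jet d q p (r + 1)}
    (hw : w ∈ W.R κ p (r + 1) x) (hws : w.proj = s x) (v : Fin n → ℂ) :
    fderiv ℂ s x v - W.jetDeriv x w v ∈ W.R κ p r x := by
  -- Linearity in v reduces the claim to coordinate directions, in which the recursion for `coef` is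
  -- written.
  have hlin : ∀ v, fderiv ℂ s x v - W.jetDeriv x w v =
      ∑ l, v l • (fderiv ℂ s x (Pi.single l 1) - W.jetDeriv x w (Pi.single l 1)) := by
    intro v
    have h1 := fderiv_eq_sum_single (LinearMap.toContinuousLinearMap
      ((W.isLinearMap_jetDeriv x w).mk' _)) v
    have h2 := fderiv_eq_sum_single (fderiv ℂ s x) v
    simp only [LinearMap.coe_toContinuousLinearMap', IsLinearMap.mk'_apply] at h1
    rw [h1, h2]
    simp only [smul_sub, Finset.sum_sub_distrib]
  rw [hlin]
  refine Submodule.sum_mem _ fun l _ => Submodule.smul_mem _ _ ?_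
  have hw' := W.mem_R_iff.1 hw
  refine ⟨fun h => sub_mem ?_ ?_, fun l' => ?_⟩
  · let P : Jet d q p r →L[ℂ] Symb d q p h :=
      ContinuousLinearMap.proj (R := ℂ) (φ := fun h : Fin r => Symb d q p h) h
    have h1 : fderiv ℂ (fun y => P (s y)) x = P.comp (fderiv ℂ s x) :=
      (P.hasFDerivAt.comp x hs.hasFDerivAt).fderiv
    have h2 := fderiv_mem_of_forall_mem (S := symbols κ d q p h) (f := fun y => P (s y))
      (P.differentiableAt.comp x hs) (hR.mono fun y hy => hy.1 h) (Pi.single l 1)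
    rw [h1] at h2
    exact h2
  · exact forall_mem_symbols_iff.2
      (fun hκ i => W.isClosedFamily_jetDeriv x _ (hw'.1 hκ i)) h
  · ext ⟨B, L⟩
    have hL : ((L : Multiset (Fin n)).sort (· ≤ ·)).length = l' := by
      rw [Multiset.length_sort]
      exact L.2
    -- The list with l in front need not be sorted; the equation for its sorted rearrangement is one
    -- of those defining `R`, and |L| + 1 < r + 1.
    have h1 : W.eqs (r + 1) (jetExt w) B (l :: (L : Multiset (Fin n)).sort (· ≤ ·)) x = 0 := by
      rw [W.eqs_perm (L' := (l ::ₘ (L : Multiset (Fin n))).sort (· ≤ ·)) ?_ hx]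
      · refine hw'.2 B _ ?_
        have hL' : (L : Multiset (Fin n)).card = l' := L.2
        have := l'.2
        rw [Multiset.card_cons]
        omega
      · rw [← Multiset.coe_eq_coe, ← Multiset.cons_coe, Multiset.sort_eq, Multiset.sort_eq]
    have h2 : (fun y => W.eqs r (jetExt (s y)) B ((L : Multiset (Fin n)).sort (· ≤ ·)) y)
        =ᶠ[𝓝 x] fun _ => 0 := hR.mono fun y hy =>
      (W.mem_R_iff.1 hy).2 B L (lt_of_eq_of_lt L.2 l'.2)
    have h3 := W.fderiv_eqs hx hs B ((L : Multiset (Fin n)).sort (· ≤ ·)) (Pi.single l 1)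
    rw [h2.fderiv_eq] at h3
    rw [W.eqs_cons w B l (hL.trans_lt l'.2), hws] at h1
    have h4 : ∀ t : Jet d q p r, (∑ h : Fin r, (W.block p l' h x).mulVec (t h)) (B, L) =
        W.eqs r (jetExt t) B ((L : Multiset (Fin n)).sort (· ≤ ·)) x := fun t =>
      W.sum_block_mulVec t le_rfl x B L
    have h5 : ∑ h : Fin r, (W.block p l' h x).mulVec
        ((fderiv ℂ s x (Pi.single l 1) - W.jetDeriv x w (Pi.single l 1)) h) =
        ∑ h : Fin r, (W.block p l' h x).mulVec (fderiv ℂ s x (Pi.single l 1) h) -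
        ∑ h : Fin r, (W.block p l' h x).mulVec (W.jetDeriv x w (Pi.single l 1) h) := by
      simp only [Pi.sub_apply, Matrix.mulVec_sub, Finset.sum_sub_distrib]
    rw [h5, Pi.sub_apply, h4, h4]
    have h6 : (fderiv ℂ (fun _ : Fin n → ℂ => (0 : ℂ)) x) (Pi.single l 1) = 0 := by simp
    rw [h6] at h3
    rw [Pi.zero_apply, sub_eq_zero]
    exact add_left_cancel (h3.symm.trans h1.symm)

/-! ### The lift of a section and the connection that it defines. -/

section connection

variable {W} {κ : RelKind} {r N : ℕ} (hb : ∀ x ∈ W.U, Set.BijOn Jet.proj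
  (W.R κ p (r + 1) x : Set (Jet d q p (r + 1))) (W.R κ p r x : Set (Jet d q p r)))
  (hE : IsHolomorphicSubbundle W.U (W.R κ p (r + 1)) N)
include hb

theorem lift_mem {x : Fin n → ℂ} (hx : x ∈ W.U) {w : Jet d q p r} (hw : w ∈ W.R κ p r x) :
    W.lift κ p r x w ∈ W.R κ p (r + 1) x :=
  Function.invFunOn_mem ((hb x hx).surjOn hw)

theorem proj_lift {x : Fin n → ℂ} (hx : x ∈ W.U) {w : Jet d q p r} (hw : w ∈ W.R κ p r x) :
    (W.lift κ p r x w).proj = w :=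
  Function.invFunOn_eq ((hb x hx).surjOn hw)

theorem lift_proj {x : Fin n → ℂ} (hx : x ∈ W.U) {w : Jet d q p (r + 1)}
    (hw : w ∈ W.R κ p (r + 1) x) : W.lift κ p r x w.proj = w :=
  (hb x hx).injOn (lift_mem hb hx (W.proj_mem hw)) hw (proj_lift hb hx (W.proj_mem hw))

theorem lift_add {x : Fin n → ℂ} (hx : x ∈ W.U) {w w' : Jet d q p r} (hw : w ∈ W.R κ p r x)
    (hw' : w' ∈ W.R κ p r x) :
    W.lift κ p r x (w + w') = W.lift κ p r x w + W.lift κ p r x w' := by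
  have h := lift_proj hb hx (add_mem (lift_mem hb hx hw) (lift_mem hb hx hw'))
  rw [← h, show (W.lift κ p r x w + W.lift κ p r x w').proj = _ from map_add (projL d q p r) _ _]
  change _ = W.lift κ p r x ((W.lift κ p r x w).proj + (W.lift κ p r x w').proj)
  rw [proj_lift hb hx hw, proj_lift hb hx hw']

theorem lift_smul {x : Fin n → ℂ} (hx : x ∈ W.U) (c : ℂ) {w : Jet d q p r}
    (hw : w ∈ W.R κ p r x) : W.lift κ p r x (c • w) = c • W.lift κ p r x w := by
  have h := lift_proj hb hx (Submodule.smul_mem _ c (lift_mem hb hx hw))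
  rw [← h, show (c • W.lift κ p r x w).proj = _ from map_smul (projL d q p r) c _]
  change _ = W.lift κ p r x (c • (W.lift κ p r x w).proj)
  rw [proj_lift hb hx hw]

-- In a frame e of the upper bundle, projection ∘ e is injective and has an analytic left inverse
-- c'; the lift is then e ∘ c'.
include hE in
theorem analyticOnNhd_lift {V : Set (Fin n → ℂ)} (hV : IsOpen V) (hVU : V ⊆ W.U)
    {s : (Fin n → ℂ) → Jet d q p r} (hs : W.IsSection κ p r V s) :
    AnalyticOnNhd ℂ (fun y => W.lift κ p r y (s y)) V := by
  intro x hx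
  obtain ⟨V', hV'o, hxV', hV'U, e, c, he, hc, hce, heE⟩ := hE.exists_frame (hVU hx)
  let P : Jet d q p (r + 1) →L[ℂ] Jet d q p r := LinearMap.toContinuousLinearMap (projL d q p r)
  have hPe : AnalyticOnNhd ℂ (fun y => P.comp (e y)) V' := fun y hy =>
    analyticAt_clm_of_apply fun w => (P.analyticAt _).comp (analyticAt_clm_eval (he y hy) w)
  have hinj : Function.Injective (P.comp (e x)) := by
    intro a b hab
    have h1 := (hb x (hVU hx)).injOn ((heE x hxV' _).2 ⟨a, rfl⟩) ((heE x hxV' _).2 ⟨b, rfl⟩) hab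
    rw [← hce x hxV' a, h1, hce x hxV']
  obtain ⟨V'', hV''o, hxV'', hV''V', c', hc', hc'e⟩ :=
    exists_analytic_leftInverse hV'o hPe hxV' hinj
  have key : (fun y => e y (c' y (s y))) =ᶠ[𝓝 x] fun y => W.lift κ p r y (s y) := by
    filter_upwards [hV''o.mem_nhds hxV'', hV.mem_nhds hx] with y hy hyV
    obtain ⟨w, hw, hws⟩ := (hb y (hVU hyV)).surjOn (hs.2 y hyV)
    obtain ⟨g, rfl⟩ := (heE y (hV''V' hy) w).1 hw
    have h1 : c' y (s y) = g := by
      rw [← hc'e y hy g]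
      exact congrArg _ hws.symm
    rw [h1, ← hws, lift_proj hb (hVU hyV) hw]
  refine AnalyticAt.congr ?_ key
  exact analyticAt_clm_apply (he x hxV') (analyticAt_clm_apply (hc' x hxV'') (hs.1 x hx))

include hE in
theorem isSection_nabla {V : Set (Fin n → ℂ)} (hV : IsOpen V) (hVU : V ⊆ W.U)
    {s : (Fin n → ℂ) → Jet d q p r} (hs : W.IsSection κ p r V s) (v : Fin n → ℂ) :
    W.IsSection κ p r V fun x => W.nabla κ p r s x v := by
  refine ⟨fun x hx => ?_, fun x hx => ?_⟩
  · refine (analyticAt_clm_eval (hs.1 x hx).fderiv v).sub (AnalyticAt.pi fun h =>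
      AnalyticAt.pi fun iAK => Finset.analyticAt_fun_sum _ fun α _ => AnalyticAt.mul ?_ ?_)
    · exact (((ContinuousLinearMap.proj (R := ℂ)
        (φ := fun _ : SymbIdx d q p h.succ => ℂ) (iAK.1, iAK.2.1, α ::ₛ iAK.2.2)).comp
          (ContinuousLinearMap.proj (R := ℂ)
            (φ := fun h : Fin (r + 1) => Symb d q p h) h.succ)).analyticAt _).comp
        (analyticOnNhd_lift hb hE hV hVU hs x hx)
    · exact ((ContinuousLinearMap.proj (R := ℂ) (φ := fun _ : Fin q => ℂ) α).analyticAt _).comp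
        (analyticAt_clm_eval (W.holomorphic_u iAK.1 x (hVU hx)).fderiv v)
  · exact W.fderiv_sub_jetDeriv_mem (hVU hx) (hs.1 x hx).differentiableAt
      (by filter_upwards [hV.mem_nhds hx] with y hy using hs.2 y hy)
      (lift_mem hb (hVU hx) (hs.2 x hx)) (proj_lift hb (hVU hx) (hs.2 x hx)) v

include hE in
theorem isHolomorphicConnection : W.IsHolomorphicConnection κ p r where
  linear s x := W.isLinearMap_nabla κ s x
  isSection V hV hVU s hs v := isSection_nabla hb hE hV hVU hs v
  add V hV hVU s t hs ht x hx v := by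
    rw [nabla, nabla, nabla, lift_add hb (hVU hx) (hs.2 x hx) (ht.2 x hx), jetDeriv_add,
      fderiv_fun_add (hs.1 x hx).differentiableAt (ht.1 x hx).differentiableAt, add_apply]
    abel
  leibniz V hV hVU s hs f hf x hx v := by
    rw [nabla, nabla, lift_smul hb (hVU hx) _ (hs.2 x hx), jetDeriv_smul,
      fderiv_fun_smul (hf x hx).differentiableAt (hs.1 x hx).differentiableAt, add_apply,
      smul_apply, ContinuousLinearMap.smulRight_apply, smul_sub]
    abel

end connection

end Web

/-! ### Abelian relations and their jets -/

namespace Web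

variable {n d q p : ℕ} (W : Web n d q)

/-- Submersions are open, so a property holding at the points u_i(y) for y near x holds on a whole
neighbourhood of u_i(x). -/
theorem map_nhds_u (i : Fin d) {x : Fin n → ℂ} (hx : x ∈ W.U) :
    map (W.u i) (𝓝 x) = 𝓝 (W.u i x) :=
  (W.holomorphic_u i x hx).hasStrictFDerivAt.map_nhds_eq_of_surj
    (LinearMap.range_eq_top.2 (W.submersion_u i x hx))

theorem eventually_of_eventually_u {i : Fin d} {x : Fin n → ℂ} (hx : x ∈ W.U)
    {P : (Fin q → ℂ) → Prop} (h : ∀ᶠ y in 𝓝 x, P (W.u i y)) : ∀ᶠ z in 𝓝 (W.u i x), P z := by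
  rw [← W.map_nhds_u i hx]
  exact h

theorem eq_of_comp_eq {i : Fin d} {x : Fin n → ℂ} (hx : x ∈ W.U) {k : ℕ} {η η' : Form q k}
    (h : η.compContinuousLinearMap (fderiv ℂ (W.u i) x) =
      η'.compContinuousLinearMap (fderiv ℂ (W.u i) x)) : η = η' := by
  ext m
  choose g hg using W.submersion_u i x hx
  have h1 := DFunLike.congr_fun h fun j => g (m j)
  simpa only [ContinuousAlternatingMap.compContinuousLinearMap_apply, Function.comp_def, hg]
    using h1

/-- Near `x`, the forms `ω_i` are the pull-backs of the forms with coefficients `f_{i,A}`. -/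
structure HasCoeffs (ω : (Fin n → ℂ) → Fin d → Form n p)
    (f : Fin d → IncIdx p q → (Fin q → ℂ) → ℂ) (x : Fin n → ℂ) : Prop where
  analyticAt : ∀ i A, AnalyticAt ℂ (f i A) (W.u i x)
  eventually_eq : ∀ i, ∀ᶠ y in 𝓝 x, ω y i = W.pull i (f i) y

/-- The jet at `x` of the family of forms with coefficients `f_{i,A}`. -/
def jetOf (r : ℕ) (f : Fin d → IncIdx p q → (Fin q → ℂ) → ℂ) (x : Fin n → ℂ) : Jet d q p r :=
  fun _ iAK => partialD (f iAK.1 iAK.2.1) iAK.2.2 (W.u iAK.1 x)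

theorem jetExt_jetOf {r : ℕ} (f : Fin d → IncIdx p q → (Fin q → ℂ) → ℂ) (x : Fin n → ℂ)
    (i : Fin d) (A : IncIdx p q) {K : Multiset (Fin q)} (hK : K.card < r) :
    jetExt (W.jetOf r f x) i A K = partialD (f i A) K (W.u i x) :=
  jetExt_eq rfl hK

theorem isJetAt_iff {r : ℕ} {ω : (Fin n → ℂ) → Fin d → Form n p} {x : Fin n → ℂ}
    {w : Jet d q p r} : W.IsJetAt r ω x w ↔ ∃ f, W.HasCoeffs ω f x ∧ w = W.jetOf r f x := by
  refine exists_congr fun f => ⟨fun h => ⟨⟨h.1, fun i => (h.2.1 i).mono fun y hy => ?_⟩, ?_⟩,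
    fun h => ⟨h.1.1, fun i => (h.1.2 i).mono fun y hy m => ?_, ?_⟩⟩
  · ext m
    rw [hy, W.pull_apply]
  · funext h' ⟨i, A, K⟩
    exact h.2.2 h' i A K
  · rw [hy, W.pull_apply]
  · intro h' i A K
    rw [h.2]
    rfl

variable {W}

theorem HasCoeffs.eventually {ω : (Fin n → ℂ) → Fin d → Form n p}
    {f : Fin d → IncIdx p q → (Fin q → ℂ) → ℂ} {x : Fin n → ℂ} (h : W.HasCoeffs ω f x)
    (hx : x ∈ W.U) : ∀ᶠ y in 𝓝 x, W.HasCoeffs ω f y := by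
  have h1 : ∀ᶠ y in 𝓝 x, ∀ i A, AnalyticAt ℂ (f i A) (W.u i y) :=
    eventually_all.2 fun i => eventually_all.2 fun A =>
      (W.holomorphic_u i x hx).continuousAt.eventually (h.1 i A).eventually_analyticAt
  have h2 : ∀ᶠ y in 𝓝 x, ∀ i, ∀ᶠ z in 𝓝 y, ω z i = W.pull i (f i) z :=
    eventually_all.2 fun i => (h.2 i).eventually_nhds
  filter_upwards [h1, h2] with y h1 h2 using ⟨h1, h2⟩

theorem coeff_eq_of_pull_eq {i : Fin d} {x : Fin n → ℂ} (hx : x ∈ W.U)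
    {f f' : IncIdx p q → (Fin q → ℂ) → ℂ} (h : W.pull i f x = W.pull i f' x) (A : IncIdx p q) :
    f A (W.u i x) = f' A (W.u i x) := by
  rw [← famForm_coordVec f, ← famForm_coordVec f', W.eq_of_comp_eq hx h]

theorem HasCoeffs.eventuallyEq {ω : (Fin n → ℂ) → Fin d → Form n p}
    {f f' : Fin d → IncIdx p q → (Fin q → ℂ) → ℂ} {x : Fin n → ℂ} (h : W.HasCoeffs ω f x)
    (h' : W.HasCoeffs ω f' x) (hx : x ∈ W.U) (i : Fin d) (A : IncIdx p q) :
    f i A =ᶠ[𝓝 (W.u i x)] f' i A := by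
  refine W.eventually_of_eventually_u hx ?_
  filter_upwards [h.2 i, h'.2 i, W.isOpen_U.mem_nhds hx] with y h1 h2 hy
  exact coeff_eq_of_pull_eq hy (h1.symm.trans h2) A

theorem HasCoeffs.jetOf_eq {ω : (Fin n → ℂ) → Fin d → Form n p}
    {f f' : Fin d → IncIdx p q → (Fin q → ℂ) → ℂ} {x : Fin n → ℂ} (h : W.HasCoeffs ω f x)
    (h' : W.HasCoeffs ω f' x) (hx : x ∈ W.U) (r : ℕ) : W.jetOf r f x = W.jetOf r f' x := by
  funext k iAK
  exact (partialD_congr (h.eventuallyEq h' hx iAK.1 iAK.2.1) _).self_of_nhds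

theorem IsJetAt.unique {r : ℕ} {ω : (Fin n → ℂ) → Fin d → Form n p} {x : Fin n → ℂ}
    (hx : x ∈ W.U) {w w' : Jet d q p r} (h : W.IsJetAt r ω x w) (h' : W.IsJetAt r ω x w') :
    w = w' := by
  obtain ⟨f, hf, rfl⟩ := W.isJetAt_iff.1 h
  obtain ⟨f', hf', rfl⟩ := W.isJetAt_iff.1 h'
  exact hf.jetOf_eq hf' hx r

theorem partialD_linear {r : ℕ} {f g : (Fin r → ℂ) → ℂ} {y : Fin r → ℂ} (hf : AnalyticAt ℂ f y)
    (hg : AnalyticAt ℂ g y) (a b : ℂ) (K : Multiset (Fin r)) :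
    partialD (fun z => a * f z + b * g z) K y = a * partialD f K y + b * partialD g K y := by
  have h := (partialDeriv_sum (Finset.univ : Finset (Fin 2)) ![a, b] (F := ![f, g])
    (fun i _ => by fin_cases i; exacts [hf, hg]) (K.sort (· ≤ ·))).self_of_nhds
  simp only [Fin.sum_univ_two] at h
  exact h

theorem HasCoeffs.linear {ω ω' : (Fin n → ℂ) → Fin d → Form n p}
    {f f' : Fin d → IncIdx p q → (Fin q → ℂ) → ℂ} {x : Fin n → ℂ} (h : W.HasCoeffs ω f x)
    (h' : W.HasCoeffs ω' f' x) (a b : ℂ) :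
    W.HasCoeffs (a • ω + b • ω') (fun i A z => a * f i A z + b * f' i A z) x where
  analyticAt i A := (analyticAt_const.mul (h.1 i A)).add (analyticAt_const.mul (h'.1 i A))
  eventually_eq i := by
    filter_upwards [h.2 i, h'.2 i] with y h1 h2
    ext m
    simp only [Pi.add_apply, Pi.smul_apply, h1, h2, ContinuousAlternatingMap.add_apply,
      ContinuousAlternatingMap.smul_apply, pull_apply, smul_eq_mul, Finset.mul_sum,
      ← Finset.sum_add_distrib]
    refine Finset.sum_congr rfl fun A _ => ?_
    ring

theorem IsJetAt.linear {r : ℕ} {ω ω' : (Fin n → ℂ) → Fin d → Form n p} {x : Fin n → ℂ}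
    {w w' : Jet d q p r} (h : W.IsJetAt r ω x w) (h' : W.IsJetAt r ω' x w') (a b : ℂ) :
    W.IsJetAt r (a • ω + b • ω') x (a • w + b • w') := by
  obtain ⟨f, hf, rfl⟩ := W.isJetAt_iff.1 h
  obtain ⟨f', hf', rfl⟩ := W.isJetAt_iff.1 h'
  refine W.isJetAt_iff.2 ⟨_, hf.linear hf' a b, ?_⟩
  funext k iAK
  exact (partialD_linear (hf.1 _ _) (hf'.1 _ _) a b _).symm

theorem IsAbelian.exists_hasCoeffs {κ : RelKind} {V : Set (Fin n → ℂ)} (hV : IsOpen V)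
    (hVU : V ⊆ W.U) {ω : (Fin n → ℂ) → Fin d → Form n p} (h : W.IsAbelian κ p V ω)
    {x : Fin n → ℂ} (hx : x ∈ V) : ∃ f, W.HasCoeffs ω f x := by
  have h1 : ∀ i, ∃ η : (Fin q → ℂ) → Form q p, AnalyticAt ℂ η (W.u i x) ∧ ∀ᶠ y in 𝓝 x,
      ω y i = (η (W.u i y)).compContinuousLinearMap (fderiv ℂ (W.u i) y) := fun i =>
    exists_eq_pullback_of_basic (W.holomorphic_u i x (hVU hx)) (W.submersion_u i x (hVU hx))
      ((h.basic i).1 x hx)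
      (by filter_upwards [hV.mem_nhds hx] with y hy using (h.basic i).2 y hy)
      (by filter_upwards [hV.mem_nhds hx] with y hy using (h.basic i).3 y hy)
  choose η hη hωη using h1
  refine ⟨fun i A z => η i z (coordVec A), fun i A => analyticAt_form_eval (hη i) _, fun i => ?_⟩
  filter_upwards [hωη i] with y hy
  rw [hy, pull]
  congr 1
  exact form_eq_sum _

/-- The equations are the derivatives of the identity that the trace is zero. In the closed case the
forms on the targets are closed because pull-back by a submersion is injective, and the Koszul
relations are the derivatives of this closedness. -/
theorem IsAbelian.jetOf_mem {κ : RelKind} {V : Set (Fin n → ℂ)} (hV : IsOpen V)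
    (hVU : V ⊆ W.U) {ω : (Fin n → ℂ) → Fin d → Form n p} (h : W.IsAbelian κ p V ω)
    {x : Fin n → ℂ} (hx : x ∈ V) {f : Fin d → IncIdx p q → (Fin q → ℂ) → ℂ}
    (hf : W.HasCoeffs ω f x) (r : ℕ) : W.jetOf r f x ∈ W.R κ p r x := by
  refine W.mem_R_iff.2 ⟨fun hκ i C K => ?_, fun B L hL => ?_⟩
  · by_cases hK : K.card + 1 < r
    · have hd : ∀ᶠ z in 𝓝 (W.u i x), extDeriv (famForm (f i)) z = 0 := by
        refine W.eventually_of_eventually_u (hVU hx) ?_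
        filter_upwards [hf.eventually (hVU hx), hV.mem_nhds hx] with y hfy hy
        have h1 : extDeriv (W.pull i (f i)) y = 0 := by
          rw [← h.closed hκ i y hy]
          exact (Filter.EventuallyEq.extDeriv_eq (hfy.2 i)).symm
        rw [W.extDeriv_pull i (hVU hy) (hfy.1 i)] at h1
        refine W.eq_of_comp_eq (hVU hy) (h1.trans ?_)
        ext m
        simp
      have h2 := sum_partialD_of_closed (analyticAt_famForm (hf.1 i)) hd C K
      simp only [famForm_coordVec] at h2
      rw [← h2]
      exact Finset.sum_congr rfl fun j _ => congrArg _
        (W.jetExt_jetOf f x i _ (by rw [Multiset.card_cons]; exact hK))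
    · refine Finset.sum_eq_zero fun j _ => ?_
      rw [jetExt_of_le _ _ _ (by rw [Multiset.card_cons]; omega), mul_zero]
  · have h1 := (W.partialDeriv_trace (hVU hx) hf.1 B (L := L.sort (· ≤ ·)) (N := r)
      (by simpa using hL)).self_of_nhds
    have h2 : (fun y => ∑ i, W.pull i (f i) y (coordVec B)) =ᶠ[𝓝 x] fun _ => 0 := by
      filter_upwards [eventually_all.2 hf.2, hV.mem_nhds hx] with y hy hyV
      have h3 := DFunLike.congr_fun (h.trace_zero y hyV) (coordVec B)
      rw [ContinuousAlternatingMap.sum_apply] at h3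
      simp only [hy] at h3
      exact h3
    have h4 := (partialDeriv_congr h2 (L.sort (· ≤ ·))).self_of_nhds
    rw [partialDeriv_zero] at h4
    refine Eq.trans ?_ (h1.symm.trans h4)
    exact W.eqs_congr fun i A K hK => W.jetExt_jetOf f x i A hK

theorem analyticAt_jetOf {f : Fin d → IncIdx p q → (Fin q → ℂ) → ℂ} {x : Fin n → ℂ}
    (hx : x ∈ W.U) (hf : ∀ i A, AnalyticAt ℂ (f i A) (W.u i x)) (r : ℕ) :
    AnalyticAt ℂ (W.jetOf r f) x :=
  AnalyticAt.pi fun _ => AnalyticAt.pi fun iAK =>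
    AnalyticAt.comp (g := partialD (f iAK.1 iAK.2.1) iAK.2.2)
      (analyticAt_partialD (hf _ _) _) (W.holomorphic_u iAK.1 x hx)

theorem fderiv_partialD_comp {f : (Fin q → ℂ) → ℂ} {i : Fin d} {x : Fin n → ℂ}
    (hx : x ∈ W.U) (hf : AnalyticAt ℂ f (W.u i x)) (K : Multiset (Fin q)) (v : Fin n → ℂ) :
    fderiv ℂ (fun y => partialD f K (W.u i y)) x v =
      ∑ α, partialD f (α ::ₘ K) (W.u i x) * fderiv ℂ (W.u i) x v α := by
  have h1 := ((analyticAt_partialD hf K).differentiableAt.hasFDerivAt.comp x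
    (W.holomorphic_u i x hx).differentiableAt.hasFDerivAt).fderiv
  refine (DFunLike.congr_fun h1 v).trans ?_
  rw [ContinuousLinearMap.comp_apply, fderiv_eq_sum_single]
  refine Finset.sum_congr rfl fun α _ => ?_
  rw [(partialD_cons hf K α).self_of_nhds, smul_eq_mul, mul_comm]

theorem fderiv_jetOf {f : Fin d → IncIdx p q → (Fin q → ℂ) → ℂ} {x : Fin n → ℂ}
    (hx : x ∈ W.U) (hf : ∀ i A, AnalyticAt ℂ (f i A) (W.u i x)) (r : ℕ) (v : Fin n → ℂ) :
    fderiv ℂ (W.jetOf r f) x v = W.jetDeriv x (W.jetOf (r + 1) f x) v := by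
  have hd := (analyticAt_jetOf hx hf r).differentiableAt
  funext h ⟨i, A, K⟩
  have h1 := (jetExt_fderiv hd v i A K).2
  rw [jetExt_coe] at h1
  simp only [jetExt_coe] at h1
  rw [← h1]
  exact fderiv_partialD_comp hx (hf i A) K v

end Web

/-! ### Abelian relations are the parallel sections -/

namespace Web

variable {n d q p : ℕ} {W : Web n d q}

open Classical in
/-- The jet of a family of forms at a point where it exists, and zero elsewhere. -/
def jetAt (W : Web n d q) (r : ℕ) (V : Set (Fin n → ℂ)) (ω : (Fin n → ℂ) → Fin d → Form n p)
    (x : Fin n → ℂ) : Jet d q p r :=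
  if h : x ∈ V ∧ ∃ w, W.IsJetAt r ω x w then h.2.choose else 0

theorem jetAt_of_notMem {r : ℕ} {V : Set (Fin n → ℂ)} (ω : (Fin n → ℂ) → Fin d → Form n p)
    {x : Fin n → ℂ} (hx : x ∉ V) : W.jetAt r V ω x = 0 := dif_neg fun h => hx h.1

theorem jetAt_eq {r : ℕ} {V : Set (Fin n → ℂ)} (hVU : V ⊆ W.U)
    {ω : (Fin n → ℂ) → Fin d → Form n p} {x : Fin n → ℂ} (hx : x ∈ V) {w : Jet d q p r}
    (hw : W.IsJetAt r ω x w) : W.jetAt r V ω x = w := by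
  have h : x ∈ V ∧ ∃ w, W.IsJetAt r ω x w := ⟨hx, w, hw⟩
  rw [jetAt, dif_pos h]
  exact h.2.choose_spec.unique (hVU hx) hw

section correspondence

variable {κ : RelKind} {r : ℕ} {V : Set (Fin n → ℂ)} (hV : IsOpen V) (hVU : V ⊆ W.U)
include hV hVU

theorem isJetAt_jetAt {ω : (Fin n → ℂ) → Fin d → Form n p} (h : W.IsAbelian κ p V ω)
    {x : Fin n → ℂ} (hx : x ∈ V) : W.IsJetAt r ω x (W.jetAt r V ω x) := by
  obtain ⟨f, hf⟩ := h.exists_hasCoeffs hV hVU hx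
  have hw : W.IsJetAt r ω x (W.jetOf r f x) := W.isJetAt_iff.2 ⟨f, hf, rfl⟩
  rwa [jetAt_eq hVU hx hw]

theorem jetAt_eventuallyEq {ω : (Fin n → ℂ) → Fin d → Form n p} {x : Fin n → ℂ} (hx : x ∈ V)
    {f : Fin d → IncIdx p q → (Fin q → ℂ) → ℂ} (hf : W.HasCoeffs ω f x) :
    W.jetAt r V ω =ᶠ[𝓝 x] W.jetOf r f := by
  filter_upwards [hf.eventually (hVU hx), hV.mem_nhds hx] with y hfy hy
  exact jetAt_eq hVU hy (W.isJetAt_iff.2 ⟨f, hfy, rfl⟩)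

/-- The map `σ ↦ j^{r-1} σ`. -/
def jetMap (κ : RelKind) (p r : ℕ) : W.Ab κ p V →ₗ[ℂ] ((Fin n → ℂ) → Jet d q p r) where
  toFun σ := W.jetAt r V σ
  map_add' σ τ := by
    funext x
    by_cases hx : x ∈ V
    · have h := (isJetAt_jetAt (r := r) hV hVU σ.2.1 hx).linear
        (isJetAt_jetAt (r := r) hV hVU τ.2.1 hx) 1 1
      simp only [one_smul] at h
      exact jetAt_eq hVU hx h
    · rw [Pi.add_apply, jetAt_of_notMem _ hx, jetAt_of_notMem _ hx, jetAt_of_notMem _ hx, add_zero]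
  map_smul' c σ := by
    funext x
    by_cases hx : x ∈ V
    · have h := (isJetAt_jetAt (r := r) hV hVU σ.2.1 hx).linear
        (isJetAt_jetAt (r := r) hV hVU σ.2.1 hx) c 0
      have e : c • σ.1 + (0 : ℂ) • σ.1 = c • σ.1 := by
        funext y i
        ext m
        simp
      rw [e, zero_smul, add_zero] at h
      exact jetAt_eq hVU hx h
    · rw [Pi.smul_apply, jetAt_of_notMem _ hx, jetAt_of_notMem _ hx, smul_zero]

variable (hb : ∀ x ∈ W.U, Set.BijOn Jet.proj
  (W.R κ p (r + 1) x : Set (Jet d q p (r + 1))) (W.R κ p r x : Set (Jet d q p r)))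
include hb

/-- The next jet of the relation also lies in the space of formal relations and projects to the
given one; by bijectivity it is the lift. -/
theorem lift_jetOf {ω : (Fin n → ℂ) → Fin d → Form n p} (h : W.IsAbelian κ p V ω)
    {x : Fin n → ℂ} (hx : x ∈ V) {f : Fin d → IncIdx p q → (Fin q → ℂ) → ℂ}
    (hf : W.HasCoeffs ω f x) : W.lift κ p r x (W.jetOf r f x) = W.jetOf (r + 1) f x :=
  lift_proj hb (hVU hx) (h.jetOf_mem hV hVU hx hf (r + 1))

/-- The lift of a zero jet is zero, and the lifted jet always contains the entries of order 0, even
for r = 0 where the jet itself has no entry. -/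
theorem IsAbelian.eq_zero_of_jet {ω : (Fin n → ℂ) → Fin d → Form n p}
    (h : W.IsAbelian κ p V ω) {x : Fin n → ℂ} (hx : x ∈ V)
    (hj : W.IsJetAt r ω x (0 : Jet d q p r)) : ω x = 0 := by
  obtain ⟨f, hf, h1⟩ := W.isJetAt_iff.1 hj
  have h2 : W.jetOf (r + 1) f x = 0 := by
    -- The zero jet is rewritten as 0 • 0 so that homogeneity of the lift gives its value.
    rw [← lift_jetOf hV hVU hb h hx hf, ← h1, ← zero_smul ℂ (0 : Jet d q p r),
      lift_smul hb (hVU hx) 0 (zero_mem _), zero_smul]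
  have h3 : ∀ i A, f i A (W.u i x) = 0 := by
    intro i A
    have h4 := W.jetExt_jetOf f x i A (K := 0) (r := r + 1) (by simp)
    rw [h2, partialD_zero, jetExt_eq (h := 0) rfl (by omega)] at h4
    exact h4.symm
  funext i
  rw [(hf.2 i).self_of_nhds]
  ext m
  simp [pull_apply, h3]

theorem jetMap_injective : Function.Injective (jetMap hV hVU κ p r) := by
  refine (injective_iff_map_eq_zero _).2 fun σ hσ => Subtype.ext (funext fun x => ?_)
  by_cases hx : x ∈ V
  · refine σ.2.1.eq_zero_of_jet hV hVU hb hx ?_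
    have h1 := isJetAt_jetAt (r := r) hV hVU σ.2.1 hx
    rwa [show W.jetAt r V σ.1 x = 0 from congrFun hσ x] at h1
  · exact σ.2.2 x hx

theorem jetAt_mem {ω : (Fin n → ℂ) → Fin d → Form n p} (h : W.IsAbelian κ p V ω) :
    W.jetAt r V ω ∈ W.parallelSections κ p r V := by
  refine ⟨⟨fun x hx => ?_, fun x hx => ?_⟩, fun x hx v => ?_, fun x hx => jetAt_of_notMem _ hx⟩
  all_goals
    obtain ⟨f, hf⟩ := h.exists_hasCoeffs hV hVU hx
    have h1 : W.jetAt r V ω =ᶠ[𝓝 x] W.jetOf r f := jetAt_eventuallyEq hV hVU hx hf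
  · exact (analyticAt_jetOf (hVU hx) hf.1 r).congr h1.symm
  · rw [h1.self_of_nhds]
    exact h.jetOf_mem hV hVU hx hf r
  · rw [nabla, h1.fderiv_eq, h1.self_of_nhds, lift_jetOf hV hVU hb h hx hf,
      fderiv_jetOf (hVU hx) hf.1, sub_self]

/-- The coefficients of a parallel section, in the variables of the foliations. -/
theorem exists_coeffs_of_parallel {s : (Fin n → ℂ) → Jet d q p r}
    (hs : s ∈ W.parallelSections κ p r V) (hr : 0 < r) {x : Fin n → ℂ} (hx : x ∈ V) (i : Fin d)
    (A : IncIdx p q) : ∃ f : (Fin q → ℂ) → ℂ, AnalyticAt ℂ f (W.u i x) ∧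
      ∀ᶠ y in 𝓝 x, ∀ K : Multiset (Fin q), K.card ≤ r →
        jetExt (W.lift κ p r y (s y)) i A K = partialD f K (W.u i y) := by
  have hd : ∀ y ∈ V, ∀ (v : Fin n → ℂ) (K : Multiset (Fin q)),
      fderiv ℂ (fun z => jetExt (s z) i A K) y v =
        ∑ α, jetExt (W.lift κ p r y (s y)) i A (α ::ₘ K) * fderiv ℂ (W.u i) y v α := by
    intro y hy v K
    rw [(jetExt_fderiv (hs.1.1 y hy).differentiableAt v i A K).2, ← W.jetExt_jetDeriv,
      ← sub_eq_zero.1 (hs.2.1 y hy v)]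
  have hlow : ∀ y ∈ V, ∀ K : Multiset (Fin q), K.card < r →
      jetExt (W.lift κ p r y (s y)) i A K = jetExt (s y) i A K := by
    intro y hy K hK
    rw [← jetExt_proj _ _ _ hK, proj_lift hb (hVU hy) (hs.1.2 y hy)]
  have hg : AnalyticAt ℂ (fun y => jetExt (s y) i A 0) x := by
    have : (fun y => jetExt (s y) i A 0) = fun y => s y ⟨0, hr⟩ (i, A, ⟨0, rfl⟩) :=
      funext fun y => jetExt_eq rfl hr
    rw [this]
    exact (((ContinuousLinearMap.proj (R := ℂ)
      (φ := fun _ : SymbIdx d q p 0 => ℂ) (i, A, ⟨0, rfl⟩)).comp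
        (ContinuousLinearMap.proj (R := ℂ)
          (φ := fun h : Fin r => Symb d q p h) ⟨0, hr⟩)).analyticAt _).comp (hs.1.1 x hx)
  -- By `hd`, the derivative of the entry of order 0 vanishes on ker du_i, so this entry is a
  -- function of u_i.
  obtain ⟨f, hf, hgf⟩ := exists_eq_comp_of_fderiv_eq_zero (W.holomorphic_u i x (hVU hx))
    (W.submersion_u i x (hVU hx)) hg (by
      filter_upwards [hV.mem_nhds hx] with y hy v hv
      rw [hd y hy]
      simp [hv])
  refine ⟨f, hf, ?_⟩
  have hfe : ∀ᶠ y in 𝓝 x, AnalyticAt ℂ f (W.u i y) :=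
    (W.holomorphic_u i x (hVU hx)).continuousAt.eventually hf.eventually_analyticAt
  -- Induction on K, for all points y at once, so that the identity for K holds near y and can be
  -- differentiated.
  have key : ∀ K : Multiset (Fin q), K.card ≤ r → ∀ y ∈ V,
      (∀ᶠ z in 𝓝 y, jetExt (s z) i A 0 = f (W.u i z)) →
      (∀ᶠ z in 𝓝 y, AnalyticAt ℂ f (W.u i z)) →
        jetExt (W.lift κ p r y (s y)) i A K = partialD f K (W.u i y) := by
    intro K
    induction K using Multiset.induction_on with
    | empty =>
      intro _ y hy hgy _
      rw [hlow y hy 0 hr, partialD_zero]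
      exact hgy.self_of_nhds
    | cons a K ih =>
      intro hK y hy hgy hfy
      rw [Multiset.card_cons] at hK
      have h1 : (fun z => jetExt (s z) i A K) =ᶠ[𝓝 y] fun z => partialD f K (W.u i z) := by
        filter_upwards [hgy.eventually_nhds, hfy.eventually_nhds, hV.mem_nhds hy] with z h1 h2 hz
        rw [← hlow z hz K hK]
        exact ih (by omega) z hz h1 h2
      -- A direction v with du_i(v) = e_a isolates the index α = a in the two sums over α.
      obtain ⟨v, hv⟩ := W.submersion_u i y (hVU hy) (Pi.single a 1)
      have h2 := hd y hy v K
      rw [h1.fderiv_eq, fderiv_partialD_comp (hVU hy) hfy.self_of_nhds, hv] at h2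
      simpa [Pi.single_apply] using h2.symm
  filter_upwards [hgf.eventually_nhds, hfe.eventually_nhds, hV.mem_nhds hx] with y hgy hfy hy K hK
  exact key K hK y hy hgy hfy

-- The equation with L empty is the vanishing of the trace, and the Koszul relation with K = 0 is
-- closedness. The latter involves first derivatives, which belong to the r-jet because 0 < r.
omit hV hb in
theorem isAbelian_of_coeffs (hr : 0 < r) {ω : (Fin n → ℂ) → Fin d → Form n p}
    (h : ∀ x ∈ V, ∃ f, W.HasCoeffs ω f x ∧ W.jetOf (r + 1) f x ∈ W.R κ p (r + 1) x) :
    W.IsAbelian κ p V ω := by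
  have hpull : ∀ x ∈ V, ∀ f, W.HasCoeffs ω f x → ∀ i, extDeriv (fun y => ω y i) x =
      (extDeriv (famForm (f i)) (W.u i x)).compContinuousLinearMap (fderiv ℂ (W.u i) x) := by
    intro x hx f hf i
    rw [← W.extDeriv_pull i (hVU hx) (hf.1 i)]
    exact Filter.EventuallyEq.extDeriv_eq (hf.2 i)
  refine ⟨fun i => ⟨fun x hx => ?_, fun x hx m j hm => ?_, fun x hx m j hm => ?_⟩,
    fun x hx => ?_, fun hκ i x hx => ?_⟩
  all_goals obtain ⟨f, hf, hR⟩ := h x hx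
  · exact (W.analyticAt_pull i (hVU hx) (hf.1 i)).congr ((hf.2 i).mono fun y hy => hy.symm)
  · rw [(hf.2 i).self_of_nhds, pull]
    exact (famForm (f i) (W.u i x)).map_coord_zero
      (m := fun k => fderiv ℂ (W.u i) x (m k)) j hm
  · rw [hpull x hx f hf]
    exact (extDeriv (famForm (f i)) (W.u i x)).map_coord_zero
      (m := fun k => fderiv ℂ (W.u i) x (m k)) j hm
  · refine form_ext fun B => ?_
    have h1 := (W.partialDeriv_trace (hVU hx) hf.1 B (L := []) (N := r + 1)
      (by simp)).self_of_nhds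
    have h2 := (W.mem_R_iff.1 hR).2 B 0 (by simp)
    rw [Multiset.sort_zero] at h2
    have h3 : ∑ i, W.pull i (f i) x (coordVec B) = 0 := by
      refine Eq.trans h1 (Eq.trans ?_ h2)
      exact W.eqs_congr fun i A K hK => (W.jetExt_jetOf f x i A hK).symm
    rw [ContinuousAlternatingMap.sum_apply]
    simp only [(hf.2 _).self_of_nhds]
    exact h3
  · rw [hpull x hx f hf, (extDeriv_famForm_eq_zero_iff (hf.1 i)).2]
    · ext m
      simp
    · intro C
      rw [← (W.mem_R_iff.1 hR).1 hκ i C 0]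
      refine Finset.sum_congr rfl fun j _ => congrArg _ ?_
      rw [W.jetExt_jetOf f x i _ (by simpa using hr), (partialD_cons (hf.1 i _) 0 _).self_of_nhds,
        partialD_zero]

theorem exists_of_parallel {s : (Fin n → ℂ) → Jet d q p r}
    (hs : s ∈ W.parallelSections κ p r V) : ∃ σ, jetMap hV hVU κ p r σ = s := by
  classical
  -- For r = 0 the bundle is zero, and the zero relation is a preimage.
  rcases Nat.eq_zero_or_pos r with rfl | hr
  · exact ⟨0, Subsingleton.elim _ _⟩
  -- At each point the forms are assembled from the entries of order 0 of s at that point. That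
  -- these vary as functions of u_i is supplied afterwards by `exists_coeffs_of_parallel`.
  let ω : (Fin n → ℂ) → Fin d → Form n p := fun x i =>
    if x ∈ V then W.pull i (fun A _ => jetExt (s x) i A 0) x else 0
  have hω : ∀ x ∈ V, ∃ f, W.HasCoeffs ω f x ∧
      W.jetOf (r + 1) f x = W.lift κ p r x (s x) := by
    intro x hx
    choose f hf hfe using exists_coeffs_of_parallel hV hVU hb hs hr hx
    refine ⟨f, ⟨hf, fun i => ?_⟩, ?_⟩
    · filter_upwards [eventually_all.2 (hfe i), hV.mem_nhds hx] with y hy hyV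
      simp only [ω, if_pos hyV]
      ext m
      rw [pull_apply, pull_apply]
      refine Finset.sum_congr rfl fun A _ => ?_
      have h1 := hy A 0 (by simp)
      rw [partialD_zero, ← jetExt_proj _ _ _ (by simpa using hr),
        proj_lift hb (hVU hyV) (hs.1.2 y hyV)] at h1
      rw [h1]
    · funext h ⟨i, A, K⟩
      have hK : (K : Multiset (Fin q)).card = h := K.2
      have h1 := (hfe i A).self_of_nhds K (by rw [hK]; exact Nat.le_of_lt_succ h.2)
      rw [jetExt_coe] at h1
      exact h1.symm
  have hab : W.IsAbelian κ p V ω := isAbelian_of_coeffs hVU hr fun x hx => by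
    obtain ⟨f, hf, hj⟩ := hω x hx
    exact ⟨f, hf, hj ▸ lift_mem hb (hVU hx) (hs.1.2 x hx)⟩
  refine ⟨⟨ω, hab, fun x hx => funext fun i => if_neg hx⟩, funext fun x => ?_⟩
  by_cases hx : x ∈ V
  · obtain ⟨f, hf, hj⟩ := hω x hx
    refine jetAt_eq hVU hx (W.isJetAt_iff.2 ⟨f, hf, ?_⟩)
    rw [← proj_lift hb (hVU hx) (hs.1.2 x hx), ← hj]
    rfl
  · exact (jetAt_of_notMem _ hx).trans (hs.2.2 x hx).symm

theorem range_jetMap : Set.range (jetMap hV hVU κ p r) = W.parallelSections κ p r V := by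
  refine Set.Subset.antisymm ?_ fun s hs => exists_of_parallel hV hVU hb hs
  rintro _ ⟨σ, rfl⟩
  exact jetAt_mem hV hVU hb σ.2.1

end correspondence

end Web

/-! ### The connection in a frame -/

theorem fderiv_clm_apply_apply {D X Y : Type*} [NormedAddCommGroup D] [NormedSpace ℂ D]
    [NormedAddCommGroup X] [NormedSpace ℂ X] [NormedAddCommGroup Y] [NormedSpace ℂ Y]
    {A : D → X →L[ℂ] Y} {g : D → X} {y : D} (hA : DifferentiableAt ℂ A y)
    (hg : DifferentiableAt ℂ g y) (v : D) :
    fderiv ℂ (fun z => A z (g z)) y v = fderiv ℂ A y v (g y) + A y (fderiv ℂ g y v) := by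
  rw [(hA.hasFDerivAt.clm_apply hg.hasFDerivAt).fderiv, add_apply, add_comm]
  rfl

theorem fderiv_clm_apply_const {D X Y : Type*} [NormedAddCommGroup D] [NormedSpace ℂ D]
    [NormedAddCommGroup X] [NormedSpace ℂ X] [NormedAddCommGroup Y] [NormedSpace ℂ Y]
    {A : D → X →L[ℂ] Y} {y : D} (hA : DifferentiableAt ℂ A y) (w : X) :
    DifferentiableAt ℂ (fun z => A z w) y ∧
      ∀ v, fderiv ℂ (fun z => A z w) y v = fderiv ℂ A y v w :=
  ⟨hA.clm_apply (differentiableAt_const w), fun v => by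
    rw [fderiv_clm_apply_apply hA (differentiableAt_const w)]
    simp⟩

theorem fderiv_covariant {D X : Type*} [NormedAddCommGroup D] [NormedSpace ℂ D]
    [NormedAddCommGroup X] [NormedSpace ℂ X] {a : D → D →L[ℂ] X →L[ℂ] X} {g : D → X} {y : D}
    (ha : DifferentiableAt ℂ a y) (hg : AnalyticAt ℂ g y) [CompleteSpace X] (v w : D) :
    fderiv ℂ (fun z => fderiv ℂ g z w + a z w (g z)) y v =
      fderiv ℂ (fderiv ℂ g) y v w + (fderiv ℂ a y v w (g y) + a y w (fderiv ℂ g y v)) := by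
  have h1 := fderiv_clm_apply_const hg.fderiv.differentiableAt w
  have h2 := fderiv_clm_apply_const ha w
  have h3 := h2.1.clm_apply hg.differentiableAt
  rw [fderiv_fun_add h1.1 h3, add_apply, h1.2, fderiv_clm_apply_apply h2.1 hg.differentiableAt,
    h2.2]

theorem analyticAt_fderiv_apply {D E : Type*} [NormedAddCommGroup D] [NormedSpace ℂ D]
    [NormedAddCommGroup E] [NormedSpace ℂ E] [CompleteSpace E] {a : D → D →L[ℂ] E} {y : D}
    (ha : AnalyticAt ℂ a y) (v w : D) : AnalyticAt ℂ (fun z => fderiv ℂ a z v w) y :=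
  analyticAt_clm_eval (analyticAt_clm_eval ha.fderiv v) w

/-- The curvature of a matrix-valued connection form. -/
def curvForm {D X : Type*} [NormedAddCommGroup D] [NormedSpace ℂ D]
    [NormedAddCommGroup X] [NormedSpace ℂ X] (a : D → D →L[ℂ] X →L[ℂ] X) (v w y : D) :
    X →L[ℂ] X :=
  fderiv ℂ a y v w - fderiv ℂ a y w v + ((a y v).comp (a y w) - (a y w).comp (a y v))

theorem analyticAt_curvForm {D X : Type*} [NormedAddCommGroup D] [NormedSpace ℂ D]
    [NormedAddCommGroup X] [NormedSpace ℂ X] [FiniteDimensional ℂ X]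
    {a : D → D →L[ℂ] X →L[ℂ] X} {y : D} (ha : AnalyticAt ℂ a y) (v w : D) :
    AnalyticAt ℂ (curvForm a v w) y := by
  have : CompleteSpace X := FiniteDimensional.complete ℂ X
  have h1 := analyticAt_fderiv_apply ha
  have h2 : ∀ v, AnalyticAt ℂ (fun z => a z v) y := fun v => analyticAt_clm_eval ha v
  have h3 : ∀ v w, AnalyticAt ℂ (fun z => (a z v).comp (a z w)) y := fun v w =>
    analyticAt_clm_of_apply fun g =>
      analyticAt_clm_apply (A := fun z => a z v) (h2 v) (analyticAt_clm_eval (h2 w) g)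
  exact ((h1 v w).sub (h1 w v)).add ((h3 v w).sub (h3 w v))

namespace Web

variable {n d q p : ℕ} {W : Web n d q} {κ : RelKind} {r N : ℕ}

theorem nabla_congr {s t : (Fin n → ℂ) → Jet d q p r} {x : Fin n → ℂ} (h : s =ᶠ[𝓝 x] t)
    (v : Fin n → ℂ) : W.nabla κ p r s x v = W.nabla κ p r t x v := by
  rw [nabla, nabla, h.fderiv_eq, h.self_of_nhds]

/-- An analytic frame `e` of the bundle of formal abelian relations, with coordinates `c`. -/
structure IsFrame (W : Web n d q) (κ : RelKind) (V : Set (Fin n → ℂ))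
    (e : (Fin n → ℂ) → (Fin N → ℂ) →L[ℂ] Jet d q p r)
    (c : (Fin n → ℂ) → Jet d q p r →L[ℂ] (Fin N → ℂ)) : Prop where
  isOpen : IsOpen V
  subset : V ⊆ W.U
  analytic_e : AnalyticOnNhd ℂ e V
  analytic_c : AnalyticOnNhd ℂ c V
  coord : ∀ y ∈ V, ∀ g, c y (e y g) = g
  mem_iff : ∀ y ∈ V, ∀ w, w ∈ W.R κ p r y ↔ ∃ g, e y g = w

/-- The connection form in a frame. -/
def connForm (W : Web n d q) (κ : RelKind) (e : (Fin n → ℂ) → (Fin N → ℂ) →L[ℂ] Jet d q p r)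
    (c : (Fin n → ℂ) → Jet d q p r →L[ℂ] (Fin N → ℂ)) (y : Fin n → ℂ) :
    (Fin n → ℂ) →L[ℂ] (Fin N → ℂ) →L[ℂ] (Fin N → ℂ) :=
  ofCoord fun l => ofCoord fun j =>
    c y (W.nabla κ p r (fun z => e z (Pi.single j 1)) y (Pi.single l 1))

section frame

variable {V : Set (Fin n → ℂ)} {e : (Fin n → ℂ) → (Fin N → ℂ) →L[ℂ] Jet d q p r}
    {c : (Fin n → ℂ) → Jet d q p r →L[ℂ] (Fin N → ℂ)} (hF : W.IsFrame κ V e c)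
include hF

theorem IsFrame.apply_coord {y : Fin n → ℂ} (hy : y ∈ V) {w : Jet d q p r}
    (hw : w ∈ W.R κ p r y) : e y (c y w) = w := by
  obtain ⟨g, rfl⟩ := (hF.mem_iff y hy w).1 hw
  rw [hF.coord y hy]

theorem IsFrame.isSection {V' : Set (Fin n → ℂ)} (hV' : V' ⊆ V) {g : (Fin n → ℂ) → (Fin N → ℂ)}
    (hg : AnalyticOnNhd ℂ g V') : W.IsSection κ p r V' fun y => e y (g y) :=
  ⟨fun y hy => analyticAt_clm_apply (hF.analytic_e y (hV' hy)) (hg y hy),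
    fun y hy => (hF.mem_iff y (hV' hy) _).2 ⟨_, rfl⟩⟩

variable (hC : W.IsHolomorphicConnection κ p r)
include hC

theorem IsFrame.analytic_connForm : AnalyticOnNhd ℂ (W.connForm κ e c) V := fun y hy => by
  refine analyticAt_clm_of_apply fun v => analyticAt_clm_of_apply fun g => ?_
  have : (fun y => W.connForm κ e c y v g) = fun y => ∑ l, v l • ∑ j, g j •
      c y (W.nabla κ p r (fun z => e z (Pi.single j 1)) y (Pi.single l 1)) := by
    funext y
    simp only [connForm, ofCoord_apply, sum_apply, smul_apply]
  rw [this]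
  refine Finset.analyticAt_fun_sum _ fun l _ => analyticAt_const.fun_smul
    (Finset.analyticAt_fun_sum _ fun j _ => analyticAt_const.fun_smul
      (analyticAt_clm_apply (hF.analytic_c y hy) ?_))
  exact (hC.isSection V hF.isOpen hF.subset _
    (hF.isSection subset_rfl (g := fun _ => Pi.single j 1) analyticOnNhd_const) _).1 y hy

/-- Additivity, and the Leibniz rule with a constant function, make the expression linear in g, so
it is determined by the frame vectors that define `connForm`. -/
theorem IsFrame.nabla_const {y : Fin n → ℂ} (hy : y ∈ V) (g : Fin N → ℂ) (v : Fin n → ℂ) :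
    W.nabla κ p r (fun z => e z g) y v = e y (W.connForm κ e c y v g) := by
  have hsec : ∀ g, W.IsSection κ p r V fun z => e z g := fun g =>
    hF.isSection subset_rfl (g := fun _ => g) analyticOnNhd_const
  have hlin : IsLinearMap ℂ fun g => c y (W.nabla κ p r (fun z => e z g) y v) := by
    refine ⟨fun g g' => ?_, fun a g => ?_⟩
    · simp only [map_add]
      rw [hC.add V hF.isOpen hF.subset _ _ (hsec g) (hsec g') y hy, map_add]
    · simp only [map_smul]
      have h := hC.leibniz V hF.isOpen hF.subset _ (hsec g) (fun _ => a) analyticOnNhd_const y hy v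
      rw [h, map_add, map_smul]
      simp
  have h1 := fderiv_eq_sum_single (LinearMap.toContinuousLinearMap (hlin.mk' _)) g
  simp only [LinearMap.coe_toContinuousLinearMap', IsLinearMap.mk'_apply] at h1
  have h2 : ∀ j, c y (W.nabla κ p r (fun z => e z (Pi.single j 1)) y v) = ∑ l, v l •
      c y (W.nabla κ p r (fun z => e z (Pi.single j 1)) y (Pi.single l 1)) := by
    intro j
    have h := fderiv_eq_sum_single ((c y).comp (LinearMap.toContinuousLinearMap
      ((hC.linear (fun z => e z (Pi.single j 1)) y).mk' _))) v
    simpa only [ContinuousLinearMap.comp_apply, LinearMap.coe_toContinuousLinearMap',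
      IsLinearMap.mk'_apply] using h
  have h3 : e y (c y (W.nabla κ p r (fun z => e z g) y v)) = W.nabla κ p r (fun z => e z g) y v :=
    hF.apply_coord hy ((hC.isSection V hF.isOpen hF.subset _ (hsec g) v).2 y hy)
  rw [← h3, h1]
  congr 1
  simp only [h2, connForm, ofCoord_apply, sum_apply, smul_apply, Finset.smul_sum]
  rw [Finset.sum_comm]
  refine Finset.sum_congr rfl fun l _ => Finset.sum_congr rfl fun j _ => smul_comm _ _ _

theorem IsFrame.nabla_eq {y : Fin n → ℂ} (hy : y ∈ V) {g : (Fin n → ℂ) → (Fin N → ℂ)}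
    (hg : DifferentiableAt ℂ g y) (v : Fin n → ℂ) :
    W.nabla κ p r (fun z => e z (g z)) y v =
      e y (fderiv ℂ g y v + W.connForm κ e c y v (g y)) := by
  have he := (hF.analytic_e y hy).differentiableAt
  rw [map_add, ← hF.nabla_const hC hy, nabla, nabla, (he.hasFDerivAt.clm_apply hg.hasFDerivAt).fderiv,
    (he.hasFDerivAt.clm_apply (hasFDerivAt_const (g y) y)).fderiv]
  simp [add_sub_assoc]

theorem IsFrame.nabla_eq_coord {V' : Set (Fin n → ℂ)} (hV' : IsOpen V')
    {s : (Fin n → ℂ) → Jet d q p r} (hs : W.IsSection κ p r V' s) {y : Fin n → ℂ} (hy : y ∈ V)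
    (hy' : y ∈ V') (v : Fin n → ℂ) : W.nabla κ p r s y v =
      e y (fderiv ℂ (fun z => c z (s z)) y v + W.connForm κ e c y v (c y (s y))) := by
  rw [← hF.nabla_eq hC hy
    (analyticAt_clm_apply (hF.analytic_c y hy) (hs.1 y hy')).differentiableAt]
  refine nabla_congr ?_ v
  filter_upwards [hF.isOpen.mem_nhds hy, hV'.mem_nhds hy'] with z hz hz'
  exact (hF.apply_coord hz (hs.2 z hz')).symm

/-- Expanding the iterated covariant derivatives in coordinates, the second derivatives cancel by
symmetry and the terms containing first derivatives of the coordinates cancel in pairs; the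
curvature is tensorial. -/
theorem IsFrame.curvature_eq {V' : Set (Fin n → ℂ)} (hV' : IsOpen V')
    {s : (Fin n → ℂ) → Jet d q p r} (hs : W.IsSection κ p r V' s) {y : Fin n → ℂ} (hy : y ∈ V)
    (hy' : y ∈ V') (v w : Fin n → ℂ) : W.curvature κ p r s v w y =
      e y (curvForm (W.connForm κ e c) v w y (c y (s y))) := by
  have ha := (hF.analytic_connForm hC y hy).differentiableAt
  have hg : AnalyticAt ℂ (fun z => c z (s z)) y :=
    analyticAt_clm_apply (hF.analytic_c y hy) (hs.1 y hy')
  have h1 : ∀ v w, W.nabla κ p r (fun z => W.nabla κ p r s z w) y v =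
      e y (fderiv ℂ (fderiv ℂ fun z => c z (s z)) y v w +
        (fderiv ℂ (W.connForm κ e c) y v w (c y (s y)) +
          W.connForm κ e c y w (fderiv ℂ (fun z => c z (s z)) y v)) +
        W.connForm κ e c y v (fderiv ℂ (fun z => c z (s z)) y w +
          W.connForm κ e c y w (c y (s y)))) := by
    intro v w
    have h2 : (fun z => W.nabla κ p r s z w) =ᶠ[𝓝 y] fun z => e z
        (fderiv ℂ (fun z => c z (s z)) z w + W.connForm κ e c z w (c z (s z))) := by
      filter_upwards [hF.isOpen.mem_nhds hy, hV'.mem_nhds hy'] with z hz hz'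
      exact hF.nabla_eq_coord hC hV' hs hz hz' w
    have h3 : AnalyticAt ℂ (fun z => fderiv ℂ (fun z => c z (s z)) z w +
        W.connForm κ e c z w (c z (s z))) y :=
      (analyticAt_clm_eval hg.fderiv w).add
        (analyticAt_clm_apply (analyticAt_clm_eval (hF.analytic_connForm hC y hy) w) hg)
    exact (nabla_congr h2 v).trans ((hF.nabla_eq hC hy h3.differentiableAt v).trans
      (congrArg (fun t => e y (t + W.connForm κ e c y v _)) (fderiv_covariant ha hg v w)))
  rw [curvature, h1, h1, ← map_sub]
  have hsymm : fderiv ℂ (fderiv ℂ fun z => c z (s z)) y v w =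
      fderiv ℂ (fderiv ℂ fun z => c z (s z)) y w v :=
    (hg.contDiffAt (n := ⊤)).isSymmSndFDerivAt (by simp) v w
  congr 1
  simp only [curvForm, add_apply, sub_apply, ContinuousLinearMap.comp_apply, map_add, hsymm]
  abel

end frame

end Web

/-! ### Flatness -/

namespace Web

variable {n d q p : ℕ} {W : Web n d q} {κ : RelKind} {r N : ℕ}

theorem fderiv_fun_neg_apply {D E : Type*} [NormedAddCommGroup D] [NormedSpace ℂ D]
    [NormedAddCommGroup E] [NormedSpace ℂ E] (a : D → E) (y v : D) :
    fderiv ℂ (fun z => -a z) y v = -fderiv ℂ a y v := by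
  rw [fderiv_fun_neg]
  rfl

/-- The curvature vanishes at a point. -/
def IsFlatAt (W : Web n d q) (κ : RelKind) (p r : ℕ) (x : Fin n → ℂ) : Prop :=
  ∀ V, IsOpen V → V ⊆ W.U → ∀ s, W.IsSection κ p r V s → ∀ v w, x ∈ V →
    W.curvature κ p r s v w x = 0

/-- Sections with constant coordinates reach every vector of the fibre, so they suffice to test the
curvature. -/
theorem IsFrame.isFlatAt_iff {V : Set (Fin n → ℂ)}
    {e : (Fin n → ℂ) → (Fin N → ℂ) →L[ℂ] Jet d q p r}
    {c : (Fin n → ℂ) → Jet d q p r →L[ℂ] (Fin N → ℂ)} (hF : W.IsFrame κ V e c)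
    (hC : W.IsHolomorphicConnection κ p r) {y : Fin n → ℂ} (hy : y ∈ V) :
    W.IsFlatAt κ p r y ↔ ∀ v w, curvForm (W.connForm κ e c) v w y = 0 := by
  constructor
  · intro h v w
    ext1 g
    have hs := hF.isSection subset_rfl (g := fun _ => g) analyticOnNhd_const
    have h1 := h V hF.isOpen hF.subset _ hs v w hy
    rw [hF.curvature_eq hC hF.isOpen hs hy hy, hF.coord y hy] at h1
    rw [← hF.coord y hy (curvForm (W.connForm κ e c) v w y g), h1, map_zero]
    rfl
  · intro h V' hV' _ s hs v w hy'
    rw [hF.curvature_eq hC hV' hs hy hy', h]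
    exact map_zero _

theorem exists_isFrame (hE : IsHolomorphicSubbundle W.U (W.R κ p r) N) {x : Fin n → ℂ}
    (hx : x ∈ W.U) : ∃ (V : Set (Fin n → ℂ)) (e : (Fin n → ℂ) → (Fin N → ℂ) →L[ℂ] Jet d q p r)
      (c : (Fin n → ℂ) → Jet d q p r →L[ℂ] (Fin N → ℂ)), x ∈ V ∧ W.IsFrame κ V e c := by
  obtain ⟨V, h1, h2, h3, e, c, h4, h5, h6, h7⟩ := hE.exists_frame hx
  exact ⟨V, e, c, h2, h1, h3, h4, h5, h6, h7⟩

section flat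

variable (hE : IsHolomorphicSubbundle W.U (W.R κ p r) N) (hC : W.IsHolomorphicConnection κ p r)
include hE hC

/-- By analytic continuation, a connection that is flat near a point is flat. -/
theorem isFlat_of_eventually {m : Fin n → ℂ} (hm : m ∈ W.U)
    (h : ∀ᶠ y in 𝓝 m, W.IsFlatAt κ p r y) : W.IsFlat κ p r := by
  -- The set of points near which the connection is flat is open. It is closed in U by the identity
  -- theorem for `curvForm` on a ball around a limit point, and U is connected.
  have hZ : W.U ⊆ {x | ∀ᶠ y in 𝓝 x, W.IsFlatAt κ p r y} := by
    refine W.isConnected_U.isPreconnected.subset_of_closure_inter_subset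
      isOpen_setOfPred_eventually_nhds ⟨m, hm, h⟩ ?_
    rintro x ⟨hxc, hxU⟩
    obtain ⟨V, e, c, hxV, hF⟩ := exists_isFrame hE hxU
    obtain ⟨ε, hε, hb⟩ := Metric.isOpen_iff.1 hF.isOpen x hxV
    obtain ⟨z, hz, hzZ⟩ := mem_closure_iff_nhds.1 hxc _ (Metric.ball_mem_nhds x hε)
    have h0 : ∀ v w, Set.EqOn (curvForm (W.connForm κ e c) v w) 0 (Metric.ball x ε) := by
      intro v w
      refine AnalyticOnNhd.eqOn_zero_of_preconnected_of_eventuallyEq_zero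
        (fun y hy => analyticAt_curvForm (hF.analytic_connForm hC y (hb hy)) v w)
        (convex_ball x ε).isPreconnected hz ?_
      filter_upwards [hzZ, Metric.isOpen_ball.mem_nhds hz] with y hy hyb
      exact (hF.isFlatAt_iff hC (hb hyb)).1 hy v w
    filter_upwards [Metric.ball_mem_nhds x hε] with y hy
    exact (hF.isFlatAt_iff hC (hb hy)).2 fun v w => h0 v w hy
  intro V hV hVU s hs v w x hx
  exact (hZ (hVU hx)).self_of_nhds V hV hVU s hs v w hx

/-- A parallel section that vanishes at a point vanishes near it. -/
theorem eventually_eq_zero_of_parallel {V' : Set (Fin n → ℂ)} (hV' : IsOpen V') (hVU : V' ⊆ W.U)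
    {s : (Fin n → ℂ) → Jet d q p r} (hs : s ∈ W.parallelSections κ p r V') {m : Fin n → ℂ}
    (hm : m ∈ V') (h0 : s m = 0) : ∀ᶠ y in 𝓝 m, s y = 0 := by
  obtain ⟨V, e, c, hmV, hF⟩ := exists_isFrame hE (hVU hm)
  have hg : ∀ y ∈ V, y ∈ V' → AnalyticAt ℂ (fun z => c z (s z)) y := fun y hy hy' =>
    analyticAt_clm_apply (hF.analytic_c y hy) (hs.1.1 y hy')
  have h1 : ∀ᶠ y in 𝓝 m, c y (s y) = 0 := by
    refine eventually_eq_zero_of_linear_system (g := fun y => c y (s y))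
      (hF.analytic_connForm hC m hmV).neg ?_ ?_ (by simp [h0])
    · filter_upwards [hF.isOpen.mem_nhds hmV, hV'.mem_nhds hm] with y hy hy'
      exact (hg y hy hy').differentiableAt
    · filter_upwards [hF.isOpen.mem_nhds hmV, hV'.mem_nhds hm] with y hy hy' v
      have h2 := hF.nabla_eq_coord hC hV' hs.1 hy hy' v
      rw [hs.2.1 y hy'] at h2
      have h3 := congrArg (c y) h2
      rw [hF.coord y hy, map_zero] at h3
      -- In the frame, parallelism reads dg = -a g with a the connection form: a linear system with
      -- zero initial value.
      exact eq_neg_of_add_eq_zero_left h3.symm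
  filter_upwards [h1, hF.isOpen.mem_nhds hmV, hV'.mem_nhds hm] with y hy hyV hyV'
  rw [← hF.apply_coord hyV (hs.1.2 y hyV'), hy, map_zero]

omit hE in
theorem curvature_of_parallel {V' : Set (Fin n → ℂ)} (hV' : IsOpen V') (hVU : V' ⊆ W.U)
    {s : (Fin n → ℂ) → Jet d q p r} (hs : s ∈ W.parallelSections κ p r V') {y : Fin n → ℂ}
    (hy : y ∈ V') (v w : Fin n → ℂ) : W.curvature κ p r s v w y = 0 := by
  have h0 : ∀ v w, W.nabla κ p r (fun z => W.nabla κ p r s z w) y v = 0 := by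
    intro v w
    -- The zero section is written 0 • s so that the Leibniz rule gives its covariant derivative.
    have h1 : (fun z => W.nabla κ p r s z w) =ᶠ[𝓝 y] fun z => (0 : ℂ) • s z := by
      filter_upwards [hV'.mem_nhds hy] with z hz
      rw [hs.2.1 z hz, zero_smul]
    rw [nabla_congr h1, hC.leibniz V' hV' hVU s hs.1 (fun _ => 0) analyticOnNhd_const y hy]
    simp
  rw [curvature, h0, h0, sub_zero]

/-- In a frame the equation is dg = B g with B = -a, and its integrability condition is the
vanishing of `curvForm`. The fundamental solution, equal to 1 at m, is applied to the coordinates of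
w₀. -/
theorem exists_parallel_of_flat (hflat : W.IsFlat κ p r) {m : Fin n → ℂ} (hm : m ∈ W.U)
    {w₀ : Jet d q p r} (hw₀ : w₀ ∈ W.R κ p r m) :
    ∃ V' : Set (Fin n → ℂ), IsOpen V' ∧ m ∈ V' ∧ V' ⊆ W.U ∧
      ∃ s ∈ W.parallelSections κ p r V', s m = w₀ := by
  classical
  obtain ⟨V, e, c, hmV, hF⟩ := exists_isFrame hE hm
  let B : (Fin n → ℂ) → (Fin n → ℂ) →L[ℂ] ((Fin N → ℂ) →L[ℂ] (Fin N → ℂ)) := fun y =>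
    -W.connForm κ e c y
  have hB : AnalyticAt ℂ B m := (hF.analytic_connForm hC m hmV).neg
  have hBflat : ∀ᶠ y in 𝓝 m, ∀ v w, fderiv ℂ B y v w + B y w * B y v =
      fderiv ℂ B y w v + B y v * B y w := by
    filter_upwards [hF.isOpen.mem_nhds hmV] with y hy v w
    have h1 := (hF.isFlatAt_iff hC hy).1
      (fun V hV hVU s hs v w hy => hflat V hV hVU s hs v w y hy) v w
    have h2 := fderiv_fun_neg_apply (W.connForm κ e c) y
    simp only [B, h2, neg_apply]
    rw [← sub_eq_zero, ← neg_eq_zero, ← h1, curvForm]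
    simp only [ContinuousLinearMap.mul_def, ContinuousLinearMap.neg_comp,
      ContinuousLinearMap.comp_neg, neg_neg]
    abel
  obtain ⟨S, hS, hSm, hSd⟩ := exists_fundamental_solution hB hBflat
  obtain ⟨V', hV'sub, hV', hmV'⟩ := mem_nhds_iff.1
    ((hS.eventually_analyticAt.and hSd).and (hF.isOpen.mem_nhds hmV))
  have hV'V : V' ⊆ V := fun y hy => (hV'sub hy).2
  have hg : AnalyticOnNhd ℂ (fun y => S y (c m w₀)) V' := fun y hy =>
    analyticAt_clm_eval (hV'sub hy).1.1 _
  have hs := hF.isSection hV'V hg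
  have heq : ∀ y ∈ V', (fun y => if y ∈ V' then e y (S y (c m w₀)) else 0) =ᶠ[𝓝 y]
      fun y => e y (S y (c m w₀)) := fun y hy => by
    filter_upwards [hV'.mem_nhds hy] with z hz using if_pos hz
  refine ⟨V', hV', hmV', hV'V.trans hF.subset, fun y => if y ∈ V' then e y (S y (c m w₀)) else 0,
    ⟨⟨fun y hy => (hs.1 y hy).congr (heq y hy).symm, fun y hy => ?_⟩, fun y hy v => ?_,
      fun y hy => if_neg hy⟩, ?_⟩
  · beta_reduce
    rw [if_pos hy]
    exact hs.2 y hy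
  · rw [nabla_congr (heq y hy), hF.nabla_eq hC (hV'V hy) (hg y hy).differentiableAt,
      (fderiv_clm_apply_const (hV'sub hy).1.1.differentiableAt (c m w₀)).2, (hV'sub hy).1.2]
    simp [B]
  · beta_reduce
    rw [if_pos hmV', hSm]
    exact hF.apply_coord hmV hw₀

end flat

end Web

/-! ### The rank -/

namespace Web

variable {n d q p : ℕ} {W : Web n d q} {κ : RelKind} {r N : ℕ}

theorem IsJetAt.congr {ω ω' : (Fin n → ℂ) → Fin d → Form n p} {x : Fin n → ℂ} {w : Jet d q p r}
    (h : W.IsJetAt r ω x w) (hω : ω =ᶠ[𝓝 x] ω') : W.IsJetAt r ω' x w := by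
  obtain ⟨f, hf, hw⟩ := W.isJetAt_iff.1 h
  refine W.isJetAt_iff.2 ⟨f, ⟨hf.1, fun i => ?_⟩, hw⟩
  filter_upwards [hf.2 i, hω] with y h1 h2
  rw [← h2, h1]

/-- `w` is the jet at `m` of a germ of abelian relation. -/
def IsGermJet (W : Web n d q) (κ : RelKind) (m : Fin n → ℂ) (g : Germ (𝓝 m) (Fin d → Form n p))
    (w : Jet d q p r) : Prop :=
  ∃ (V : Set (Fin n → ℂ)) (ω : (Fin n → ℂ) → Fin d → Form n p), IsOpen V ∧ m ∈ V ∧ V ⊆ W.U ∧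
    W.IsAbelian κ p V ω ∧ g = (ω : Germ (𝓝 m) (Fin d → Form n p)) ∧ W.IsJetAt r ω m w

theorem exists_isGermJet {m : Fin n → ℂ} (hm : m ∈ W.U) (r : ℕ)
    {g : Germ (𝓝 m) (Fin d → Form n p)} (hg : g ∈ W.AbGerm κ p m) :
    ∃ w : Jet d q p r, W.IsGermJet κ m g w := by
  obtain ⟨V, ω, hV, hmV, h, rfl⟩ := hg
  have hV' := hV.inter W.isOpen_U
  have h' := h.mono (Set.inter_subset_left (t := W.U))
  exact ⟨_, V ∩ W.U, ω, hV', ⟨hmV, hm⟩, Set.inter_subset_right, h', rfl,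
    isJetAt_jetAt hV' Set.inter_subset_right h' ⟨hmV, hm⟩⟩

theorem IsGermJet.unique {m : Fin n → ℂ} {g : Germ (𝓝 m) (Fin d → Form n p)}
    {w w' : Jet d q p r} (h : W.IsGermJet κ m g w) (h' : W.IsGermJet κ m g w') : w = w' := by
  obtain ⟨V, ω, _, hmV, hVU, _, hg, hj⟩ := h
  obtain ⟨V', ω', _, _, _, _, hg', hj'⟩ := h'
  exact hj.unique (hVU hmV) (hj'.congr (Germ.coe_eq.1 (hg'.symm.trans hg)))

theorem IsGermJet.add {m : Fin n → ℂ} {g g' : Germ (𝓝 m) (Fin d → Form n p)}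
    {w w' : Jet d q p r} (h : W.IsGermJet κ m g w) (h' : W.IsGermJet κ m g' w') :
    W.IsGermJet κ m (g + g') (w + w') := by
  obtain ⟨V, ω, hV, hmV, hVU, hω, rfl, hj⟩ := h
  obtain ⟨V', ω', hV', hmV', _, hω', rfl, hj'⟩ := h'
  refine ⟨V ∩ V', ω + ω', hV.inter hV', ⟨hmV, hmV'⟩, Set.inter_subset_left.trans hVU,
    (hω.mono Set.inter_subset_left).add (hω'.mono Set.inter_subset_right), rfl, ?_⟩
  have h1 := hj.linear hj' 1 1
  simp only [one_smul] at h1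
  exact h1

theorem IsGermJet.smul {m : Fin n → ℂ} {g : Germ (𝓝 m) (Fin d → Form n p)}
    {w : Jet d q p r} (h : W.IsGermJet κ m g w) (a : ℂ) : W.IsGermJet κ m (a • g) (a • w) := by
  obtain ⟨V, ω, hV, hmV, hVU, hω, rfl, hj⟩ := h
  refine ⟨V, a • ω, hV, hmV, hVU, hω.smul a, rfl, ?_⟩
  have h1 := hj.linear hj a 0
  have e : a • ω + (0 : ℂ) • ω = a • ω := by
    funext y i
    ext m
    simp
  rwa [e, zero_smul, add_zero] at h1

theorem IsGermJet.mem {m : Fin n → ℂ} {g : Germ (𝓝 m) (Fin d → Form n p)}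
    {w : Jet d q p r} (h : W.IsGermJet κ m g w) : w ∈ W.R κ p r m := by
  obtain ⟨V, ω, hV, hmV, hVU, hω, rfl, hj⟩ := h
  obtain ⟨f, hf, rfl⟩ := W.isJetAt_iff.1 hj
  exact hω.jetOf_mem hV hVU hmV hf r

section rank

variable (hb : ∀ x ∈ W.U, Set.BijOn Jet.proj
  (W.R κ p (r + 1) x : Set (Jet d q p (r + 1))) (W.R κ p r x : Set (Jet d q p r)))
  (hE : IsHolomorphicSubbundle W.U (W.R κ p r) N) (hC : W.IsHolomorphicConnection κ p r)
include hb hE hC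

/-- The jet is a parallel section vanishing at m, so it vanishes near m, and with it the forms. -/
theorem IsGermJet.eq_zero {m : Fin n → ℂ} {g : Germ (𝓝 m) (Fin d → Form n p)}
    (h : W.IsGermJet κ m g (0 : Jet d q p r)) : g = 0 := by
  obtain ⟨V, ω, hV, hmV, hVU, hω, rfl, hj⟩ := h
  have h1 := eventually_eq_zero_of_parallel hE hC hV hVU (jetAt_mem hV hVU hb hω) hmV
    (jetAt_eq hVU hmV hj)
  refine Germ.coe_eq.2 ?_
  filter_upwards [h1, hV.mem_nhds hmV] with y hy hyV
  refine hω.eq_zero_of_jet hV hVU hb hyV ?_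
  rw [← hy]
  exact isJetAt_jetAt hV hVU hω hyV

theorem IsGermJet.injective {m : Fin n → ℂ} {g g' : Germ (𝓝 m) (Fin d → Form n p)}
    {w : Jet d q p r} (h : W.IsGermJet κ m g w) (h' : W.IsGermJet κ m g' w) : g = g' := by
  have h1 := h.add (h'.smul (-1))
  rw [neg_one_smul, add_neg_cancel] at h1
  have h2 := h1.eq_zero hb hE hC
  induction g, g' using Germ.inductionOn₂ with
  | _ ω ω' =>
    have h4 : ω + (-1 : ℂ) • ω' =ᶠ[𝓝 m] 0 := Germ.coe_eq.1 h2
    refine Germ.coe_eq.2 (h4.mono fun y hy => ?_)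
    funext i
    ext v
    have h3 := DFunLike.congr_fun (congrFun hy i) v
    simpa [← sub_eq_add_neg, sub_eq_zero] using h3

/-- The rank is the dimension of the space of jets of germs of abelian relations. -/
theorem exists_rankAt_eq {m : Fin n → ℂ} (hm : m ∈ W.U) :
    ∃ S : Submodule ℂ (Jet d q p r), S ≤ W.R κ p r m ∧
      W.rankAt κ p m = (Module.finrank ℂ S : ℕ∞) ∧
      ∀ w, w ∈ S ↔ ∃ g ∈ W.AbGerm κ p m, W.IsGermJet κ m g w := by
  choose ev hev using fun g : W.AbGerm κ p m => exists_isGermJet hm r g.2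
  let E : W.AbGerm κ p m →ₗ[ℂ] Jet d q p r :=
    { toFun := ev
      map_add' := fun g g' => (hev (g + g')).unique ((hev g).add (hev g'))
      map_smul' := fun a g => (hev (a • g)).unique ((hev g).smul a) }
  have hinj : Function.Injective E := fun g g' h => by
    have h0 : ev g = ev g' := h
    exact Subtype.ext (IsGermJet.injective hb hE hC (hev g) (h0 ▸ hev g'))
  refine ⟨LinearMap.range E, ?_, ?_, fun w => ⟨?_, ?_⟩⟩
  · rintro _ ⟨g, rfl⟩
    exact (hev g).mem
  · rw [rankAt, (LinearEquiv.ofInjective E hinj).rank_eq, ← Module.finrank_eq_rank]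
    exact Cardinal.toENat_nat _
  · rintro ⟨g, rfl⟩
    exact ⟨g, g.2, hev g⟩
  · rintro ⟨g, hg, hw⟩
    exact ⟨⟨g, hg⟩, (hev ⟨g, hg⟩).unique hw⟩

theorem rankAt_le {m : Fin n → ℂ} (hm : m ∈ W.U) (hN : Module.finrank ℂ (W.R κ p r m) = N) :
    W.rankAt κ p m ≤ N := by
  obtain ⟨S, hS, hr, -⟩ := exists_rankAt_eq hb hE hC hm
  rw [hr, ← hN]
  exact_mod_cast Submodule.finrank_mono hS

theorem rankAt_eq_iff {m : Fin n → ℂ} (hm : m ∈ W.U)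
    (hN : Module.finrank ℂ (W.R κ p r m) = N) :
    W.rankAt κ p m = N ↔ ∀ w ∈ W.R κ p r m,
      ∃ g ∈ W.AbGerm κ p m, W.IsGermJet κ m g w := by
  obtain ⟨S, hS, hr, hmem⟩ := exists_rankAt_eq hb hE hC hm
  rw [hr, ← hN, Nat.cast_inj]
  simp only [← hmem]
  exact ⟨fun h => (Submodule.eq_of_le_of_finrank_eq hS h).ge, fun h => by rw [hS.antisymm h]⟩

theorem rankAt_eq_of_isFlat (hflat : W.IsFlat κ p r) {m : Fin n → ℂ} (hm : m ∈ W.U)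
    (hN : Module.finrank ℂ (W.R κ p r m) = N) : W.rankAt κ p m = N := by
  refine (rankAt_eq_iff hb hE hC hm hN).2 fun w hw => ?_
  obtain ⟨V, hV, hmV, hVU, s, hs, rfl⟩ := exists_parallel_of_flat hE hC hflat hm hw
  obtain ⟨σ, hσ⟩ := exists_of_parallel hV hVU hb hs
  refine ⟨_, ⟨V, σ, hV, hmV, σ.2.1, rfl⟩, V, σ, hV, hmV, hVU, σ.2.1, rfl, ?_⟩
  rw [← hσ]
  exact isJetAt_jetAt hV hVU σ.2.1 hmV

/-- Full rank at m gives N parallel sections through the frame vectors at m. The matrix G of their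
coordinates is the identity at m, hence invertible nearby. The curvature kills each of its columns,
so it is zero. -/
theorem eventually_isFlatAt {m : Fin n → ℂ} (hm : m ∈ W.U)
    (hN : Module.finrank ℂ (W.R κ p r m) = N) (hrank : W.rankAt κ p m = N) :
    ∀ᶠ y in 𝓝 m, W.IsFlatAt κ p r y := by
  obtain ⟨V, e, c, hmV, hF⟩ := exists_isFrame hE hm
  have h1 : ∀ j : Fin N, ∃ (V' : Set (Fin n → ℂ)) (s : (Fin n → ℂ) → Jet d q p r), IsOpen V' ∧
      m ∈ V' ∧ V' ⊆ W.U ∧ s ∈ W.parallelSections κ p r V' ∧ s m = e m (Pi.single j 1) := by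
    intro j
    obtain ⟨_, -, V', ω, hV', hmV', hVU, hω, -, hj⟩ := (rankAt_eq_iff hb hE hC hm hN).1 hrank
      (e m (Pi.single j 1)) ((hF.mem_iff m hmV _).2 ⟨_, rfl⟩)
    exact ⟨V', W.jetAt r V' ω, hV', hmV', hVU, jetAt_mem hV' hVU hb hω, jetAt_eq hVU hmV' hj⟩
  choose V' s hV' hmV' hVU hs hsm using h1
  let G : (Fin n → ℂ) → (Fin N → ℂ) →L[ℂ] (Fin N → ℂ) := fun y => ofCoord fun j => c y (s j y)
  have hG : AnalyticAt ℂ G m := analyticAt_clm_of_apply fun g => by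
    simp only [G, ofCoord_apply]
    exact Finset.analyticAt_fun_sum _ fun j _ => analyticAt_const.fun_smul
      (analyticAt_clm_apply (hF.analytic_c m hmV) ((hs j).1.1 m (hmV' j)))
  have hGm : G m = 1 := by
    ext1 g
    simp only [G, ofCoord_apply, hsm, hF.coord m hmV]
    exact (pi_eq_sum_univ' g).symm
  have hunit : ∀ᶠ y in 𝓝 m, IsUnit (G y) :=
    hG.continuousAt.eventually (Units.isOpen.mem_nhds (hGm ▸ isUnit_one))
  filter_upwards [hunit, hF.isOpen.mem_nhds hmV,
    eventually_all.2 fun j => (hV' j).mem_nhds (hmV' j)] with y hu hy hy'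
  rw [hF.isFlatAt_iff hC hy]
  intro v w
  have h2 : ∀ j, curvForm (W.connForm κ e c) v w y (c y (s j y)) = 0 := by
    intro j
    have h3 := curvature_of_parallel hC (hV' j) (hVU j) (hs j) (hy' j) v w
    rw [hF.curvature_eq hC (hV' j) (hs j).1 hy (hy' j)] at h3
    rw [← hF.coord y hy (curvForm (W.connForm κ e c) v w y (c y (s j y))), h3, map_zero]
  have h4 : curvForm (W.connForm κ e c) v w y * G y = 0 := by
    ext1 g
    simp only [G, mul_apply_eq_comp, ofCoord_apply, map_sum, map_smul, h2, smul_zero,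
      Finset.sum_const_zero, zero_apply]
  exact (hu.mul_left_eq_zero).1 h4

/-- A supremum of naturals bounded by N that equals N is attained. So one point has full rank,
flatness holds near it, and analytic continuation does the rest. -/
theorem rank_eq_iff_isFlat (hN : ∀ m ∈ W.U, Module.finrank ℂ (W.R κ p r m) = N) :
    W.rank κ p = N ↔ W.IsFlat κ p r := by
  obtain ⟨m₀, hm₀⟩ := W.isConnected_U.nonempty
  have hle : ∀ m ∈ W.U, W.rankAt κ p m ≤ N := fun m hm => rankAt_le hb hE hC hm (hN m hm)
  constructor
  · intro h
    obtain ⟨m, hm, hrank⟩ : ∃ m ∈ W.U, W.rankAt κ p m = N := by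
      by_contra! hne
      -- The case N = 0 is separate because the bound N - 1 on ranks smaller than N is strict only
      -- for N > 0.
      rcases Nat.eq_zero_or_pos N with rfl | hpos
      · exact hne m₀ hm₀ (le_antisymm (hle m₀ hm₀) (by simp))
      · have h1 : W.rank κ p ≤ ((N - 1 : ℕ) : ℕ∞) := iSup₂_le fun m hm => by
          have h2 := lt_of_le_of_ne (hle m hm) (hne m hm)
          obtain ⟨k, hk⟩ := ENat.ne_top_iff_exists.1 (ne_top_of_lt h2)
          rw [← hk] at h2 ⊢
          have h3 : k < N := by exact_mod_cast h2
          exact_mod_cast (by omega : k ≤ N - 1)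
        rw [h] at h1
        have h2 : N ≤ N - 1 := by exact_mod_cast h1
        omega
    exact isFlat_of_eventually hE hC hm (eventually_isFlatAt hb hE hC hm (hN m hm) hrank)
  · intro h
    refine le_antisymm (iSup₂_le hle) ?_
    rw [← rankAt_eq_of_isFlat hb hE hC h hm₀ (hN m₀ hm₀)]
    exact le_iSup₂ (f := fun m (_ : m ∈ W.U) => W.rankAt κ p m) m₀ hm₀

end rank

end Web

end WebTheory

end

theorem mainTheorem3 {n d q p : ℕ} (hp : 1 ≤ p) (hpq : p ≤ q) (hqn : q < n)
    (W : WebTheory.Web n d q) (κ : WebTheory.RelKind)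
    (hord : W.IsOrdinary κ p) (hcal : WebTheory.IsCalibrated κ n d q p) :
    let k₀ := WebTheory.kZero κ n d q p
    let N := WebTheory.maxRank κ n d q p
    (WebTheory.IsHolomorphicSubbundle W.U (W.R κ p k₀) N ∧
      WebTheory.IsHolomorphicSubbundle W.U (W.R κ p (k₀ + 1)) N ∧
      (∀ x ∈ W.U, Set.BijOn WebTheory.Jet.proj
        (W.R κ p (k₀ + 1) x : Set (WebTheory.Jet d q p (k₀ + 1)))
        (W.R κ p k₀ x : Set (WebTheory.Jet d q p k₀))) ∧
      W.IsHolomorphicConnection κ p k₀) ∧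
    (∀ V : Set (Fin n → ℂ), IsOpen V → V ⊆ W.U →
      ∃ Φ : W.Ab κ p V →ₗ[ℂ] ((Fin n → ℂ) → WebTheory.Jet d q p k₀),
        (∀ σ : W.Ab κ p V, ∀ x ∈ V, W.IsJetAt k₀ (σ : (Fin n → ℂ) → Fin d → WebTheory.Form n p) x (Φ σ x)) ∧
        Function.Injective Φ ∧
        Set.range Φ = W.parallelSections κ p k₀ V) ∧
    (W.rank κ p = (N : ℕ∞) ↔ W.IsFlat κ p k₀) := by
  have hb : ∀ x ∈ W.U, Set.BijOn WebTheory.Jet.proj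
      (W.R κ p (WebTheory.kZero κ n d q p + 1) x :
        Set (WebTheory.Jet d q p (WebTheory.kZero κ n d q p + 1)))
      (W.R κ p (WebTheory.kZero κ n d q p) x :
        Set (WebTheory.Jet d q p (WebTheory.kZero κ n d q p))) :=
    fun x hx => WebTheory.Web.bijOn_proj hp hpq hqn hord hcal hx
  have hN : ∀ x ∈ W.U, Module.finrank ℂ (W.R κ p (WebTheory.kZero κ n d q p) x) =
      WebTheory.maxRank κ n d q p :=
    fun x hx => WebTheory.Web.finrank_R hp hpq hqn hord hcal hx
  have hE := W.isHolomorphicSubbundle_R hN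
  have hE' := W.isHolomorphicSubbundle_R fun x hx =>
    WebTheory.Web.finrank_R_kZero_succ hp hpq hqn hord hcal hx
  have hC := WebTheory.Web.isHolomorphicConnection hb hE'
  refine ⟨⟨hE, hE', hb, hC⟩, fun V hV hVU => ?_, WebTheory.Web.rank_eq_iff_isFlat hb hE hC hN⟩
  exact ⟨WebTheory.Web.jetMap hV hVU κ p _,
    fun σ x hx => WebTheory.Web.isJetAt_jetAt hV hVU σ.2.1 hx,
    WebTheory.Web.jetMap_injective hV hVU hb, WebTheory.Web.range_jetMap hV hVU hb⟩
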